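/- A \emph{drawing} of a graph represents its vertices by distinct points of the plane and every edge by a simple continuous arc joining the two corresponding points and passing through no other vertex; drawings are noncrossing, i.e. the arcs of two different edges have no interior point in common. A graph is planar if it has such a drawing. The \emph{planar slope number} of a planar graph is the smallest $s$ such that the graph has a drawing in which all edges are straight-line segments of at most $s$ distinct slopes. An edge is drawn with $k$ bends if it is a polygonal path consisting of $k+1$ segments; the slopes of a polygonal drawing are the slopes of all its segments. For every integer $d\ge 3$ let $G_d$ be the following graph. Start with two triangles $abc$ and $a'b'c'$ connected by the edges $aa'$, $bb'$, $cc'$. Add a cycle $C$ of length $3(d-3)$ and connect $d-3$ consecutive vertices of $C$ to $a$, the next $d-3$ to $b$, and the remaining $d-3$ to $c$. Analogously add a cycle $C'$ of length $3(d-3)$ and connect its vertices, in three consecutive blocks of $d-3$ vertices, to $a'$, $b'$, $c'$, respectively. (For $d=3$ no vertices are added.) \textbf{Theorem.} For every $d\ge 3$, the graph $G_d$ is planar, has maximum degree $d$, and its planar slope number is at least $3d-6$. Moreover, every drawing of $G_d$ with at most one bend per edge uses at least $\frac34(d-1)$ distinct slopes. -/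

import Mathlib

/-- `A` is a simple arc with endpoints `p` and `q` in the plane. -/
def IsArcBetween (p q : ℝ × ℝ) (A : Set (ℝ × ℝ)) : Prop :=
  ∃ γ : Path p q, Function.Injective γ ∧ Set.range γ = A

/-- A (noncrossing) drawing of a graph in the plane: vertices are distinct points, each edge is a
simple arc between its endpoints passing through no other vertex, and the arcs of two different
edges have no interior point in common. Only the values of `arc` on edges of `G` are relevant. -/
structure PlaneDrawing {V : Type*} (G : SimpleGraph V) where
  pos : V → ℝ × ℝ
  arc : Sym2 V → Set (ℝ × ℝ)
  pos_injective : Function.Injective pos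
  isArc : ∀ u v, G.Adj u v → IsArcBetween (pos u) (pos v) (arc s(u, v))
  avoids : ∀ u v w, G.Adj u v → pos w ∈ arc s(u, v) → w = u ∨ w = v
  noncrossing : ∀ u v u' v', G.Adj u v → G.Adj u' v' → s(u, v) ≠ s(u', v') →
    Disjoint (arc s(u, v) \ {pos u, pos v}) (arc s(u', v') \ {pos u', pos v'})

/-- A graph is planar if it has a noncrossing drawing in the plane. -/
def IsPlanarGraph {V : Type*} (G : SimpleGraph V) : Prop := Nonempty (PlaneDrawing G)

/-- The slope of the segment `pq` (for `p ≠ q`): the linear line parallel to it. Vertical segments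
have a slope as well. -/
def slopeOf (p q : ℝ × ℝ) : Submodule ℝ (ℝ × ℝ) := Submodule.span ℝ {q - p}

/-- `A` is traced by a polygonal path `x 0, x 1, …, x (m + 1)` from `p` to `q` that consists of
`m + 1` nondegenerate segments (so it has `m` bends), where `m ≤ k` and all segments have slopes
in `S`. -/
def IsPolygonalPath (k : ℕ) (S : Finset (Submodule ℝ (ℝ × ℝ))) (p q : ℝ × ℝ)
    (A : Set (ℝ × ℝ)) : Prop :=
  ∃ m ≤ k, ∃ x : ℕ → ℝ × ℝ, x 0 = p ∧ x (m + 1) = q ∧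
    (∀ i ≤ m, x i ≠ x (i + 1) ∧ slopeOf (x i) (x (i + 1)) ∈ S) ∧
    A = ⋃ i ≤ m, segment ℝ (x i) (x (i + 1))

/-- In the drawing `D`, every edge is a polygonal path with at most `k` bends, all of whose
segments have slopes in `S`. -/
def PlaneDrawing.HasBendsSlopes {V : Type*} {G : SimpleGraph V} (D : PlaneDrawing G)
    (k : ℕ) (S : Finset (Submodule ℝ (ℝ × ℝ))) : Prop :=
  ∀ u v, G.Adj u v → IsPolygonalPath k S (D.pos u) (D.pos v) (D.arc s(u, v))

/-- The planar slope number: the smallest `s` such that `G` has a (noncrossing) straight-line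
drawing, i.e. one without bends, with edges of at most `s` distinct slopes. -/
noncomputable def planarSlopeNumber {V : Type*} (G : SimpleGraph V) : ℕ :=
  sInf {s : ℕ | ∃ (D : PlaneDrawing G) (S : Finset (Submodule ℝ (ℝ × ℝ))),
    S.card ≤ s ∧ D.HasBendsSlopes 0 S}

/-- The vertices of `G_d`: two copies (indexed by `Bool`) of a triangle `Fin 3` together with a
cycle on `3 (d - 3)` vertices. -/
abbrev PrismCycleVertex (d : ℕ) : Type := Bool × (Fin 3 ⊕ Fin (3 * (d - 3)))

/-- Adjacency in `G_d`: each triangle is complete, corresponding vertices of the two triangles are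
joined, and within each copy the cycle vertices are joined to the triangle in three consecutive
blocks of `d - 3` vertices. -/
def PrismCycleAdj (d : ℕ) : PrismCycleVertex d → PrismCycleVertex d → Prop
  | (s, Sum.inl i), (t, Sum.inl j) => (s = t ∧ i ≠ j) ∨ (s ≠ t ∧ i = j)
  | (s, Sum.inl i), (t, Sum.inr y) => s = t ∧ y.val / (d - 3) = i.val
  | (s, Sum.inr x), (t, Sum.inl j) => s = t ∧ x.val / (d - 3) = j.val
  | (s, Sum.inr x), (t, Sum.inr y) => s = t ∧ (SimpleGraph.cycleGraph (3 * (d - 3))).Adj x y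

/-- The graph `G_d`: a triangular prism with a cycle of length `3 (d - 3)` attached to each of its
two triangles (for `d = 3` the cycles are empty). -/
def prismCycleGraph (d : ℕ) : SimpleGraph (PrismCycleVertex d) where
  Adj := PrismCycleAdj d
  symm := ⟨by
    rintro ⟨s, i | x⟩ ⟨t, j | y⟩ h
    · exact h.imp (fun h => ⟨h.1.symm, h.2.symm⟩) (fun h => ⟨h.1.symm, h.2.symm⟩)
    · exact ⟨h.1.symm, h.2⟩
    · exact ⟨h.1.symm, h.2⟩
    · exact ⟨h.1.symm, h.2.symm⟩⟩
  loopless := ⟨by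
    rintro ⟨s, i | x⟩ h
    · exact h.elim (fun h => h.2 rfl) (fun h => h.1 rfl)
    · exact h.2.ne rfl⟩

instance (d : ℕ) : DecidableRel (prismCycleGraph d).Adj
  | (s, Sum.inl i), (t, Sum.inl j) =>
    inferInstanceAs (Decidable ((s = t ∧ i ≠ j) ∨ (s ≠ t ∧ i = j)))
  | (s, Sum.inl i), (t, Sum.inr y) =>
    inferInstanceAs (Decidable (s = t ∧ y.val / (d - 3) = i.val))
  | (s, Sum.inr x), (t, Sum.inl j) =>
    inferInstanceAs (Decidable (s = t ∧ x.val / (d - 3) = j.val))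
  | (s, Sum.inr x), (t, Sum.inr y) =>
    inferInstanceAs (Decidable (s = t ∧ (SimpleGraph.cycleGraph (3 * (d - 3))).Adj x y))

/-!
The graph is drawn by placing each cycle on the conic inscribed in its triangle and reflecting one
copy; every pair of edges is separated by a line, which within a copy comes from a linear form in
barycentric coordinates, for example a tangent of the conic or a chord supporting the polygon of
the cycle (`FormSeparates`, `exists_straight_drawing_prismCycleGraph`). In particular, the planar
slope number is attained by a drawing.

Both lower bounds start from the fact that one of the two cycles lies inside its triangle. The
topology of the plane enters only through crossing parities of vertical rays with polygonal
chains. The exchange rule `up_add_up_eq_down_add_down` for two disjoint segments gives, after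
summation, that the parity with respect to a closed chain is constant along disjoint paths.
Combined with a parity count for four points joined pairwise (`Chain.k4_parity`), this shows that
two disjoint tripods attached to the same three vertices of a closed chain start on different
sides of it (`Chain.tripod_parity`). The cycle and the other copy are such tripods for a triangle.
So if neither cycle were inside its triangle, each triangle would be inside the other one, the
convex hulls of the two triangles would agree, and a common extreme point would be a vertex of
both (`BendDrawing.exists_forall_upSum_hexagon_eq_one`).

In a straight-line drawing, the cycle vertices are then interior points of the triangle. The three
sides and the `3 (d - 3)` edges from the corners into the triangle have pairwise different slopes,
because the angles at the three corners are disjoint as sets of slopes (`card_le_of_straight`).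

With one bend per edge, the triangle is drawn as a hexagon, and `3 (d - 1)` segments leave the
three corners along sides of the hexagon or into its interior. A slope occurs at most four times
among them (`Chain.SimpleHex.card_directions_le`), which gives the bound `3 (d - 1) / 4`. Indeed,
of the six directions `u` and `-u` at the three corners, no five occur. To see this, the bends are
pushed outwards a little (`Chain.SimpleHex.exists_push`), so that all segments run strictly inside
and no side is parallel to `u`. If `u` is vertical, two of the corners are then reflex vertices
that are local extrema of the abscissa, and the third one is no convex local extremum, which is
impossible for a simple hexagon (`Chain.hexagon_contradiction`).
-/

/-! ### Crossings of vertical rays with segments -/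

/-- The height at abscissa `x` of the line through `p` and `q` (meaningful when `p.1 ≠ q.1`). -/
noncomputable def lineY (p q : ℝ × ℝ) (x : ℝ) : ℝ :=
  p.2 + (x - p.1) * ((q.2 - p.2) / (q.1 - p.1))

lemma lineY_comm {p q : ℝ × ℝ} (h : p.1 ≠ q.1) (x : ℝ) : lineY p q x = lineY q p x := by
  have h1 : q.1 - p.1 ≠ 0 := sub_ne_zero.2 h.symm
  have h2 : p.1 - q.1 ≠ 0 := sub_ne_zero.2 h
  unfold lineY
  field_simp
  ring

lemma lineY_mem_segment {p q : ℝ × ℝ} {x : ℝ} (hpq : p.1 < q.1) (h1 : p.1 ≤ x) (h2 : x ≤ q.1) :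
    (x, lineY p q x) ∈ segment ℝ p q := by
  have h : 0 < q.1 - p.1 := sub_pos.2 hpq
  rw [segment_eq_image']
  refine ⟨(x - p.1) / (q.1 - p.1), ⟨div_nonneg (by linarith) h.le, (div_le_one h).2 (by linarith)⟩,
    ?_⟩
  ext <;> simp [lineY] <;> field_simp
  ring

lemma continuous_lineY (p q : ℝ × ℝ) : Continuous (lineY p q) := by
  unfold lineY; fun_prop

open Classical in
/-- The number mod 2 of crossings of the upward vertical ray from `q` with the segment `pp'`. The
condition on abscissae is half-open, as if `q` were moved slightly to the right. -/
noncomputable def up (q p p' : ℝ × ℝ) : ZMod 2 :=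
  if ¬ (p.1 ≤ q.1 ↔ p'.1 ≤ q.1) ∧ q.2 < lineY p p' q.1 then 1 else 0

open Classical in
/-- The number mod 2 of crossings of the downward vertical ray from `p` with the segment `qq'`, with
the half-open convention dual to that of `up`: as if `p` were moved slightly to the left. -/
noncomputable def down (p q q' : ℝ × ℝ) : ZMod 2 :=
  if ¬ (p.1 ≤ q.1 ↔ p.1 ≤ q'.1) ∧ lineY q q' p.1 < p.2 then 1 else 0

lemma up_comm (q p p' : ℝ × ℝ) : up q p p' = up q p' p := by
  unfold up
  by_cases h : p.1 = p'.1
  · simp [h]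
  · rw [lineY_comm h]; congr 1; grind

lemma down_comm (p q q' : ℝ × ℝ) : down p q q' = down p q' q := by
  unfold down
  by_cases h : q.1 = q'.1
  · simp [h]
  · rw [lineY_comm h]; congr 1; grind

/-- Two disjoint segments do not change their vertical order. -/
lemma lineY_lt_iff_of_disjoint {p p' q q' : ℝ × ℝ} {l r : ℝ} (hp : p.1 < p'.1) (hq : q.1 < q'.1)
    (hd : Disjoint (segment ℝ p p') (segment ℝ q q')) (hl : p.1 ≤ l ∧ l ≤ p'.1)
    (hl' : q.1 ≤ l ∧ l ≤ q'.1) (hr : p.1 ≤ r ∧ r ≤ p'.1) (hr' : q.1 ≤ r ∧ r ≤ q'.1) :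
    lineY q q' l < lineY p p' l ↔ lineY q q' r < lineY p p' r := by
  by_contra hcon
  have hc : Continuous fun x => lineY p p' x - lineY q q' x :=
    (continuous_lineY _ _).sub (continuous_lineY _ _)
  have h0 : (0 : ℝ) ∈ (fun x => lineY p p' x - lineY q q' x) '' Set.uIcc l r := by
    apply intermediate_value_uIcc hc.continuousOn
    rw [Set.mem_uIcc]
    by_cases h1 : lineY q q' l < lineY p p' l
    · right; constructor <;> [skip; linarith]
      have : ¬ lineY q q' r < lineY p p' r := fun h => hcon (by simp [h1, h])
      linarith
    · left; constructor <;> [linarith; skip]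
      have : lineY q q' r < lineY p p' r := by by_contra h; exact hcon (by simp [h1, h])
      linarith
  obtain ⟨x, hx, hx0⟩ := h0
  rw [Set.mem_uIcc] at hx
  refine Set.disjoint_left.1 hd (lineY_mem_segment (x := x) hp ?_ ?_) ?_
  · rcases hx with h | h <;> linarith
  · rcases hx with h | h <;> linarith
  · have : lineY p p' x = lineY q q' x := by simpa [sub_eq_zero] using hx0
    rw [this]
    exact lineY_mem_segment hq (by rcases hx with h | h <;> linarith)
      (by rcases hx with h | h <;> linarith)

lemma lineY_left (p q : ℝ × ℝ) : lineY p q p.1 = p.2 := by simp [lineY]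

lemma lineY_right {p q : ℝ × ℝ} (h : p.1 ≠ q.1) : lineY p q q.1 = q.2 := by
  rw [lineY_comm h, lineY_left]

/-- A vertical segment disjoint from another segment lies entirely above or entirely below it. -/
lemma lt_lineY_iff_of_disjoint {p p' q q' : ℝ × ℝ} (hp : p.1 < p'.1) (hq : q.1 = q'.1)
    (hd : Disjoint (segment ℝ p p') (segment ℝ q q')) (h1 : p.1 ≤ q.1) (h2 : q.1 ≤ p'.1) :
    (q.2 < lineY p p' q.1 ↔ q'.2 < lineY p p' q.1) ∧
    (lineY p p' q.1 < q.2 ↔ lineY p p' q.1 < q'.2) := by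
  have hmem := lineY_mem_segment hp h1 h2
  have hn : (q.1, lineY p p' q.1) ∉ segment ℝ q q' := Set.disjoint_left.1 hd hmem
  have hseg : ∀ y, y ∈ segment ℝ q.2 q'.2 → (q.1, y) ∈ segment ℝ q q' := by
    rintro y ⟨a, b, ha, hb, hab, rfl⟩
    refine ⟨a, b, ha, hb, hab, ?_⟩
    ext
    · simp [← hq, ← add_mul, hab]
    · simp
  have hn' : lineY p p' q.1 ∉ Set.uIcc q.2 q'.2 := fun h => hn (hseg _ (by
    rwa [segment_eq_uIcc]))
  rw [Set.mem_uIcc] at hn'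
  push Not at hn'
  constructor <;> constructor <;> intro h <;> by_contra h' <;> grind

/-- The exchange rule for two disjoint segments, which is all that the parity arguments below use of
the topology of the plane. -/
theorem up_add_up_eq_down_add_down {p p' q q' : ℝ × ℝ}
    (hd : Disjoint (segment ℝ p p') (segment ℝ q q')) :
    up q p p' + up q' p p' = down p q q' + down p' q q' := by
  wlog hp : p.1 ≤ p'.1 generalizing p p'
  · rw [up_comm q, up_comm q', add_comm (down p _ _)]
    exact this (by rwa [segment_symm]) (le_of_not_ge hp)
  wlog hq : q.1 ≤ q'.1 generalizing q q'
  · rw [down_comm p, down_comm p', add_comm (up q _ _)]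
    exact this (by rwa [segment_symm ℝ q']) (le_of_not_ge hq)
  rcases hp.eq_or_lt with hp | hp
  · rcases hq.eq_or_lt with hq | hq
    · simp [up, down, hp, hq]
    · have := @lt_lineY_iff_of_disjoint q q' p p' hq hp hd.symm
      have h0 : up q p p' + up q' p p' = 0 := by simp [up, hp]
      rw [h0, show down p' q q' = down p q q' from ?_, CharTwo.add_self_eq_zero]
      unfold down
      grind
  · rcases hq.eq_or_lt with hq | hq
    · have := @lt_lineY_iff_of_disjoint p p' q q' hp hq hd
      have h0 : down p q q' + down p' q q' = 0 := by simp [down, hq]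
      rw [h0, show up q' p p' = up q p p' from ?_, CharTwo.add_self_eq_zero]
      unfold up
      grind
    · -- Each of the four terms vanishes or compares the heights of the segments at an end of one
      -- of them.
      have key := fun l r => @lineY_lt_iff_of_disjoint p p' q q' l r hp hq hd
      have e1 := lineY_left p p'
      have e2 := lineY_right hp.ne
      have e3 := lineY_left q q'
      have e4 := lineY_right hq.ne
      have k1 := key q.1 q'.1
      have k2 := key q.1 p'.1
      have k3 := key p.1 q'.1
      have k4 := key p.1 p'.1
      have z : (1 : ZMod 2) + 1 = 0 := by decide
      rw [e3] at k1 k2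
      rw [e1] at k3 k4
      rw [e4] at k1 k3
      rw [e2] at k2 k4
      clear key e1 e2 e3 e4
      unfold up down
      by_cases c1 : p.1 ≤ q.1 <;> by_cases c2 : p'.1 ≤ q'.1 <;>
      by_cases c3 : p.1 ≤ q'.1 <;> by_cases c4 : p'.1 ≤ q.1 <;>
      simp only [c1, c2, c3, c4, iff_true, iff_false, not_true, not_false_eq_true, true_and,
        false_and, if_false, iff_self] <;> grind

/-! ### Crossing parity of polygonal chains -/

/-- A polygonal chain, as a list of segments. -/
abbrev Chain : Type := List ((ℝ × ℝ) × (ℝ × ℝ))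

namespace Chain

/-- The number mod 2 of crossings of the upward vertical ray from `q` with the chain `E`. For a
closed chain `E` not passing through `q` it says whether `q` is inside `E`. -/
noncomputable def upSum (q : ℝ × ℝ) (E : Chain) : ZMod 2 := (E.map fun e => up q e.1 e.2).sum

/-- The number mod 2 of crossings of the downward vertical ray from `q` with the chain `E`. -/
noncomputable def downSum (q : ℝ × ℝ) (E : Chain) : ZMod 2 := (E.map fun e => down q e.1 e.2).sum

/-- The mod 2 boundary of the chain `E` is `p + p'`, expressed by duality with functions. -/
def Joins (E : Chain) (p p' : ℝ × ℝ) : Prop :=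
  ∀ φ : ℝ × ℝ → ZMod 2, (E.map fun e => φ e.1 + φ e.2).sum = φ p + φ p'

/-- The mod 2 boundary of the chain `E` is zero, i.e. `E` is a union of closed polygons. -/
def IsCycle (E : Chain) : Prop := ∀ φ : ℝ × ℝ → ZMod 2, (E.map fun e => φ e.1 + φ e.2).sum = 0

/-- No segment of `E` meets a segment of `F`. -/
def Disj (E F : Chain) : Prop :=
  ∀ e ∈ E, ∀ f ∈ F, Disjoint (segment ℝ e.1 e.2) (segment ℝ f.1 f.2)

/-- The chain `E` does not pass through `q`. -/
def Avoids (E : Chain) (q : ℝ × ℝ) : Prop := ∀ e ∈ E, q ∉ segment ℝ e.1 e.2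

/-- The image of a chain under a linear automorphism of the plane. -/
def mapL (T : (ℝ × ℝ) ≃ₗ[ℝ] (ℝ × ℝ)) (E : Chain) : Chain := E.map (Prod.map T T)

@[simp] lemma upSum_nil (q : ℝ × ℝ) : upSum q [] = 0 := rfl
@[simp] lemma upSum_cons (q : ℝ × ℝ) (e) (E : Chain) :
    upSum q (e :: E) = up q e.1 e.2 + upSum q E := by simp [upSum]
@[simp] lemma upSum_append (q : ℝ × ℝ) (E F : Chain) :
    upSum q (E ++ F) = upSum q E + upSum q F := by simp [upSum]
@[simp] lemma downSum_nil (q : ℝ × ℝ) : downSum q [] = 0 := rfl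
@[simp] lemma downSum_cons (q : ℝ × ℝ) (e) (E : Chain) :
    downSum q (e :: E) = down q e.1 e.2 + downSum q E := by simp [downSum]

lemma Disj.symm {E F : Chain} (h : Disj E F) : Disj F E := fun f hf e he => (h e he f hf).symm

lemma Disj.append_left {E E' F : Chain} (h : Disj E F) (h' : Disj E' F) : Disj (E ++ E') F := by
  intro e he
  rcases List.mem_append.1 he with he | he
  · exact h e he
  · exact h' e he

lemma Avoids.append {E F : Chain} {q : ℝ × ℝ} (h : Avoids E q) (h' : Avoids F q) :
    Avoids (E ++ F) q := by
  intro e he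
  rcases List.mem_append.1 he with he | he
  · exact h e he
  · exact h' e he

lemma Joins.append {E F : Chain} {p q r : ℝ × ℝ} (h : Joins E p q) (h' : Joins F q r) :
    Joins (E ++ F) p r := by
  intro φ
  rw [List.map_append, List.sum_append, h φ, h' φ]
  linear_combination CharTwo.add_self_eq_zero (φ q)

lemma Joins.symm {E : Chain} {p q : ℝ × ℝ} (h : Joins E p q) : Joins E q p := by
  intro φ
  rw [h φ, add_comm]

lemma Joins.isCycle {E : Chain} {p : ℝ × ℝ} (h : Joins E p p) : IsCycle E := by
  intro φ
  rw [h φ, CharTwo.add_self_eq_zero]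

lemma joins_nil (p : ℝ × ℝ) : Joins [] p p := fun φ => by simp [CharTwo.add_self_eq_zero]

lemma joins_single (p q : ℝ × ℝ) : Joins [(p, q)] p q := fun φ => by simp

/-- A chain with boundary `p + p'`, `p ≠ p'`, has a segment ending at `p`. -/
lemma Joins.exists_mem {E : Chain} {p p' : ℝ × ℝ} (h : Joins E p p') (hne : p ≠ p') :
    ∃ e ∈ E, p ∈ segment ℝ e.1 e.2 := by
  classical
  by_contra! hcon
  have h1 := h (fun x => if x = p then 1 else 0)
  rw [List.map_congr_left (g := fun _ => 0)] at h1
  · simp [hne.symm] at h1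
  · intro e he
    have := hcon e he
    have h2 : e.1 ≠ p := fun h => this (h ▸ left_mem_segment ℝ _ _)
    have h3 : e.2 ≠ p := fun h => this (h ▸ right_mem_segment ℝ _ _)
    simp [h2, h3]

lemma Joins.avoids {E F : Chain} {p p' : ℝ × ℝ} (h : Joins E p p') (hne : p ≠ p')
    (hd : Disj E F) : Avoids F p := by
  obtain ⟨e, he, hp⟩ := h.exists_mem hne
  exact fun f hf => Set.disjoint_left.1 (hd e he f hf) hp

/-- The exchange rule summed over two disjoint chains. -/
lemma sum_upSum_eq_sum_downSum {E F : Chain} (h : Disj E F) :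
    (F.map fun f => upSum f.1 E + upSum f.2 E).sum =
      (E.map fun e => downSum e.1 F + downSum e.2 F).sum := by
  induction E with
  | nil => simp
  | cons e E ih =>
    have ih' := ih fun e he => h e (List.mem_cons_of_mem _ he)
    rw [List.map_cons, List.sum_cons, ← ih']
    have he := h e List.mem_cons_self
    clear ih ih' h
    induction F with
    | nil => simp
    | cons f F ih =>
      have := ih fun f hf => he f (List.mem_cons_of_mem _ hf)
      have h1 := up_add_up_eq_down_add_down (he f List.mem_cons_self)
      simp only [List.map_cons, List.sum_cons, downSum_cons, upSum_cons] at this ⊢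
      linear_combination this + h1

lemma Joins.upSum_add_upSum {E F : Chain} {p p' q q' : ℝ × ℝ} (hE : Joins E p p')
    (hF : Joins F q q') (h : Disj E F) :
    upSum q E + upSum q' E = downSum p F + downSum p' F := by
  have := sum_upSum_eq_sum_downSum h
  rwa [hF fun x => upSum x E, hE fun x => downSum x F] at this

lemma IsCycle.upSum_eq_of_joins {E F : Chain} {q q' : ℝ × ℝ} (hE : IsCycle E)
    (hF : Joins F q q') (h : Disj E F) : upSum q E = upSum q' E := by
  have := sum_upSum_eq_sum_downSum h
  rwa [hF fun x => upSum x E, hE fun x => downSum x F, CharTwo.add_eq_zero] at this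

/-- The side of a closed chain is constant along a segment that does not meet the chain. -/
lemma IsCycle.upSum_eq {E : Chain} {q q' : ℝ × ℝ} (hE : IsCycle E)
    (h : ∀ e ∈ E, Disjoint (segment ℝ e.1 e.2) (segment ℝ q q')) : upSum q E = upSum q' E :=
  hE.upSum_eq_of_joins (joins_single q q') fun e he f hf => by
    rw [List.mem_singleton] at hf; subst hf; exact h e he

lemma exists_abs_le (E : Chain) : ∃ M : ℝ, ∀ e ∈ E, |e.1.1| ≤ M ∧ |e.2.1| ≤ M := by
  induction E with
  | nil => simp
  | cons e E ih =>
    obtain ⟨M, hM⟩ := ih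
    refine ⟨max M (max |e.1.1| |e.2.1|), ?_⟩
    intro f hf
    rcases List.mem_cons.1 hf with rfl | hf
    · simp
    · exact ⟨(hM f hf).1.trans (le_max_left _ _), (hM f hf).2.trans (le_max_left _ _)⟩

lemma disjoint_segment_of_lt {p p' q q' : ℝ × ℝ} (g : (ℝ × ℝ) →ₗ[ℝ] ℝ) (c : ℝ)
    (hp : c < g p) (hp' : c < g p') (hq : g q ≤ c) (hq' : g q' ≤ c) :
    Disjoint (segment ℝ p p') (segment ℝ q q') := by
  rw [Set.disjoint_left]
  intro x hx hx'
  have h1 : c < g x := (convex_halfSpace_gt g.isLinear c).segment_subset hp hp' hx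
  have h2 : g x ≤ c := (convex_halfSpace_le g.isLinear c).segment_subset hq hq' hx'
  linarith

/-- A point separated from a closed chain by a line is outside the chain. -/
lemma IsCycle.upSum_eq_zero_of_lt {E : Chain} {q : ℝ × ℝ} (hE : IsCycle E)
    (g : (ℝ × ℝ) →ₗ[ℝ] ℝ) (hg : ∀ e ∈ E, g q < g e.1 ∧ g q < g e.2) : upSum q E = 0 := by
  have hg' : ∀ x : ℝ × ℝ, g x = x.1 * g (1, 0) + x.2 * g (0, 1) := by
    intro x
    rw [← smul_eq_mul, ← smul_eq_mul, ← map_smul, ← map_smul, ← map_add]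
    simp
  obtain rfl | hne := eq_or_ne E []
  · simp
  obtain ⟨e₀, he₀⟩ := List.exists_mem_of_ne_nil E hne
  -- Follow a ray from `q` that leaves both the half-plane of `E` and its range of abscissae.
  suffices h : ∃ v : ℝ × ℝ, 0 < g v ∧ v.1 ≠ 0 by
    obtain ⟨v, hv, hv1⟩ := h
    obtain ⟨M, hM⟩ := exists_abs_le E
    set R : ℝ := (|M| + |q.1| + 1) / |v.1| with hR
    have hR0 : 0 ≤ R := by positivity
    rw [hE.upSum_eq (q' := q - R • v)]
    · have hRv : |R * v.1| = |M| + |q.1| + 1 := by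
        rw [abs_mul, abs_of_nonneg hR0, hR, div_mul_cancel₀ _ (abs_ne_zero.2 hv1)]
      have hz : ∀ e ∈ E, up (q - R • v) e.1 e.2 = 0 := by
        intro e he
        obtain ⟨h1, h2⟩ := hM e he
        have hiff : e.1.1 ≤ (q - R • v).1 ↔ e.2.1 ≤ (q - R • v).1 := by
          simp only [Prod.fst_sub, Prod.smul_fst, smul_eq_mul]
          rw [abs_le] at h1 h2
          have := le_abs_self M
          have := le_abs_self q.1
          have := neg_abs_le q.1
          rcases abs_cases (R * v.1) with ⟨h, -⟩ | ⟨h, -⟩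
          · exact iff_of_false (by linarith) (by linarith)
          · exact iff_of_true (by linarith) (by linarith)
        rw [up, if_neg fun h => h.1 hiff]
      rw [upSum, List.map_congr_left hz]
      simp
    · intro e he
      refine disjoint_segment_of_lt g (g q) (hg e he).1 (hg e he).2 le_rfl ?_
      simp only [map_sub, map_smul, smul_eq_mul]
      nlinarith
  by_cases h1 : g (1, 0) = 0
  · by_cases h2 : g (0, 1) = 0
    · have := (hg e₀ he₀).1
      simp [hg' q, hg' e₀.1, h1, h2] at this
    · exact ⟨(1, g (0, 1)), by rw [hg']; simp [h1]; positivity, by simp⟩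
  · exact ⟨(g (1, 0), 0), by rw [hg']; simp; positivity, by simpa using h1⟩

/-- A point outside the convex hull of a finite set is separated from it by a linear functional. -/
lemma exists_lt_of_notMem_convexHull {s : Set (ℝ × ℝ)} (hs : s.Finite) {q : ℝ × ℝ}
    (hq : q ∉ convexHull ℝ s) : ∃ g : (ℝ × ℝ) →L[ℝ] ℝ, ∀ x ∈ s, g q < g x := by
  obtain ⟨g, u, h1, h2⟩ := geometric_hahn_banach_point_closed (convex_convexHull ℝ s)
    (hs.isCompact_convexHull ℝ).isClosed hq
  exact ⟨g, fun x hx => h1.trans (h2 x (subset_convexHull ℝ s hx))⟩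

lemma IsCycle.upSum_eq_zero_of_notMem_convexHull {E : Chain} {q : ℝ × ℝ} (hE : IsCycle E)
    {s : Set (ℝ × ℝ)} (hs : s.Finite) (hEs : ∀ e ∈ E, e.1 ∈ s ∧ e.2 ∈ s)
    (hq : q ∉ convexHull ℝ s) : upSum q E = 0 := by
  obtain ⟨g, hg⟩ := exists_lt_of_notMem_convexHull hs hq
  exact hE.upSum_eq_zero_of_lt g.toLinearMap
    fun e he => ⟨hg _ (hEs e he).1, hg _ (hEs e he).2⟩

/-- The determinant of two vectors of the plane. -/
def det (v w : ℝ × ℝ) : ℝ := v.1 * w.2 - v.2 * w.1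

/-- The closed chain of the three sides of a triangle. -/
def tri (p q r : ℝ × ℝ) : Chain := [(p, q), (q, r), (r, p)]

lemma tri_isCycle (p q r : ℝ × ℝ) : IsCycle (tri p q r) := by
  intro φ
  simp only [tri, List.map_cons, List.map_nil, List.sum_cons, List.sum_nil]
  linear_combination CharTwo.add_self_eq_zero (φ p) + CharTwo.add_self_eq_zero (φ q) +
    CharTwo.add_self_eq_zero (φ r)

lemma lt_lineY_iff_det {p p' q : ℝ × ℝ} (h : p.1 < p'.1) :
    q.2 < lineY p p' q.1 ↔ det (p - q) (p' - q) < 0 := by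
  have h' : 0 < p'.1 - p.1 := sub_pos.2 h
  have : det (p - q) (p' - q) = -((lineY p p' q.1 - q.2) * (p'.1 - p.1)) := by
    simp only [det, lineY, Prod.fst_sub, Prod.snd_sub]
    field_simp
    ring
  rw [this, neg_lt_zero, mul_pos_iff_of_pos_right h', sub_pos]

open Classical in
lemma up_eq_of_lt {p p' q : ℝ × ℝ} (h : p.1 ≤ q.1) (h' : q.1 < p'.1) :
    up q p p' = if det (p - q) (p' - q) < 0 then 1 else 0 := by
  simp only [up, ← lt_lineY_iff_det (h.trans_lt h')]
  simp [h, h']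

lemma det_ne_zero_of_notMem {p p' q : ℝ × ℝ} (h : p.1 ≤ q.1) (h' : q.1 < p'.1)
    (hq : q ∉ segment ℝ p p') : det (p - q) (p' - q) ≠ 0 := by
  intro h0
  apply hq
  have hd : 0 < p'.1 - p.1 := by linarith
  have := lineY_mem_segment (h.trans_lt h') h h'.le
  convert this
  simp only [det, lineY, Prod.fst_sub, Prod.snd_sub] at h0 ⊢
  field_simp
  linarith

lemma det_swap (v w : ℝ × ℝ) : det w v = - det v w := by unfold det; ring

/-- The vertical ray from an interior point of a triangle crosses exactly one of the two sides
at the vertex that lies on its own side of the vertical line. -/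
lemma upSum_tri_aux {p q r x : ℝ × ℝ} {α β γ : ℝ} (hβ : 0 < β) (hγ : 0 < γ)
    (hx : α • p + β • q + γ • r = x) (hs : α + β + γ = 1)
    (hpq : x ∉ segment ℝ p q)
    (h : (p.1 ≤ x.1 ∧ x.1 < q.1 ∧ x.1 < r.1) ∨ (x.1 < p.1 ∧ q.1 ≤ x.1 ∧ r.1 ≤ x.1)) :
    up x p q + up x q r + up x r p = 1 := by
  classical
  have hrel : β * det (p - x) (q - x) + γ * det (p - x) (r - x) = 0 := by
    have h1 : α * p.1 + β * q.1 + γ * r.1 = x.1 := by simpa using congrArg Prod.fst hx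
    have h2 : α * p.2 + β * q.2 + γ * r.2 = x.2 := by simpa using congrArg Prod.snd hx
    have hα : α = 1 - β - γ := by linarith
    subst hα
    simp only [det, Prod.fst_sub, Prod.snd_sub]
    linear_combination (p.1 - x.1) * h2 - (p.2 - x.2) * h1
  have hqr : up x q r = 0 := by
    rw [up, if_neg]
    rintro ⟨h', -⟩
    apply h'
    rcases h with ⟨-, h1, h2⟩ | ⟨-, h1, h2⟩
    · exact iff_of_false (not_le.2 h1) (not_le.2 h2)
    · exact iff_of_true h1 h2
  have hne : ∀ a b : ℝ, a ≠ 0 → β * a + γ * b = 0 → (a < 0 ↔ ¬ b < 0) := by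
    intro a b ha hab
    constructor
    · intro h1 h2; nlinarith
    · intro h1
      by_contra h2
      have : 0 < a := lt_of_le_of_ne (not_lt.1 h2) ha.symm
      nlinarith
  rcases h with ⟨h0, h1, h2⟩ | ⟨h0, h1, h2⟩
  · rw [hqr, up_comm x r p, up_eq_of_lt h0 h1, up_eq_of_lt h0 h2]
    have := hne _ _ (det_ne_zero_of_notMem h0 h1 hpq) hrel
    by_cases h3 : det (p - x) (r - x) < 0 <;> simp [h3, this]
  · rw [hqr, up_comm x p q, up_eq_of_lt h1 h0, up_eq_of_lt h2 h0]
    have h3 := det_ne_zero_of_notMem h1 h0 (by rwa [segment_symm])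
    rw [det_swap (p - x) (q - x), det_swap (p - x) (r - x)] at *
    have := hne (-det (p - x) (q - x)) (-det (p - x) (r - x)) h3 (by linarith)
    by_cases h3 : -det (p - x) (r - x) < 0 <;> simp [h3, this]

/-- A point of a triangle that is on no side has positive barycentric coordinates. -/
lemma exists_pos_of_mem_convexHull {p q r x : ℝ × ℝ} (hx : x ∈ convexHull ℝ {p, q, r})
    (hpq : x ∉ segment ℝ p q) (hqr : x ∉ segment ℝ q r) (hrp : x ∉ segment ℝ r p) :
    ∃ α β γ : ℝ, 0 < α ∧ 0 < β ∧ 0 < γ ∧ α + β + γ = 1 ∧ α • p + β • q + γ • r = x := by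
  rw [convexHull_insert (by simp)] at hx
  simp only [convexHull_pair, convexJoin_singleton_left, Set.mem_iUnion] at hx
  obtain ⟨y, ⟨s, t, hs, ht, hst, rfl⟩, a, b, ha', hb, hab, hx⟩ := hx
  obtain ⟨α, β, γ, hα, hβ, hγ, hsum, hx⟩ : ∃ α β γ : ℝ, 0 ≤ α ∧ 0 ≤ β ∧ 0 ≤ γ ∧ α + β + γ = 1 ∧
      α • p + β • q + γ • r = x := by
    refine ⟨a, b * s, b * t, ha', mul_nonneg hb hs, mul_nonneg hb ht, ?_, ?_⟩
    · rw [add_assoc, ← mul_add, hst, mul_one, hab]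
    · rw [← hx, smul_add, smul_smul, smul_smul, add_assoc]
  have hα : 0 < α := by
    refine lt_of_le_of_ne hα fun h => hqr ⟨β, γ, hβ, hγ, by linarith, ?_⟩
    rw [← hx, ← h, zero_smul, zero_add]
  have hβ : 0 < β := by
    refine lt_of_le_of_ne hβ fun h => hrp ⟨γ, α, hγ, hα.le, by linarith, ?_⟩
    rw [← hx, ← h, zero_smul, add_zero, add_comm]
  have hγ : 0 < γ := by
    refine lt_of_le_of_ne hγ fun h => hpq ⟨α, β, hα.le, hβ.le, by linarith, ?_⟩
    rw [← hx, ← h, zero_smul, add_zero]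
  exact ⟨α, β, γ, hα, hβ, hγ, hsum, hx⟩

lemma upSum_tri_of_mem_convexHull {p q r x : ℝ × ℝ} (hx : x ∈ convexHull ℝ {p, q, r})
    (ha : Avoids (tri p q r) x) : upSum x (tri p q r) = 1 := by
  have hpq : x ∉ segment ℝ p q := ha (p, q) (by simp [tri])
  have hqr : x ∉ segment ℝ q r := ha (q, r) (by simp [tri])
  have hrp : x ∉ segment ℝ r p := ha (r, p) (by simp [tri])
  obtain ⟨α, β, γ, hα, hβ, hγ, hsum, hx⟩ := exists_pos_of_mem_convexHull hx hpq hqr hrp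
  have h1 : α * (p.1 - x.1) + β * (q.1 - x.1) + γ * (r.1 - x.1) = 0 := by
    have : α * p.1 + β * q.1 + γ * r.1 = x.1 := by simpa using congrArg Prod.fst hx
    linear_combination this - x.1 * hsum
  simp only [tri, upSum_cons, upSum_nil, add_zero, ← add_assoc]
  have rot1 : β • q + γ • r + α • p = x := by rw [← hx]; abel
  have rot2 : γ • r + α • p + β • q = x := by rw [← hx]; abel
  have A := upSum_tri_aux hβ hγ hx hsum hpq
  have B := upSum_tri_aux hγ hα rot1 (by linarith) hqr
  have C := upSum_tri_aux hα hβ rot2 (by linarith) hrp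
  rw [add_rotate] at B
  rw [← add_rotate] at C
  -- Either one vertex is separated from the other two by the vertical line through `x`, or all
  -- three lie on that line and `x` is on a side.
  have key : ¬ (x.1 < p.1 ∧ x.1 < q.1 ∧ x.1 < r.1) := by
    rintro ⟨h2, h3, h4⟩
    nlinarith [mul_pos hα (sub_pos.2 h2), mul_pos hβ (sub_pos.2 h3), mul_pos hγ (sub_pos.2 h4)]
  have key' : ¬ (p.1 ≤ x.1 ∧ q.1 ≤ x.1 ∧ r.1 ≤ x.1) := by
    rintro ⟨h2, h3, h4⟩
    have e2 : p.1 = x.1 := by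
      nlinarith [mul_nonneg hβ.le (sub_nonneg.2 h3), mul_nonneg hγ.le (sub_nonneg.2 h4)]
    have e3 : q.1 = x.1 := by
      nlinarith [mul_nonneg hα.le (sub_nonneg.2 h2), mul_nonneg hγ.le (sub_nonneg.2 h4)]
    have e4 : r.1 = x.1 := by
      nlinarith [mul_nonneg hβ.le (sub_nonneg.2 h3), mul_nonneg hα.le (sub_nonneg.2 h2)]
    have h5 : α * (p.2 - x.2) + β * (q.2 - x.2) + γ * (r.2 - x.2) = 0 := by
      have : α * p.2 + β * q.2 + γ * r.2 = x.2 := by simpa using congrArg Prod.snd hx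
      linear_combination this - x.2 * hsum
    have vert : ∀ u v : ℝ × ℝ, u.1 = x.1 → v.1 = x.1 → x ∉ segment ℝ u v →
        x.2 ∉ Set.uIcc u.2 v.2 := by
      intro u v hu hv hn hm
      rw [← segment_eq_uIcc] at hm
      obtain ⟨a, b, ha, hb, hab, h⟩ := hm
      refine hn ⟨a, b, ha, hb, hab, ?_⟩
      ext
      · simp [hu, hv, ← add_mul, hab]
      · simpa using h
    have v1 := vert p q e2 e3 hpq
    have v2 := vert q r e3 e4 hqr
    have v3 := vert r p e4 e2 hrp
    rw [Set.mem_uIcc] at v1 v2 v3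
    push Not at v1 v2 v3
    have hlt : (p.2 < x.2 ∧ q.2 < x.2 ∧ r.2 < x.2) ∨ (x.2 < p.2 ∧ x.2 < q.2 ∧ x.2 < r.2) := by
      grind
    rcases hlt with ⟨h2, h3, h4⟩ | ⟨h2, h3, h4⟩
    · nlinarith [mul_pos hα (sub_pos.2 h2), mul_pos hβ (sub_pos.2 h3), mul_pos hγ (sub_pos.2 h4)]
    · nlinarith [mul_pos hα (sub_pos.2 h2), mul_pos hβ (sub_pos.2 h3), mul_pos hγ (sub_pos.2 h4)]
  grind

end Chain

/-! ### Four points joined pairwise and the parity of tripods -/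

namespace Chain

lemma IsCycle.mapL {E : Chain} (hE : IsCycle E) (T : (ℝ × ℝ) ≃ₗ[ℝ] (ℝ × ℝ)) :
    IsCycle (E.mapL T) := by
  intro φ
  have := hE fun x => φ (T x)
  simpa [Chain.mapL, Function.comp_def] using this

lemma Joins.mapL {E : Chain} {p q : ℝ × ℝ} (hE : Joins E p q) (T : (ℝ × ℝ) ≃ₗ[ℝ] (ℝ × ℝ)) :
    Joins (E.mapL T) (T p) (T q) := by
  intro φ
  have := hE fun x => φ (T x)
  simpa [Chain.mapL, Function.comp_def] using this

lemma disjoint_segment_map {p p' q q' : ℝ × ℝ} (T : (ℝ × ℝ) ≃ₗ[ℝ] (ℝ × ℝ))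
    (h : Disjoint (segment ℝ p p') (segment ℝ q q')) :
    Disjoint (segment ℝ (T p) (T p')) (segment ℝ (T q) (T q')) := by
  have h1 := image_segment ℝ T.toLinearMap.toAffineMap p p'
  have h2 := image_segment ℝ T.toLinearMap.toAffineMap q q'
  simp only [LinearMap.coe_toAffineMap, LinearEquiv.coe_coe] at h1 h2
  rw [← h1, ← h2]
  exact Set.disjoint_image_of_injective T.injective h

lemma Disj.mapL {E F : Chain} (h : Disj E F) (T : (ℝ × ℝ) ≃ₗ[ℝ] (ℝ × ℝ)) :
    Disj (E.mapL T) (F.mapL T) := by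
  intro e he f hf
  simp only [Chain.mapL, List.mem_map] at he hf
  obtain ⟨e, he, rfl⟩ := he
  obtain ⟨f, hf, rfl⟩ := hf
  exact disjoint_segment_map T (h e he f hf)

/-- A closed chain is mod 2 the sum of the triangles spanned by its segments and any apex `o`. -/
lemma IsCycle.upSum_eq_sum_tri {E : Chain} (hE : IsCycle E) (q o : ℝ × ℝ) :
    upSum q E = (E.map fun e => upSum q (tri o e.1 e.2)).sum := by
  have h := hE fun x => up q o x
  have : (E.map fun e => upSum q (tri o e.1 e.2)).sum =
      upSum q E + (E.map fun e => up q o e.1 + up q o e.2).sum := by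
    rw [upSum, ← List.sum_map_add]
    congr 1
    refine List.map_congr_left fun e _ => ?_
    simp only [tri, upSum_cons, upSum_nil, up_comm q e.2 o]
    ring
  rw [this, h, add_zero]

/-- A generic apex `o`: the point `q` is on no side of the triangles spanned by `o` and the segments
of a chain that avoids `q`. -/
lemma exists_apex (E : Chain) (q : ℝ × ℝ) (ha : Avoids E q) :
    ∃ o, ∀ e ∈ E, Avoids (tri o e.1 e.2) q := by
  classical
  obtain ⟨t, ht⟩ := Infinite.exists_notMem_finset
    ((E.map fun e => (e.1 - q).2 / (e.1 - q).1) ++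
      (E.map fun e => (e.2 - q).2 / (e.2 - q).1)).toFinset
  simp only [List.mem_toFinset, List.mem_append, List.mem_map, not_or, not_exists, not_and] at ht
  have key : ∀ p : ℝ × ℝ, p ≠ q → (p - q).2 / (p - q).1 ≠ t → q ∉ segment ℝ (q + (1, t)) p := by
    rintro p hpq hpt ⟨a, b, ha, hb, hab, h⟩
    have h1 : a * q.1 + a + b * p.1 = q.1 := by simpa [mul_add] using congrArg Prod.fst h
    have h2 : a * q.2 + a * t + b * p.2 = q.2 := by simpa [mul_add] using congrArg Prod.snd h
    have e1 : b * (p.1 - q.1) = -a := by linear_combination h1 - q.1 * hab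
    have e2 : b * (p.2 - q.2) = -(a * t) := by linear_combination h2 - q.2 * hab
    have hb0 : b ≠ 0 := by rintro rfl; simp at e1 hab; linarith
    have ha0 : a ≠ 0 := by
      rintro rfl
      simp [hb0, sub_eq_zero] at e1 e2
      exact hpq (Prod.ext e1 e2)
    have hd : p.1 - q.1 ≠ 0 := fun h => ha0 (by rw [h] at e1; linarith)
    apply hpt
    simp only [Prod.fst_sub, Prod.snd_sub]
    rw [div_eq_iff hd]
    apply mul_left_cancel₀ hb0
    linear_combination e2 - t * e1
  refine ⟨q + (1, t), fun e he f hf => ?_⟩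
  have h1 : e.1 ≠ q := fun h => ha e he (h ▸ left_mem_segment ℝ _ _)
  have h2 : e.2 ≠ q := fun h => ha e he (h ▸ right_mem_segment ℝ _ _)
  simp only [tri, List.mem_cons, List.not_mem_nil, or_false] at hf
  rcases hf with rfl | rfl | rfl
  · exact key _ h1 (ht.1 e he)
  · exact ha e he
  · rw [segment_symm]; exact key _ h2 (ht.2 e he)

lemma Avoids.mapL {E : Chain} {q : ℝ × ℝ} (h : Avoids E q) (T : (ℝ × ℝ) ≃ₗ[ℝ] (ℝ × ℝ)) :
    Avoids (E.mapL T) (T q) := by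
  intro e he
  simp only [Chain.mapL, List.mem_map] at he
  obtain ⟨e, he, rfl⟩ := he
  have h1 := image_segment ℝ T.toLinearMap.toAffineMap e.1 e.2
  simp only [LinearMap.coe_toAffineMap, LinearEquiv.coe_coe] at h1
  simp only [Prod.map_fst, Prod.map_snd, ← h1]
  rw [T.injective.mem_set_image]
  exact h e he

open Classical in
/-- For a triangle, the crossing parity says whether the point is in the convex hull. -/
lemma upSum_tri {p q r x : ℝ × ℝ} (ha : Avoids (tri p q r) x) :
    upSum x (tri p q r) = if x ∈ convexHull ℝ {p, q, r} then 1 else 0 := by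
  split_ifs with h
  · exact upSum_tri_of_mem_convexHull h ha
  · refine (tri_isCycle p q r).upSum_eq_zero_of_notMem_convexHull (s := {p, q, r}) (by simp)
      ?_ h
    simp [tri]

/-- Whether a point is inside a closed chain does not depend on the direction of the rays. -/
theorem IsCycle.upSum_mapL {E : Chain} (hE : IsCycle E) {q : ℝ × ℝ} (ha : Avoids E q)
    (T : (ℝ × ℝ) ≃ₗ[ℝ] (ℝ × ℝ)) : upSum (T q) (E.mapL T) = upSum q E := by
  classical
  obtain ⟨o, ho⟩ := exists_apex E q ha
  rw [hE.upSum_eq_sum_tri q o, (hE.mapL T).upSum_eq_sum_tri (T q) (T o), Chain.mapL, List.map_map]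
  congr 1
  refine List.map_congr_left fun e he => ?_
  have h1 := ho e he
  have h2 : Avoids (tri (T o) (T e.1) (T e.2)) (T q) := h1.mapL T
  have h3 : convexHull ℝ {T o, T e.1, T e.2} = T '' convexHull ℝ {o, e.1, e.2} := by
    have := T.toLinearMap.image_convexHull {o, e.1, e.2}
    simp only [LinearEquiv.coe_coe] at this
    rw [this, Set.image_insert_eq, Set.image_pair]
  simp only [Function.comp, Prod.map_fst, Prod.map_snd]
  rw [upSum_tri h1, upSum_tri h2, h3]
  simp only [T.injective.mem_set_image]

/-- The linear automorphism `(x, y) ↦ (x + t y, y)` of the plane. -/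
def shear (t : ℝ) : (ℝ × ℝ) ≃ₗ[ℝ] (ℝ × ℝ) where
  toFun p := (p.1 + t * p.2, p.2)
  invFun p := (p.1 - t * p.2, p.2)
  map_add' p q := by ext <;> simp; ring
  map_smul' c p := by ext <;> simp; ring
  left_inv p := by ext <;> simp
  right_inv p := by ext <;> simp

/-- A generic shear makes the abscissae of finitely many points distinct. -/
lemma exists_shear (s : Finset (ℝ × ℝ)) :
    ∃ t, ∀ p ∈ s, ∀ q ∈ s, p ≠ q → (shear t p).1 ≠ (shear t q).1 := by
  classical
  obtain ⟨t, ht⟩ := Infinite.exists_notMem_finset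
    ((s ×ˢ s).image fun x => (x.1.1 - x.2.1) / (x.2.2 - x.1.2))
  refine ⟨t, fun p hp q hq hpq h => ?_⟩
  apply ht
  rw [Finset.mem_image]
  refine ⟨(p, q), Finset.mk_mem_product hp hq, ?_⟩
  simp only [shear, LinearEquiv.coe_mk, LinearMap.coe_mk, AddHom.coe_mk] at h
  have : q.2 - p.2 ≠ 0 := by
    intro h0
    have h2 : q.2 = p.2 := by linarith
    rw [h2] at h
    exact hpq (Prod.ext (by linarith) h2.symm)
  rw [div_eq_iff this]
  linarith

open Classical in
/-- The vertical line through `i` meets a chain from `k` to `l` an odd number of times if and only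
if it separates `k` from `l`. -/
lemma Joins.upSum_add_downSum {E : Chain} {k l i : ℝ × ℝ} (hE : Joins E k l) (ha : Avoids E i)
    (hx : ∀ e ∈ E, e.1.1 ≠ i.1 ∧ e.2.1 ≠ i.1) :
    upSum i E + downSum i E =
      (if i.1 ≤ k.1 then 1 else 0) + (if i.1 ≤ l.1 then 1 else 0) := by
  rw [← hE fun p => if i.1 ≤ p.1 then 1 else 0, upSum, downSum, ← List.sum_map_add]
  congr 1
  refine List.map_congr_left fun e he => ?_
  obtain ⟨h1, h2⟩ := hx e he
  have h3 := ha e he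
  have hne : ¬ (e.1.1 ≤ i.1 ↔ e.2.1 ≤ i.1) → lineY e.1 e.2 i.1 ≠ i.2 := by
    intro h h'
    apply h3
    have hi : (i.1, lineY e.1 e.2 i.1) = i := by rw [h']
    rw [← hi]
    rcases le_or_gt e.1.1 i.1 with h4 | h4
    · have h5 : i.1 < e.2.1 := by grind
      exact lineY_mem_segment (by linarith) h4 h5.le
    · have h5 : e.2.1 ≤ i.1 := by grind
      rw [segment_symm, lineY_comm (by linarith)]
      exact lineY_mem_segment (by linarith) h5 h4.le
  have z : (1 : ZMod 2) + 1 = 0 := by decide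
  unfold up down
  grind

/-- For four points in general position joined pairwise by chains such that independent chains are
disjoint, an odd number of the points are inside the closed chain formed by the other three. -/
lemma k4_parity_aux {a b c y : ℝ × ℝ} {ab bc ca ya yb yc : Chain} (hab : Joins ab a b)
    (hbc : Joins bc b c) (hca : Joins ca c a) (hya : Joins ya y a) (hyb : Joins yb y b)
    (hyc : Joins yc y c) (d1 : Disj ab yc) (d2 : Disj bc ya) (d3 : Disj ca yb)
    (xab : a.1 ≠ b.1) (xbc : b.1 ≠ c.1) (xca : c.1 ≠ a.1)
    (o1 : Avoids yc a ∧ Avoids yc b) (o2 : Avoids ya b ∧ Avoids ya c)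
    (o3 : Avoids yb c ∧ Avoids yb a)
    (x1 : ∀ e ∈ yc, (e.1.1 ≠ a.1 ∧ e.2.1 ≠ a.1) ∧ (e.1.1 ≠ b.1 ∧ e.2.1 ≠ b.1))
    (x2 : ∀ e ∈ ya, (e.1.1 ≠ b.1 ∧ e.2.1 ≠ b.1) ∧ (e.1.1 ≠ c.1 ∧ e.2.1 ≠ c.1))
    (x3 : ∀ e ∈ yb, (e.1.1 ≠ c.1 ∧ e.2.1 ≠ c.1) ∧ (e.1.1 ≠ a.1 ∧ e.2.1 ≠ a.1)) :
    upSum y (ab ++ bc ++ ca) + upSum c (ab ++ ya ++ yb) + upSum a (bc ++ yb ++ yc) +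
      upSum b (ca ++ yc ++ ya) = 1 := by
  classical
  have A1 := hab.upSum_add_upSum hyc d1
  have A2 := hbc.upSum_add_upSum hya d2
  have A3 := hca.upSum_add_upSum hyb d3
  have B1 := hyc.upSum_add_downSum o1.1 fun e he => (x1 e he).1
  have B2 := hyc.upSum_add_downSum o1.2 fun e he => (x1 e he).2
  have B3 := hya.upSum_add_downSum o2.1 fun e he => (x2 e he).1
  have B4 := hya.upSum_add_downSum o2.2 fun e he => (x2 e he).2
  have B5 := hyb.upSum_add_downSum o3.1 fun e he => (x3 e he).1
  have B6 := hyb.upSum_add_downSum o3.2 fun e he => (x3 e he).2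
  have T : ∀ r s : ℝ, r ≠ s →
      (if r ≤ s then (1 : ZMod 2) else 0) + (if s ≤ r then 1 else 0) = 1 := by
    intro r s h
    rcases h.lt_or_gt with h | h <;> simp [h.le, not_le.2 h]
  have T1 := T _ _ xab
  have T2 := T _ _ xbc
  have T3 := T _ _ xca
  simp only [upSum_append]
  have z : (1 : ZMod 2) + 1 = 0 := by decide
  have S := CharTwo.add_self_eq_zero (R := ZMod 2)
  linear_combination A1 + A2 + A3 + B1 + B2 + B3 + B4 + B5 + B6 + T1 + T2 + T3
    + S (if a.1 ≤ y.1 then 1 else 0) + S (if b.1 ≤ y.1 then 1 else 0)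
    + S (if c.1 ≤ y.1 then 1 else 0) + z

lemma Joins.isCycle_fan {E F G : Chain} {p q r : ℝ × ℝ} (hE : Joins E p q) (hF : Joins F r p)
    (hG : Joins G r q) : IsCycle (E ++ F ++ G) := by
  intro φ
  rw [List.map_append, List.sum_append, List.map_append, List.sum_append, hE φ, hF φ, hG φ]
  linear_combination CharTwo.add_self_eq_zero (φ p) + CharTwo.add_self_eq_zero (φ q) +
    CharTwo.add_self_eq_zero (φ r)

/-- The parity form of the nonplanarity of `K₅`: if four points are joined pairwise by chains such
that independent chains are disjoint, then an odd number of the points are inside the closed chain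
formed by the other three. -/
theorem k4_parity {a b c y : ℝ × ℝ} {ab bc ca ya yb yc : Chain} (hab : Joins ab a b)
    (hbc : Joins bc b c) (hca : Joins ca c a) (hya : Joins ya y a) (hyb : Joins yb y b)
    (hyc : Joins yc y c) (d1 : Disj ab yc) (d2 : Disj bc ya) (d3 : Disj ca yb)
    (nab : a ≠ b) (nbc : b ≠ c) (nca : c ≠ a) (ny : y ≠ a ∧ y ≠ b ∧ y ≠ c) :
    upSum y (ab ++ bc ++ ca) + upSum c (ab ++ ya ++ yb) + upSum a (bc ++ yb ++ yc) +
      upSum b (ca ++ yc ++ ya) = 1 := by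
  classical
  have o1 : Avoids yc a ∧ Avoids yc b := ⟨hab.avoids nab d1, hab.symm.avoids nab.symm d1⟩
  have o2 : Avoids ya b ∧ Avoids ya c := ⟨hbc.avoids nbc d2, hbc.symm.avoids nbc.symm d2⟩
  have o3 : Avoids yb c ∧ Avoids yb a := ⟨hca.avoids nca d3, hca.symm.avoids nca.symm d3⟩
  have p1 : Avoids ab y ∧ Avoids ab c :=
    ⟨hyc.avoids ny.2.2 d1.symm, hyc.symm.avoids ny.2.2.symm d1.symm⟩
  have p2 : Avoids bc y ∧ Avoids bc a :=
    ⟨hya.avoids ny.1 d2.symm, hya.symm.avoids ny.1.symm d2.symm⟩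
  have p3 : Avoids ca y ∧ Avoids ca b :=
    ⟨hyb.avoids ny.2.1 d3.symm, hyb.symm.avoids ny.2.1.symm d3.symm⟩
  obtain ⟨t, ht⟩ := exists_shear (insert a (insert b (insert c
    (((ya ++ yb ++ yc).map Prod.fst ++ (ya ++ yb ++ yc).map Prod.snd).toFinset))))
  -- After the shear the vertical lines through `a`, `b`, `c` contain no other vertex of the chains.
  set T := shear t
  have hx : ∀ E : Chain, ∀ i : ℝ × ℝ, (i = a ∨ i = b ∨ i = c) → (∀ e ∈ E, e ∈ ya ++ yb ++ yc) →
      Avoids E i → ∀ e ∈ E.mapL T, e.1.1 ≠ (T i).1 ∧ e.2.1 ≠ (T i).1 := by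
    intro E i hi hE ha e he
    simp only [Chain.mapL, List.mem_map] at he
    obtain ⟨e, he, rfl⟩ := he
    have hi' : i ∈ (insert a (insert b (insert c
      (((ya ++ yb ++ yc).map Prod.fst ++ (ya ++ yb ++ yc).map Prod.snd).toFinset)))) := by
      rcases hi with rfl | rfl | rfl <;> simp
    have h1 := ht e.1 (by
      simp only [Finset.mem_insert, List.mem_toFinset]
      exact .inr (.inr (.inr (List.mem_append_left _ (List.mem_map_of_mem (hE e he)))))) i hi'
    have h2 := ht e.2 (by
      simp only [Finset.mem_insert, List.mem_toFinset]
      exact .inr (.inr (.inr (List.mem_append_right _ (List.mem_map_of_mem (hE e he)))))) i hi'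
    exact ⟨h1 fun h => ha e he (h ▸ left_mem_segment ℝ _ _),
      h2 fun h => ha e he (h ▸ right_mem_segment ℝ _ _)⟩
  have mya : ∀ e ∈ ya, e ∈ ya ++ yb ++ yc := by simp +contextual
  have myb : ∀ e ∈ yb, e ∈ ya ++ yb ++ yc := by simp +contextual
  have myc : ∀ e ∈ yc, e ∈ ya ++ yb ++ yc := by simp +contextual
  have key := k4_parity_aux (hab.mapL T) (hbc.mapL T) (hca.mapL T) (hya.mapL T) (hyb.mapL T)
    (hyc.mapL T) (d1.mapL T) (d2.mapL T) (d3.mapL T)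
    (ht _ (by simp) _ (by simp) nab) (ht _ (by simp) _ (by simp) nbc)
    (ht _ (by simp) _ (by simp) nca)
    ⟨o1.1.mapL T, o1.2.mapL T⟩ ⟨o2.1.mapL T, o2.2.mapL T⟩ ⟨o3.1.mapL T, o3.2.mapL T⟩
    (fun e he => ⟨hx yc a (by simp) myc o1.1 e he, hx yc b (by simp) myc o1.2 e he⟩)
    (fun e he => ⟨hx ya b (by simp) mya o2.1 e he, hx ya c (by simp) mya o2.2 e he⟩)
    (fun e he => ⟨hx yb c (by simp) myb o3.1 e he, hx yb a (by simp) myb o3.2 e he⟩)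
  have happ : ∀ E F : Chain, E.mapL T ++ F.mapL T = Chain.mapL T (E ++ F) := fun E F => by
    simp [Chain.mapL]
  simp only [happ] at key
  rwa [((hab.append hbc).append hca).isCycle.upSum_mapL ((p1.1.append p2.1).append p3.1),
    (hab.isCycle_fan hya hyb).upSum_mapL ((p1.2.append o2.2).append o3.1),
    (hbc.isCycle_fan hyb hyc).upSum_mapL ((p2.2.append o3.2).append o1.1),
    (hca.isCycle_fan hyc hya).upSum_mapL ((p3.2.append o1.2).append o2.1)] at key

/-- If two tripods `y` and `z` attached to the corners of a closed chain `abc` are disjoint from the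
chain and from each other, then `y` and `z` lie on different sides of the chain. -/
theorem tripod_parity {a b c y z : ℝ × ℝ} {ab bc ca ya yb yc za zb zc : Chain}
    (hab : Joins ab a b) (hbc : Joins bc b c) (hca : Joins ca c a)
    (hya : Joins ya y a) (hyb : Joins yb y b) (hyc : Joins yc y c)
    (hza : Joins za z a) (hzb : Joins zb z b) (hzc : Joins zc z c)
    (d1 : Disj ab yc) (d2 : Disj bc ya) (d3 : Disj ca yb)
    (d1' : Disj ab zc) (d2' : Disj bc za) (d3' : Disj ca zb)
    (eca : Disj ya zc) (ecb : Disj yb zc) (eab : Disj yb za) (eac : Disj yc za)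
    (ebc : Disj yc zb) (eba : Disj ya zb)
    (nab : a ≠ b) (nbc : b ≠ c) (nca : c ≠ a) (ny : y ≠ a ∧ y ≠ b ∧ y ≠ c) :
    upSum y (ab ++ bc ++ ca) + upSum z (ab ++ bc ++ ca) = 1 := by
  have key := k4_parity hab hbc hca hya hyb hyc d1 d2 d3 nab nbc nca ny
  -- The closed chain through `a`, `b`, `y` does not separate `c` from `z`, and so on.
  have h1 := (hab.isCycle_fan hya hyb).upSum_eq_of_joins hzc ((d1'.append_left eca).append_left ecb)
  have h2 := (hbc.isCycle_fan hyb hyc).upSum_eq_of_joins hza ((d2'.append_left eab).append_left eac)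
  have h3 := (hca.isCycle_fan hyc hya).upSum_eq_of_joins hzb ((d3'.append_left ebc).append_left eba)
  have S := CharTwo.add_self_eq_zero (R := ZMod 2)
  simp only [upSum_append] at *
  linear_combination key + h1 + h2 + h3 - S (upSum z ya) - S (upSum z yb) - S (upSum z yc)

end Chain

/-! ### Hexagons and segments running inside them -/

open Filter Topology

lemma isOpen_disjoint_segment : IsOpen {x : ((ℝ × ℝ) × (ℝ × ℝ)) × ((ℝ × ℝ) × (ℝ × ℝ)) |
    Disjoint (segment ℝ x.1.1 x.1.2) (segment ℝ x.2.1 x.2.2)} := by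
  rw [← isClosed_compl_iff]
  have hc : IsClosed {z : (unitInterval × unitInterval) ×
      (((ℝ × ℝ) × (ℝ × ℝ)) × ((ℝ × ℝ) × (ℝ × ℝ))) |
      z.2.1.1 + (z.1.1 : ℝ) • (z.2.1.2 - z.2.1.1) = z.2.2.1 + (z.1.2 : ℝ) • (z.2.2.2 - z.2.2.1)} :=
    isClosed_eq (by fun_prop) (by fun_prop)
  convert isClosedMap_snd_of_compactSpace _ hc using 1
  ext x
  simp only [Set.mem_compl_iff, Set.mem_ofPred_eq, Set.not_disjoint_iff, segment_eq_image',
    Set.mem_image]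
  constructor
  · rintro ⟨y, ⟨s, hs, rfl⟩, ⟨t, ht, h⟩⟩
    exact ⟨((⟨s, hs⟩, ⟨t, ht⟩), x), h.symm, rfl⟩
  · rintro ⟨z, hz, rfl⟩
    exact ⟨_, ⟨z.1.1, z.1.1.2, rfl⟩, ⟨z.1.2, z.1.2.2, hz.symm⟩⟩

lemma isOpen_not_sameRay : IsOpen {x : (ℝ × ℝ) × (ℝ × ℝ) | ¬ SameRay ℝ x.1 x.2} := by
  rw [← isClosed_compl_iff]
  have : IsClosed {x : (ℝ × ℝ) × (ℝ × ℝ) | ‖x.1‖ • x.2 = ‖x.2‖ • x.1} :=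
    isClosed_eq (by fun_prop) (by fun_prop)
  convert this using 1
  ext x
  simp [sameRay_iff_norm_smul_eq]

namespace Chain

lemma sameRay_of_mem_segment {p v w : ℝ × ℝ} (h : p ∈ segment ℝ v w) :
    SameRay ℝ (p - v) (w - v) := by
  have h1 := mem_segment_iff_sameRay.1 h
  have := (SameRay.refl (R := ℝ) (p - v)).add_right h1
  simpa using this

lemma det_eq_zero_of_sameRay {v w : ℝ × ℝ} (h : SameRay ℝ v w) : det v w = 0 := by
  obtain ⟨e, a, b, -, -, -, h1, h2⟩ := h.exists_eq_smul
  rw [h1, h2]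
  simp [det]
  ring

/-- The closed chain of the sides of a hexagon. -/
def hex (h : Fin 6 → ℝ × ℝ) : Chain :=
  [(h 0, h 1), (h 1, h 2), (h 2, h 3), (h 3, h 4), (h 4, h 5), (h 5, h 0)]

lemma mem_hex {h : Fin 6 → ℝ × ℝ} {e} : e ∈ hex h ↔ ∃ i, e = (h i, h (i + 1)) := by
  simp [hex, Fin.exists_fin_succ]

lemma hex_isCycle (h : Fin 6 → ℝ × ℝ) : IsCycle (hex h) :=
  Joins.isCycle (p := h 0) <| by
    have := (((((joins_single (h 0) (h 1)).append (joins_single (h 1) (h 2))).append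
      (joins_single (h 2) (h 3))).append (joins_single (h 3) (h 4))).append
      (joins_single (h 4) (h 5))).append (joins_single (h 5) (h 0))
    exact this

/-- A hexagon is simple if sides that are not adjacent are disjoint and adjacent sides do not
overlap. -/
def SimpleHex (h : Fin 6 → ℝ × ℝ) : Prop :=
  (∀ i, ¬ SameRay ℝ (h (i + 1) - h i) (h (i - 1) - h i)) ∧
  ∀ i j, j ≠ i → j ≠ i + 1 → i ≠ j + 1 →
    Disjoint (segment ℝ (h i) (h (i + 1))) (segment ℝ (h j) (h (j + 1)))

/-- The segment from the vertex `h j` to `p` runs, apart from `h j`, inside the hexagon. -/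
def RunsInside (h : Fin 6 → ℝ × ℝ) (j : Fin 6) (p : ℝ × ℝ) : Prop :=
  (¬ SameRay ℝ (p - h j) (h (j + 1) - h j) ∧ ¬ SameRay ℝ (p - h j) (h (j - 1) - h j)) ∧
  (∀ i, i ≠ j → i + 1 ≠ j →
    Disjoint (segment ℝ (h j) p) (segment ℝ (h i) (h (i + 1)))) ∧
  upSum p (hex h) = 1

lemma RunsInside.avoids {h : Fin 6 → ℝ × ℝ} {j : Fin 6} {p : ℝ × ℝ} (hp : RunsInside h j p) :
    Avoids (hex h) p := by
  intro e he
  obtain ⟨i, rfl⟩ := mem_hex.1 he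
  intro hm
  by_cases h1 : i = j
  · subst h1
    exact hp.1.1 (sameRay_of_mem_segment hm)
  by_cases h2 : i + 1 = j
  · subst h2
    rw [segment_symm] at hm
    have := hp.1.2
    rw [add_sub_cancel_right] at this
    exact this (sameRay_of_mem_segment hm)
  exact Set.disjoint_left.1 (hp.2.1 i h1 h2) (right_mem_segment ℝ _ _) hm

/-- If a point avoids a segment, then it is outside the quadrilateral formed by the segment and a
small perturbation of it. -/
lemma eventually_upSum_quad {h : Fin 6 → ℝ × ℝ} {p : ℝ × ℝ} (i k : Fin 6)
    (hp : p ∉ segment ℝ (h i) (h k)) :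
    ∀ᶠ h' in 𝓝 h, upSum p [(h i, h k), (h k, h' k), (h' k, h' i), (h' i, h i)] = 0 := by
  rw [← convexHull_pair] at hp
  obtain ⟨g, hg⟩ := exists_lt_of_notMem_convexHull (by simp) hp
  have hgi : g p < g (h i) := hg _ (by simp)
  have hgk : g p < g (h k) := hg _ (by simp)
  have e1 : ∀ᶠ h' : Fin 6 → ℝ × ℝ in 𝓝 h, g p < g (h' i) :=
    (g.continuous.comp (continuous_apply i)).continuousAt.eventually_const_lt hgi
  have e2 : ∀ᶠ h' : Fin 6 → ℝ × ℝ in 𝓝 h, g p < g (h' k) :=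
    (g.continuous.comp (continuous_apply k)).continuousAt.eventually_const_lt hgk
  filter_upwards [e1, e2] with h' h1 h2
  refine IsCycle.upSum_eq_zero_of_lt ?_ g.toLinearMap ?_
  · have := (((joins_single (h i) (h k)).append (joins_single (h k) (h' k))).append
      (joins_single (h' k) (h' i))).append (joins_single (h' i) (h i))
    simpa using this.isCycle
  · simp [hgi, hgk, h1, h2]

lemma eventually_upSum_hex {h : Fin 6 → ℝ × ℝ} {p : ℝ × ℝ} (hp : Avoids (hex h) p) :
    ∀ᶠ h' in 𝓝 h, upSum p (hex h') = upSum p (hex h) := by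
  have hq : ∀ i, p ∉ segment ℝ (h i) (h (i + 1)) := fun i => hp _ (mem_hex.2 ⟨i, rfl⟩)
  filter_upwards [eventually_upSum_quad 0 1 (hq 0), eventually_upSum_quad 1 2 (hq 1),
    eventually_upSum_quad 2 3 (hq 2), eventually_upSum_quad 3 4 (hq 3),
    eventually_upSum_quad 4 5 (hq 4), eventually_upSum_quad 5 0 (hq 5)] with h' h0 h1 h2 h3 h4 h5
  have S := CharTwo.add_self_eq_zero (R := ZMod 2)
  have C := fun i j => up_comm p (h' i) (h' j)
  have C' := fun i => up_comm p (h' i) (h i)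
  simp only [hex, upSum_cons, upSum_nil, add_zero] at *
  linear_combination h0 + h1 + h2 + h3 + h4 + h5 - S (up p (h 0) (h 1)) - S (up p (h 1) (h 2))
    - S (up p (h 2) (h 3)) - S (up p (h 3) (h 4)) - S (up p (h 4) (h 5)) - S (up p (h 5) (h 0))
    - S (up p (h 0) (h' 0)) - S (up p (h 1) (h' 1)) - S (up p (h 2) (h' 2))
    - S (up p (h 3) (h' 3)) - S (up p (h 4) (h' 4)) - S (up p (h 5) (h' 5))
    - C' 0 - C' 1 - C' 2 - C' 3 - C' 4 - C' 5 - C 1 0 - C 2 1 - C 3 2 - C 4 3 - C 5 4 - C 0 5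

end Chain

/-! ### Stability under small perturbations and separating directions -/

namespace Chain

lemma eventually_not_sameRay {h : Fin 6 → ℝ × ℝ} {f g : (Fin 6 → ℝ × ℝ) → ℝ × ℝ}
    (hf : Continuous f) (hg : Continuous g) (hh : ¬ SameRay ℝ (f h) (g h)) :
    ∀ᶠ h' in 𝓝 h, ¬ SameRay ℝ (f h') (g h') :=
  (hf.prodMk hg).continuousAt.eventually (isOpen_not_sameRay.mem_nhds hh)

lemma eventually_disjoint_segment {h : Fin 6 → ℝ × ℝ} {f f' g g' : (Fin 6 → ℝ × ℝ) → ℝ × ℝ}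
    (hf : Continuous f) (hf' : Continuous f') (hg : Continuous g) (hg' : Continuous g')
    (hh : Disjoint (segment ℝ (f h) (f' h)) (segment ℝ (g h) (g' h))) :
    ∀ᶠ h' in 𝓝 h, Disjoint (segment ℝ (f h') (f' h')) (segment ℝ (g h') (g' h')) :=
  ((hf.prodMk hf').prodMk (hg.prodMk hg')).continuousAt.eventually
    (isOpen_disjoint_segment.mem_nhds hh)

lemma SimpleHex.eventually {h : Fin 6 → ℝ × ℝ} (hs : SimpleHex h) :
    ∀ᶠ h' in 𝓝 h, SimpleHex h' := by
  refine (eventually_all.2 fun i => ?_).and (eventually_all.2 fun i => eventually_all.2 fun j => ?_)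
  · exact eventually_not_sameRay (f := fun h => h (i + 1) - h i) (g := fun h => h (i - 1) - h i)
      (by fun_prop) (by fun_prop) (hs.1 i)
  · by_cases hij : j ≠ i ∧ j ≠ i + 1 ∧ i ≠ j + 1
    · filter_upwards [eventually_disjoint_segment (f := fun h => h i) (f' := fun h => h (i + 1))
        (g := fun h => h j) (g' := fun h => h (j + 1)) (by fun_prop) (by fun_prop) (by fun_prop)
        (by fun_prop) (hs.2 i j hij.1 hij.2.1 hij.2.2)] with h' hh' _ _ _
      exact hh'
    · exact Eventually.of_forall fun h' h1 h2 h3 => absurd ⟨h1, h2, h3⟩ hij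

lemma RunsInside.eventually {h : Fin 6 → ℝ × ℝ} {j : Fin 6} {p : ℝ × ℝ}
    (hp : RunsInside h j p) : ∀ᶠ h' in 𝓝 h, RunsInside h' j p := by
  refine (Eventually.and ?_ ?_).and (Eventually.and ?_ ?_)
  · exact eventually_not_sameRay (f := fun h => p - h j) (g := fun h => h (j + 1) - h j)
      (by fun_prop) (by fun_prop) hp.1.1
  · exact eventually_not_sameRay (f := fun h => p - h j) (g := fun h => h (j - 1) - h j)
      (by fun_prop) (by fun_prop) hp.1.2
  · refine eventually_all.2 fun i => ?_
    by_cases hij : i ≠ j ∧ i + 1 ≠ j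
    · filter_upwards [eventually_disjoint_segment (f := fun h => h j) (f' := fun h => p)
        (g := fun h => h i) (g' := fun h => h (i + 1)) (by fun_prop) (by fun_prop) (by fun_prop)
        (by fun_prop) (hp.2.1 i hij.1 hij.2)] with h' hh' _ _
      exact hh'
    · exact Eventually.of_forall fun h' h1 h2 => absurd ⟨h1, h2⟩ hij
  · filter_upwards [eventually_upSum_hex hp.avoids] with h' hh'
    rw [hh', hp.2.2]

lemma det_smul_right (v w : ℝ × ℝ) (c : ℝ) : det v (c • w) = c * det v w := by
  simp [det]; ring

lemma det_smul_left (v w : ℝ × ℝ) (c : ℝ) : det (c • v) w = c * det v w := by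
  simp [det]; ring

lemma det_add_right (v w w' : ℝ × ℝ) : det v (w + w') = det v w + det v w' := by
  simp [det]; ring

lemma det_add_left (v v' w : ℝ × ℝ) : det (v + v') w = det v w + det v' w := by
  simp [det]; ring

lemma det_self (v : ℝ × ℝ) : det v v = 0 := by
  simp [det]; ring

/-- Two parallel nonzero vectors are proportional. -/
lemma exists_smul_of_det_eq_zero {v w : ℝ × ℝ} (hv : v ≠ 0) (h : det v w = 0) :
    ∃ c : ℝ, w = c • v := by
  simp only [det] at h
  by_cases h1 : v.1 = 0
  · have h2 : v.2 ≠ 0 := fun h2 => hv (Prod.ext h1 h2)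
    refine ⟨w.2 / v.2, Prod.ext ?_ ?_⟩
    · have : v.2 * w.1 = 0 := by rw [h1] at h; linarith
      simp [h1, (mul_eq_zero.1 this).resolve_left h2]
    · simp [h2]
  · refine ⟨w.1 / v.1, Prod.ext ?_ ?_⟩
    · simp [h1]
    · simp only [Prod.smul_snd, smul_eq_mul]
      field_simp
      linarith

lemma sq_add_sq_pos {v : ℝ × ℝ} (hv : v ≠ 0) : 0 < v.1 ^ 2 + v.2 ^ 2 := by
  by_contra h
  have h1 : v.1 = 0 := by nlinarith [sq_nonneg v.1, sq_nonneg v.2]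
  have h2 : v.2 = 0 := by nlinarith [sq_nonneg v.1, sq_nonneg v.2]
  exact hv (Prod.ext h1 h2)

/-- There is a line direction `n`, not parallel to `u`, that separates two vectors. -/
lemma exists_transversal {v w u : ℝ × ℝ} (hvw : ¬ SameRay ℝ v w) (hu : u ≠ 0) :
    ∃ n, det n v * det n w < 0 ∧ det n u ≠ 0 := by
  have hv : v ≠ 0 := fun h => hvw (h ▸ SameRay.zero_left _)
  by_cases hd : det v w = 0
  · obtain ⟨c, rfl⟩ := exists_smul_of_det_eq_zero hv hd
    have hc : c < 0 := by
      by_contra hc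
      exact hvw (SameRay.sameRay_nonneg_smul_right v (not_lt.1 hc))
    have hN := sq_add_sq_pos hv
    have hprod : ∀ κ : ℝ, det ((-v.2, v.1) + κ • v) v * det ((-v.2, v.1) + κ • v) (c • v) < 0 := by
      intro κ
      have : det ((-v.2, v.1) + κ • v) v = -(v.1 ^ 2 + v.2 ^ 2) := by simp [det]; ring
      rw [det_smul_right, this]
      nlinarith [mul_pos hN hN]
    by_cases h0 : det ((-v.2, v.1) + (0 : ℝ) • v) u = 0
    · refine ⟨_, hprod 1, fun h1 => hu ?_⟩
      rw [det_add_left, det_smul_left] at h0 h1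
      simp only [zero_mul, add_zero, one_mul] at h0 h1
      rw [h0, zero_add] at h1
      simp only [det] at h0 h1
      have e1 : (v.1 ^ 2 + v.2 ^ 2) * u.1 = 0 := by linear_combination -v.2 * h1 - v.1 * h0
      have e2 : (v.1 ^ 2 + v.2 ^ 2) * u.2 = 0 := by linear_combination v.1 * h1 - v.2 * h0
      exact Prod.ext ((mul_eq_zero.1 e1).resolve_left hN.ne')
        ((mul_eq_zero.1 e2).resolve_left hN.ne')
    · exact ⟨_, hprod 0, h0⟩
  · have hprod : ∀ κ : ℝ, 0 < κ → det (v + κ • w) v * det (v + κ • w) w < 0 := by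
      intro κ hκ
      have : det (v + κ • w) v * det (v + κ • w) w = -(κ * det v w ^ 2) := by simp [det]; ring
      rw [this, neg_lt_zero]
      positivity
    by_cases h0 : det (v + (1 : ℝ) • w) u = 0
    · refine ⟨_, hprod 2 (by norm_num), fun h1 => hu ?_⟩
      rw [det_add_left, det_smul_left] at h0 h1
      have e1 : det w u = 0 := by linarith
      have e2 : det v u = 0 := by linarith
      have f1 : det v w * u.1 = 0 := by
        simp only [det] at *; linear_combination w.1 * e2 - v.1 * e1
      have f2 : det v w * u.2 = 0 := by
        simp only [det] at *; linear_combination w.2 * e2 - v.2 * e1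
      exact Prod.ext ((mul_eq_zero.1 f1).resolve_left hd) ((mul_eq_zero.1 f2).resolve_left hd)
    · exact ⟨_, hprod 1 one_pos, h0⟩

/-- The similarity of the plane that takes `u` to the vertical direction. -/
noncomputable def turn (u : ℝ × ℝ) (hu : u ≠ 0) : (ℝ × ℝ) ≃ₗ[ℝ] (ℝ × ℝ) where
  toFun p := (det u p, u.1 * p.1 + u.2 * p.2)
  invFun p := ((u.1 * p.2 - u.2 * p.1) / (u.1 ^ 2 + u.2 ^ 2),
    (u.1 * p.1 + u.2 * p.2) / (u.1 ^ 2 + u.2 ^ 2))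
  map_add' p q := by ext <;> simp [det] <;> ring
  map_smul' c p := by ext <;> simp [det] <;> ring
  left_inv p := by
    have := (sq_add_sq_pos hu).ne'
    ext <;> simp only [det] <;> field_simp <;> ring
  right_inv p := by
    have := (sq_add_sq_pos hu).ne'
    ext <;> simp only [det] <;> field_simp <;> ring

lemma turn_fst (u : ℝ × ℝ) (hu : u ≠ 0) (p : ℝ × ℝ) : (turn u hu p).1 = det u p := rfl

lemma turn_snd (u : ℝ × ℝ) (hu : u ≠ 0) (p : ℝ × ℝ) :
    (turn u hu p).2 = u.1 * p.1 + u.2 * p.2 := rfl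

/-- The case of a horizontal diagonal of `upSum_quad`: of the four sides, the ray meets exactly one
of the two at the upper vertex `a`. -/
lemma upSum_quad_horizontal {m a b : ℝ × ℝ} {r : ℝ} (hr : 0 < r) (ha : m.2 < a.2)
    (hb : b.2 < m.2) :
    up m a (m - (r, 0)) + up m (m - (r, 0)) b + up m b (m + (r, 0)) + up m (m + (r, 0)) a = 1 := by
  have hl : (m - (r, 0)).1 ≤ m.1 := by simp [hr.le]
  have hl' : m.1 < (m + (r, 0)).1 := by simp [hr]
  have dl : ∀ x : ℝ × ℝ, det (m - (r, 0) - m) (x - m) = r * (m.2 - x.2) := by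
    intro x; simp [det]; ring
  have dr : ∀ x : ℝ × ℝ, det (x - m) (m + (r, 0) - m) = r * (m.2 - x.2) := by
    intro x; simp [det]; ring
  have key : ∀ x : ℝ × ℝ, x.2 ≠ m.2 → up m (m - (r, 0)) x + up m x (m + (r, 0)) =
      if m.2 < x.2 then 1 else 0 := by
    intro x hx
    have hiff : r * (m.2 - x.2) < 0 ↔ m.2 < x.2 := by
      rw [mul_neg_iff]
      grind
    rcases le_or_gt x.1 m.1 with h | h
    · have h0 : up m (m - (r, 0)) x = 0 := by
        rw [up, if_neg]; exact fun h' => h'.1 (iff_of_true hl h)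
      rw [h0, zero_add, up_eq_of_lt h hl', dr]
      simp only [hiff]
    · have h0 : up m x (m + (r, 0)) = 0 := by
        rw [up, if_neg]; exact fun h' => h'.1 (iff_of_false (not_le.2 h) (not_le.2 hl'))
      rw [h0, add_zero, up_eq_of_lt hl h, dl]
      simp only [hiff]
  have k1 := key a ha.ne'
  have k2 := key b hb.ne
  rw [if_pos ha] at k1
  rw [if_neg (not_lt.2 hb.le)] at k2
  rw [up_comm m a, up_comm m (m + (r, 0)) a]
  linear_combination k1 + k2

lemma notMem_segment_of_det {m x n : ℝ × ℝ} (h : det n (x - m) ≠ 0) :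
    m ∉ segment ℝ x (m + n) := by
  intro hm
  have h1 := sameRay_of_mem_segment (segment_symm ℝ x (m + n) ▸ hm)
  have h2 : SameRay ℝ (-n) (x - m - n) := by
    convert h1 using 1 <;> [simp; abel]
  have h3 := det_eq_zero_of_sameRay h2
  apply h
  simp only [det, Prod.fst_sub, Prod.snd_sub, Prod.fst_neg, Prod.snd_neg] at h3 ⊢
  linarith

/-- The point `m` is inside the quadrilateral with diagonal from `m - n` to `m + n`, if the line of
this diagonal separates the other two vertices. -/
lemma upSum_quad {m a b n : ℝ × ℝ} (h : det n (a - m) * det n (b - m) < 0) :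
    upSum m [(a, m + n), (m + n, b), (b, m - n), (m - n, a)] = 1 := by
  have hn : n ≠ 0 := by rintro rfl; simp [det] at h
  have hu : ((-n.2, n.1) : ℝ × ℝ) ≠ 0 := by
    intro h0
    simp only [Prod.mk_eq_zero, neg_eq_zero] at h0
    exact hn (Prod.ext h0.2 h0.1)
  have ha : det n (a - m) ≠ 0 := left_ne_zero_of_mul h.ne
  have hb : det n (b - m) ≠ 0 := right_ne_zero_of_mul h.ne
  have hneg : ∀ x, det n (x - m) ≠ 0 → m ∉ segment ℝ x (m - n) := by
    intro x hx
    rw [sub_eq_add_neg]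
    apply notMem_segment_of_det
    have : det (-n) (x - m) = -det n (x - m) := by simp [det]; ring
    rwa [this, neg_ne_zero]
  have hcyc : IsCycle [(a, m + n), (m + n, b), (b, m - n), (m - n, a)] :=
    Joins.isCycle (p := a) (((joins_single a (m + n)).append (joins_single (m + n) b)).append
      (joins_single b (m - n)) |>.append (joins_single (m - n) a))
  have hav : Avoids [(a, m + n), (m + n, b), (b, m - n), (m - n, a)] m := by
    intro e he
    simp only [List.mem_cons, List.not_mem_nil, or_false] at he
    rcases he with rfl | rfl | rfl | rfl
    · exact notMem_segment_of_det ha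
    · rw [segment_symm]; exact notMem_segment_of_det hb
    · exact hneg b hb
    · rw [segment_symm]; exact hneg a ha
  rw [← hcyc.upSum_mapL hav (turn _ hu)]
  set T := turn _ hu with hT
  have hTn : T n = (-(n.1 ^ 2 + n.2 ^ 2), 0) := by
    ext
    · rw [hT, turn_fst]; simp [det]; ring
    · rw [hT, turn_snd]; simp; ring
  have hT2 : ∀ x, (T x).2 - (T m).2 = det n (x - m) := by
    intro x
    rw [hT, turn_snd, turn_snd]; simp [det]; ring
  have hr := sq_add_sq_pos hn
  have e1 : T (m + n) = T m - (n.1 ^ 2 + n.2 ^ 2, 0) := by rw [map_add, hTn]; ext <;> simp; ring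
  have e2 : T (m - n) = T m + (n.1 ^ 2 + n.2 ^ 2, 0) := by
    rw [map_sub, hTn]; ext
    · simp only [Prod.fst_sub, Prod.fst_add]; ring
    · simp
  simp only [mapL, List.map_cons, List.map_nil, Prod.map, upSum_cons, upSum_nil, add_zero, e1, e2]
  have ha2 := hT2 a
  have hb2 := hT2 b
  rcases mul_neg_iff.1 h with ⟨h1, h2⟩ | ⟨h1, h2⟩
  · have := upSum_quad_horizontal (m := T m) (a := T a) (b := T b) hr (by linarith) (by linarith)
    linear_combination this
  · have := upSum_quad_horizontal (m := T m) (a := T b) (b := T a) hr (by linarith) (by linarith)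
    have c := up_comm (T m)
    linear_combination this + c (T a) (T m - (n.1 ^ 2 + n.2 ^ 2, 0)) +
      c (T m - (n.1 ^ 2 + n.2 ^ 2, 0)) (T b) + c (T b) (T m + (n.1 ^ 2 + n.2 ^ 2, 0)) +
      c (T m + (n.1 ^ 2 + n.2 ^ 2, 0)) (T a)

end Chain

/-! ### Pushing a vertex of a hexagon outwards -/

namespace Chain

/-- The crossing number of a hexagon as a function of one of its vertices. -/
lemma exists_upSum_hex_update (h : Fin 6 → ℝ × ℝ) (i : Fin 6) (q : ℝ × ℝ) :
    ∃ r, ∀ x, upSum q (hex (Function.update h i x)) =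
      up q (h (i - 1)) x + up q x (h (i + 1)) + r := by
  fin_cases i
  · exact ⟨up q (h 1) (h 2) + up q (h 2) (h 3) + up q (h 3) (h 4) + up q (h 4) (h 5),
      fun x => by simp [hex, show (-1 : Fin 6) = 5 from rfl]; ring⟩
  · exact ⟨up q (h 2) (h 3) + up q (h 3) (h 4) + up q (h 4) (h 5) + up q (h 5) (h 0),
      fun x => by simp [hex]; ring⟩
  · exact ⟨up q (h 0) (h 1) + up q (h 3) (h 4) + up q (h 4) (h 5) + up q (h 5) (h 0),
      fun x => by simp [hex]; ring⟩
  · exact ⟨up q (h 0) (h 1) + up q (h 1) (h 2) + up q (h 4) (h 5) + up q (h 5) (h 0),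
      fun x => by simp [hex]; ring⟩
  · exact ⟨up q (h 0) (h 1) + up q (h 1) (h 2) + up q (h 2) (h 3) + up q (h 5) (h 0),
      fun x => by simp [hex]; ring⟩
  · exact ⟨up q (h 0) (h 1) + up q (h 1) (h 2) + up q (h 2) (h 3) + up q (h 3) (h 4),
      fun x => by simp [hex]; ring⟩

/-- The two sides of a line through `m` that separates `a` and `b`. -/
lemma disjoint_segment_of_transversal {m a b n : ℝ × ℝ}
    (h : det n (a - m) * det n (b - m) < 0) (hn : n ≠ 0) :
    Disjoint (segment ℝ a m) (segment ℝ (m + n) b) := by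
  rw [Set.disjoint_left]
  rintro x ⟨s, t, hs, ht, hst, rfl⟩ ⟨s', t', hs', ht', hst', hx⟩
  have e1 : det n (s • a + t • m - m) = s * det n (a - m) := by
    have : s • a + t • m - m = s • (a - m) := by
      rw [← sub_eq_zero, show t = 1 - s by linarith]; module
    rw [this, det_smul_right]
  have e2 : det n (s' • (m + n) + t' • b - m) = t' * det n (b - m) := by
    have : s' • (m + n) + t' • b - m = t' • (b - m) + s' • n := by
      rw [← sub_eq_zero, show t' = 1 - s' by linarith]; module
    rw [this, det_add_right, det_smul_right, det_smul_right, det_self, mul_zero, add_zero]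
  rw [hx, e1] at e2
  have hs0 : s = 0 := by
    rcases mul_neg_iff.1 h with ⟨h1, h2⟩ | ⟨h1, h2⟩
    · by_contra h0
      have := mul_pos (lt_of_le_of_ne hs (Ne.symm h0)) h1
      nlinarith
    · by_contra h0
      have := mul_neg_of_pos_of_neg (lt_of_le_of_ne hs (Ne.symm h0)) h1
      nlinarith
  have ht0 : t' = 0 := by
    rw [hs0, zero_mul, eq_comm] at e2
    exact (mul_eq_zero.1 e2).resolve_right (right_ne_zero_of_mul h.ne)
  have : t = 1 := by linarith
  have : s' = 1 := by linarith
  subst s t t' s'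
  simp at hx
  exact hn hx

/-- The vertex `h i` of a simple hexagon can be pushed slightly outwards: the sides at `h i` of the
original hexagon then run inside the new one, as do all segments of a given finite family that did
so before, and the new sides can be chosen not parallel to a given vector `u`. -/
theorem SimpleHex.exists_push {h : Fin 6 → ℝ × ℝ} (hs : SimpleHex h) (i : Fin 6) {u : ℝ × ℝ}
    (hu : u ≠ 0) {s : Set (Fin 6 × (ℝ × ℝ))} (hfin : s.Finite) :
    ∃ m, SimpleHex (Function.update h i m) ∧
      (∀ x ∈ s, RunsInside h x.1 x.2 → RunsInside (Function.update h i m) x.1 x.2) ∧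
      RunsInside (Function.update h i m) (i - 1) (h i) ∧
      RunsInside (Function.update h i m) (i + 1) (h i) ∧
      det (m - h (i - 1)) u ≠ 0 ∧ det (m - h (i + 1)) u ≠ 0 := by
  have hi1 : ∀ i : Fin 6, i + 1 ≠ i := by decide
  have hi2 : ∀ i : Fin 6, i - 1 ≠ i := by decide
  set a := h (i - 1) with ha
  set b := h (i + 1) with hb
  obtain ⟨n, hn, hnu⟩ := exists_transversal (v := a - h i) (w := b - h i)
    (fun h' => hs.1 i h'.symm) hu
  have hn0 : n ≠ 0 := by rintro rfl; simp [det] at hn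
  have hcont : Continuous fun τ : ℝ => Function.update h i (h i + τ • n) :=
    continuous_const.update i (by fun_prop)
  have hlim : Tendsto (fun τ : ℝ => Function.update h i (h i + τ • n)) (𝓝 0) (𝓝 h) := by
    have := hcont.tendsto 0
    simpa using this
  have ev1 := hlim.eventually hs.eventually
  have ev2 : ∀ᶠ τ : ℝ in 𝓝 0, ∀ x ∈ s, RunsInside h x.1 x.2 →
      RunsInside (Function.update h i (h i + τ • n)) x.1 x.2 := by
    rw [eventually_all_finite hfin]
    intro x hx
    by_cases hr : RunsInside h x.1 x.2
    · filter_upwards [hlim.eventually hr.eventually] with τ hτ _ using hτ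
    · exact Eventually.of_forall fun τ h' => absurd h' hr
  have ev3 : ∀ c : ℝ × ℝ, ∀ᶠ τ : ℝ in 𝓝 0, τ ≠ 0 → det (h i + τ • n - c) u ≠ 0 := by
    intro c
    have hlin : ∀ τ : ℝ, det (h i + τ • n - c) u = det (h i - c) u + τ * det n u := by
      intro τ; simp [det]; ring
    by_cases h0 : det (h i - c) u = 0
    · refine Eventually.of_forall fun τ hτ => ?_
      rw [hlin, h0, zero_add]
      exact mul_ne_zero hτ hnu
    · have : ContinuousAt (fun τ : ℝ => det (h i - c) u + τ * det n u) 0 := by fun_prop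
      filter_upwards [this.eventually_ne (by simpa using h0)] with τ hτ _
      rwa [hlin]
  obtain ⟨ε, hε, hball⟩ := Metric.eventually_nhds_iff.1 (ev1.and (ev2.and ((ev3 a).and (ev3 b))))
  -- Of the two opposite pushes, exactly one has the old vertex inside the new hexagon.
  obtain ⟨τ, hτ0, hτε, hτ⟩ : ∃ τ : ℝ, τ ≠ 0 ∧ |τ| < ε ∧
      upSum (h i) (hex (Function.update h i (h i + τ • n))) = 1 := by
    obtain ⟨r, hr⟩ := exists_upSum_hex_update h i (h i)
    have hε2 : ε / 2 ≠ 0 := by positivity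
    have hq := upSum_quad (m := h i) (a := a) (b := b) (n := (ε / 2) • n) (by
      rw [det_smul_left, det_smul_left]
      nlinarith [mul_pos hε hε])
    have h1 := hr (h i + (ε / 2) • n)
    have h2 := hr (h i - (ε / 2) • n)
    simp only [upSum_cons, upSum_nil, add_zero] at hq
    have S := CharTwo.add_self_eq_zero (R := ZMod 2)
    have hsum : upSum (h i) (hex (Function.update h i (h i + (ε / 2) • n))) +
        upSum (h i) (hex (Function.update h i (h i - (ε / 2) • n))) = 1 := by
      rw [h1, h2]
      linear_combination hq + S r + up_comm (h i) a (h i - (ε / 2) • n) +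
        up_comm (h i) (h i - (ε / 2) • n) b
    have habs : |ε / 2| < ε := by rw [abs_of_pos (by positivity)]; linarith
    have h01 : ∀ x y : ZMod 2, x + y = 1 → x = 1 ∨ y = 1 := by decide
    rcases h01 _ _ hsum with h3 | h3
    · exact ⟨ε / 2, hε2, habs, h3⟩
    · refine ⟨-(ε / 2), neg_ne_zero.2 hε2, by rwa [abs_neg], ?_⟩
      rwa [neg_smul, ← sub_eq_add_neg]
  obtain ⟨h1, h2, h3, h4⟩ := hball (y := τ) (by simpa using hτε)
  have hdet : det (τ • n) (a - h i) * det (τ • n) (b - h i) < 0 := by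
    rw [det_smul_left, det_smul_left]
    have := mul_pos_of_neg_of_neg hn (neg_neg_of_pos (pow_pos (abs_pos.2 hτ0) 2))
    rw [sq_abs] at this
    nlinarith
  have hτn : τ • n ≠ 0 := smul_ne_zero hτ0 hn0
  refine ⟨h i + τ • n, h1, h2, ⟨⟨?_, ?_⟩, ?_, hτ⟩, ⟨⟨?_, ?_⟩, ?_, hτ⟩, h3 hτ0, h4 hτ0⟩
  · rw [sub_add_cancel, Function.update_self, Function.update_of_ne (hi2 i)]
    intro hsr
    have := det_eq_zero_of_sameRay hsr
    apply left_ne_zero_of_mul hdet.ne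
    rw [← this]
    simp [det]; ring
  · have hne : ∀ i : Fin 6, i - 1 - 1 ≠ i := by decide
    rw [Function.update_of_ne (hi2 i), Function.update_of_ne (hne i)]
    have := hs.1 (i - 1)
    rwa [sub_add_cancel] at this
  · intro k hk hk'
    rw [Function.update_of_ne (hi2 i)]
    by_cases hki : k = i
    · subst hki
      rw [Function.update_self, Function.update_of_ne (hi1 k)]
      exact disjoint_segment_of_transversal hdet hτn
    · have hki' : k + 1 ≠ i := fun h => hk (by rw [← h, add_sub_cancel_right])
      rw [Function.update_of_ne hki, Function.update_of_ne hki']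
      have := hs.2 (i - 1) k hk (by rwa [sub_add_cancel]) (Ne.symm hk')
      rwa [sub_add_cancel] at this
  · have hne : ∀ i : Fin 6, i + 1 + 1 ≠ i := by decide
    rw [Function.update_of_ne (hi1 i), Function.update_of_ne (hne i)]
    have := hs.1 (i + 1)
    rw [add_sub_cancel_right] at this
    exact fun h' => this h'.symm
  · rw [add_sub_cancel_right, Function.update_self, Function.update_of_ne (hi1 i)]
    intro hsr
    have := det_eq_zero_of_sameRay hsr
    apply right_ne_zero_of_mul hdet.ne
    rw [← this]
    simp [det]; ring
  · intro k hk hk'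
    rw [Function.update_of_ne (hi1 i)]
    have hki : k ≠ i := fun h => hk' (by rw [h])
    rw [Function.update_of_ne hki]
    by_cases hki' : k + 1 = i
    · subst hki'
      rw [Function.update_self, ← segment_symm ℝ (h (k + 1) + τ • n)]
      have hak : a = h k := by rw [ha, add_sub_cancel_right]
      rw [← hak]
      exact disjoint_segment_of_transversal (by rwa [mul_comm]) hτn
    · rw [Function.update_of_ne hki', segment_symm]
      exact hs.2 i k hki hk (Ne.symm hki')

end Chain

/-! ### Hexagons with two reflex extrema -/

namespace Chain

open Classical in
/-- A segment on the right of the vertical line through `a` counts as a crossing only if it touches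
this line at one end, above `a`. -/
lemma up_eq_add_of_le {a p q : ℝ × ℝ} (hp : a.1 ≤ p.1) (hq : a.1 ≤ q.1) (hpq : p.1 ≠ q.1) :
    up a p q = (if p.1 = a.1 ∧ a.2 < p.2 then 1 else 0) +
      (if q.1 = a.1 ∧ a.2 < q.2 then 1 else 0) := by
  rcases hp.eq_or_lt with h | h
  · have h1 : ¬ q.1 ≤ a.1 := by rw [not_le]; exact lt_of_le_of_ne hq (by rwa [h])
    have h2 : q.1 ≠ a.1 := fun h => h1 h.le
    have h3 := lineY_left p q
    rw [← h] at h3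
    simp [up, h.symm, h1, h2, h3]
  · rcases hq.eq_or_lt with h' | h'
    · have h1 : ¬ p.1 ≤ a.1 := not_le.2 h
      have h3 := lineY_right hpq
      rw [← h'] at h3
      simp [up, h'.symm, h1, h.ne', h3]
    · simp [up, h.ne', h'.ne', not_le.2 h, not_le.2 h']

/-- A point with an odd number of crossings of a path above it is not on the left of the path. -/
lemma exists_lt_of_upSum_eq_one {a p q r s t : ℝ × ℝ} (hp : a.1 < p.1) (ht : a.1 < t.1)
    (h1 : p.1 ≠ q.1) (h2 : q.1 ≠ r.1) (h3 : r.1 ≠ s.1) (h4 : s.1 ≠ t.1)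
    (h : upSum a [(p, q), (q, r), (r, s), (s, t)] = 1) : q.1 < a.1 ∨ r.1 < a.1 ∨ s.1 < a.1 := by
  classical
  by_contra! hcon
  obtain ⟨hq, hr, hs⟩ := hcon
  simp only [upSum_cons, upSum_nil, up_eq_add_of_le hp.le hq h1, up_eq_add_of_le hq hr h2,
    up_eq_add_of_le hr hs h3, up_eq_add_of_le hs ht.le h4] at h
  have S := CharTwo.add_self_eq_zero (R := ZMod 2)
  rw [if_neg (c := p.1 = a.1 ∧ a.2 < p.2) (fun h => hp.ne' h.1),
    if_neg (c := t.1 = a.1 ∧ a.2 < t.2) (fun h => ht.ne' h.1)] at h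
  apply zero_ne_one (α := ZMod 2)
  rw [← h]
  linear_combination - S (if q.1 = a.1 ∧ a.2 < q.2 then 1 else 0)
    - S (if r.1 = a.1 ∧ a.2 < r.2 then 1 else 0) - S (if s.1 = a.1 ∧ a.2 < s.2 then 1 else 0)

/-- A point with an odd number of crossings of a path above it is not on the right of the path. -/
lemma exists_gt_of_upSum_eq_one {a p q r s t : ℝ × ℝ} (hp : p.1 < a.1) (ht : t.1 < a.1)
    (h : upSum a [(p, q), (q, r), (r, s), (s, t)] = 1) : a.1 < q.1 ∨ a.1 < r.1 ∨ a.1 < s.1 := by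
  by_contra! hcon
  obtain ⟨hq, hr, hs⟩ := hcon
  simp [up, hp.le, ht.le, hq, hr, hs] at h

/-- The spiral configuration: the path `n c l` spans the whole range of abscissae, and the
edges `bn` and `la` would have to cross. -/
lemma not_spiral {a m b n c l : ℝ × ℝ} (dα : Disj [(a, m), (m, b)] [(n, c), (c, l)])
    (dβ : Disjoint (segment ℝ b n) (segment ℝ l a))
    (hna : n.1 < a.1) (ham : a.1 < m.1) (hmb : m.1 < b.1) (hbl : b.1 < l.1)
    (ua : upSum a [(m, b), (b, n), (n, c), (c, l)] = 1)
    (ub : upSum b [(n, c), (c, l), (l, a), (a, m)] = 1) : False := by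
  have B := ((joins_single n c).append (joins_single c l)).upSum_add_upSum
    ((joins_single a m).append (joins_single m b)) dα.symm
  have C := up_add_up_eq_down_add_down dβ
  have e1 : up a m b = 0 := by simp [up, not_le.2 ham, not_le.2 (ham.trans hmb)]
  have e2 : up b a m = 0 := by simp [up, hmb.le, (ham.trans hmb).le]
  have e3 : up l b n = 0 := by simp [up, hbl.le, (hna.trans (ham.trans (hmb.trans hbl))).le]
  have e4 : down n l a = 0 := by
    simp [down, hna.le, (hna.trans (ham.trans (hmb.trans hbl))).le]
  have e5 : downSum n [(a, m), (m, b)] = 0 := by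
    simp [down, hna.le, (hna.trans ham).le, (hna.trans (ham.trans hmb)).le]
  have e6 : downSum l [(a, m), (m, b)] = 0 := by
    simp [down, not_le.2 hbl, not_le.2 (hmb.trans hbl), not_le.2 (ham.trans (hmb.trans hbl))]
  -- `b` is on exactly one side of the edge `la`, whose range of abscissae contains its own.
  have hne : up b l a + down b l a = 1 := by
    have hal : a.1 < l.1 := ham.trans (hmb.trans hbl)
    have hab : a.1 < b.1 := ham.trans hmb
    have hb : b ∉ segment ℝ l a := Set.disjoint_left.1 dβ (left_mem_segment ℝ _ _)
    have hy : lineY l a b.1 ≠ b.2 := by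
      intro h
      apply hb
      have : (b.1, lineY l a b.1) = b := by rw [h]
      rw [← this, segment_symm, lineY_comm hal.ne']
      exact lineY_mem_segment hal hab.le hbl.le
    unfold up down
    rcases lt_or_gt_of_ne hy with h | h
    · simp [h, h.le, hab.le, not_le.2 hab, hbl.le, not_le.2 hbl]
    · simp [h, h.le, hab.le, not_le.2 hab, hbl.le, not_le.2 hbl]
  simp only [upSum_cons, upSum_nil, List.cons_append, List.nil_append, e1, e2, e3, e4, e5, e6,
    add_zero, zero_add] at *
  apply zero_ne_one (α := ZMod 2)
  linear_combination ua + ub - B - C - hne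

/-- Let `a m b n c l` be a hexagon without vertical sides. Suppose that `a` and `b` are local
extrema of the abscissa and that the upward ray at each of them crosses the four sides not
containing it an odd number of times. Then `c` is a local extremum as well, and the upward ray at
`c` crosses the four sides not containing it an even number of times. -/
theorem hexagon_contradiction {a m b n c l : ℝ × ℝ}
    (dα : Disj [(a, m), (m, b)] [(n, c), (c, l)])
    (dβ : Disjoint (segment ℝ b n) (segment ℝ l a))
    (xam : a.1 ≠ m.1) (xmb : m.1 ≠ b.1) (xbn : b.1 ≠ n.1) (xnc : n.1 ≠ c.1) (xcl : c.1 ≠ l.1)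
    (xla : l.1 ≠ a.1) (ea : m.1 < a.1 ↔ l.1 < a.1) (eb : n.1 < b.1 ↔ m.1 < b.1)
    (ua : upSum a [(m, b), (b, n), (n, c), (c, l)] = 1)
    (ub : upSum b [(n, c), (c, l), (l, a), (a, m)] = 1)
    (uc : ¬ (l.1 < c.1 ↔ n.1 < c.1) ∨ upSum c [(l, a), (a, m), (m, b), (b, n)] = 1) : False := by
  have A1 := fun h1 h2 => exists_lt_of_upSum_eq_one (a := a) h1 h2 xmb xbn xnc xcl ua
  have A2 := fun h1 h2 => exists_gt_of_upSum_eq_one (a := a) h1 h2 ua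
  have B1 := fun h1 h2 => exists_lt_of_upSum_eq_one (a := b) h1 h2 xnc xcl xla xam ub
  have B2 := fun h1 h2 => exists_gt_of_upSum_eq_one (a := b) h1 h2 ub
  have C1 := fun h1 h2 h => exists_lt_of_upSum_eq_one (a := c) h1 h2 xla xam xmb xbn h
  have C2 := fun h1 h2 h => exists_gt_of_upSum_eq_one (a := c) (p := l) (q := a)
    (r := m) (s := b) (t := n) h1 h2 h
  by_cases ham : a.1 < m.1
  · by_cases hmb : m.1 < b.1
    · have h1 : n.1 < a.1 ∧ b.1 < l.1 := by grind
      exact not_spiral dα dβ h1.1 ham hmb h1.2 ua ub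
    · grind
  · by_cases hmb : m.1 < b.1
    · grind
    · have h1 : l.1 < b.1 ∧ a.1 < n.1 := by grind
      have hC : ∀ x y z, up x y z = up x z y := up_comm
      refine not_spiral (a := b) (m := m) (b := a) (n := l) (c := c) (l := n) ?_ ?_ h1.1
        (by grind) (by grind) h1.2 ?_ ?_
      · have d1 := dα (a, m) (by simp) (n, c) (by simp)
        have d2 := dα (a, m) (by simp) (c, l) (by simp)
        have d3 := dα (m, b) (by simp) (n, c) (by simp)
        have d4 := dα (m, b) (by simp) (c, l) (by simp)
        intro e he f hf
        simp only [List.mem_cons, List.not_mem_nil, or_false] at he hf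
        rcases he with rfl | rfl <;> rcases hf with rfl | rfl <;>
          (simp only [segment_symm ℝ b m, segment_symm ℝ m a, segment_symm ℝ l c,
            segment_symm ℝ c n]
           first | exact d1 | exact d2 | exact d3 | exact d4)
      · rw [segment_symm ℝ a, segment_symm ℝ n]
        exact dβ.symm
      · rw [← ub]
        simp only [upSum_cons, upSum_nil, hC b m a, hC b a l, hC b l c, hC b c n]
        ring
      · rw [← ua]
        simp only [upSum_cons, upSum_nil, hC a l c, hC a c n, hC a n b, hC a b m]
        ring

end Chain

/-! ### Directions of inner segments at the vertices of a hexagon -/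

namespace Chain

/-- The four sides of a hexagon that do not contain the vertex `g j`. -/
def farSides (g : Fin 6 → ℝ × ℝ) (j : Fin 6) : Chain :=
  [(g (j + 1), g (j + 2)), (g (j + 2), g (j + 3)), (g (j + 3), g (j + 4)), (g (j + 4), g (j + 5))]

lemma upSum_hex_eq (g : Fin 6 → ℝ × ℝ) (j : Fin 6) (q : ℝ × ℝ) :
    upSum q (hex g) = up q (g j) (g (j + 1)) + upSum q (farSides g j) + up q (g (j + 5)) (g j) := by
  fin_cases j <;> simp [hex, farSides] <;> ring

/-- How the sides that leave a vertex and the sides that pass over it are related, when a vertical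
segment at the vertex runs inside the hexagon. -/
lemma upSum_farSides {g : Fin 6 → ℝ × ℝ} {j : Fin 6} {p : ℝ × ℝ} (hp : p.1 = (g j).1)
    (h1 : (g (j + 1)).1 ≠ (g j).1) (h5 : (g (j + 5)).1 ≠ (g j).1)
    (hd : Disj (farSides g j) [(g j, p)]) (hin : upSum p (hex g) = 1) :
    ((g j).2 < p.2 → upSum (g j) (farSides g j) = 1) ∧
    (p.2 < (g j).2 → upSum (g j) (farSides g j) =
      if (g (j + 1)).1 < (g j).1 ↔ (g (j + 5)).1 < (g j).1 then 1 else 0) := by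
  have hj : Joins (farSides g j) (g (j + 1)) (g (j + 5)) :=
    ((joins_single _ _).append (joins_single _ _)).append (joins_single _ _) |>.append
      (joins_single _ _)
  have hconst := hj.upSum_add_upSum (joins_single (g j) p) hd
  have h0 : ∀ q, downSum q [(g j, p)] = 0 := fun q => by simp [down, hp]
  rw [h0, h0, add_zero, CharTwo.add_eq_zero] at hconst
  rw [upSum_hex_eq g j] at hin
  have e1 := lineY_left (g j) (g (j + 1))
  have e5 := lineY_left (g j) (g (j + 5))
  rw [hconst]
  constructor
  · intro hlt
    have u1 : up p (g j) (g (j + 1)) = 0 := by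
      rw [up, if_neg]; rintro ⟨-, h⟩; rw [hp, e1] at h; linarith
    have u5 : up p (g (j + 5)) (g j) = 0 := by
      rw [up_comm, up, if_neg]; rintro ⟨-, h⟩; rw [hp, e5] at h; linarith
    rwa [u1, u5, zero_add, add_zero] at hin
  · intro hlt
    have hu : ∀ q : ℝ × ℝ, q.1 ≠ (g j).1 → lineY (g j) q (g j).1 = (g j).2 →
        up p (g j) q = if q.1 < (g j).1 then 0 else 1 := by
      intro q hq he
      rw [up, hp, he]
      rcases lt_or_gt_of_ne hq with h | h
      · simp [h, h.le]
      · simp [hlt, not_le.2 h, not_lt.2 h.le]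
    rw [up_comm p (g (j + 5)), hu _ h1 e1, hu _ h5 e5] at hin
    have z : (1 : ZMod 2) + 1 = 0 := by decide
    have h01 : ∀ x : ZMod 2, x = 0 ∨ x = 1 := by decide
    rcases h01 (upSum p (farSides g j)) with h | h <;> rw [h] at hin ⊢ <;> grind

/-- `p` is reached from `h j` by a side of the hexagon or by a segment running inside it. -/
def RunsWeaklyInside (h : Fin 6 → ℝ × ℝ) (j : Fin 6) (p : ℝ × ℝ) : Prop :=
  RunsInside h j p ∨ p = h (j + 1) ∨ p = h (j - 1)

/-- All sides and all inner segments at the even vertices of a simple hexagon run strictly inside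
another simple hexagon with the same even vertices and no side parallel to `u`. -/
lemma SimpleHex.exists_opening {h : Fin 6 → ℝ × ℝ} (hs : SimpleHex h) {u : ℝ × ℝ} (hu : u ≠ 0)
    {s : Set (Fin 6 × (ℝ × ℝ))} (hfin : s.Finite) :
    ∃ g, SimpleHex g ∧ g 0 = h 0 ∧ g 2 = h 2 ∧ g 4 = h 4 ∧
      (∀ i, det u (g i) ≠ det u (g (i + 1))) ∧
      ∀ x ∈ s, (x.1 = 0 ∨ x.1 = 2 ∨ x.1 = 4) → RunsWeaklyInside h x.1 x.2 →
        RunsInside g x.1 x.2 := by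
  set t : Set (Fin 6 × (ℝ × ℝ)) := s ∪ {(0, h 1), (2, h 1), (2, h 3), (4, h 3)} with ht
  have htfin : t.Finite := hfin.union (by simp)
  obtain ⟨m₁, hs1, hr1, ha1, hb1, hc1, hd1⟩ := hs.exists_push 1 hu htfin
  set h₁ := Function.update h 1 m₁ with hh1
  obtain ⟨m₂, hs2, hr2, ha2, hb2, hc2, hd2⟩ := hs1.exists_push 3 hu htfin
  set h₂ := Function.update h₁ 3 m₂ with hh2
  obtain ⟨m₃, hs3, hr3, ha3, hb3, hc3, hd3⟩ := hs2.exists_push 5 hu htfin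
  set h₃ := Function.update h₂ 5 m₃ with hh3
  have v0 : h₃ 0 = h 0 := by simp [hh3, hh2, hh1]
  have v2 : h₃ 2 = h 2 := by simp [hh3, hh2, hh1]
  have v4 : h₃ 4 = h 4 := by simp [hh3, hh2, hh1]
  have v1 : h₃ 1 = m₁ := by simp [hh3, hh2, hh1]
  have v3 : h₃ 3 = m₂ := by simp [hh3, hh2]
  have v5 : h₃ 5 = m₃ := by simp [hh3]
  have w3 : h₁ 3 = h 3 := by simp [hh1]
  have w5 : h₂ 5 = h 5 := by simp [hh2, hh1]
  have i1 : (1 : Fin 6) - 1 = 0 := by decide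
  have i2 : (1 : Fin 6) + 1 = 2 := by decide
  have i3 : (3 : Fin 6) - 1 = 2 := by decide
  have i4 : (3 : Fin 6) + 1 = 4 := by decide
  have i5 : (5 : Fin 6) - 1 = 4 := by decide
  have i6 : (5 : Fin 6) + 1 = 0 := by decide
  have i7 : (0 : Fin 6) + 1 = 1 := by decide
  have i8 : (0 : Fin 6) - 1 = 5 := by decide
  have i9 : (2 : Fin 6) - 1 = 1 := by decide
  have i10 : (2 : Fin 6) + 1 = 3 := by decide
  have i11 : (4 : Fin 6) - 1 = 3 := by decide
  have i12 : (4 : Fin 6) + 1 = 5 := by decide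
  rw [i1] at ha1 hc1
  rw [i2] at hb1 hd1
  rw [i3, w3] at ha2
  rw [i4, w3] at hb2
  rw [i3] at hc2
  rw [i4] at hd2
  rw [i5, w5] at ha3
  rw [i6, w5] at hb3
  rw [i5] at hc3
  rw [i6] at hd3
  have e2 : h₁ 2 = h 2 := by simp [hh1]
  have e4 : h₁ 4 = h 4 := by simp [hh1]
  have f4 : h₂ 4 = h 4 := by simp [hh2, hh1]
  have f0 : h₂ 0 = h 0 := by simp [hh2, hh1]
  rw [e2] at hc2
  rw [e4] at hd2
  rw [f4] at hc3
  rw [f0] at hd3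
  have q1 := hr3 (0, h 1) (by simp [ht]) (hr2 (0, h 1) (by simp [ht]) ha1)
  have q2 := hr3 (2, h 1) (by simp [ht]) (hr2 (2, h 1) (by simp [ht]) hb1)
  have q3 := hr3 (2, h 3) (by simp [ht]) ha2
  have q4 := hr3 (4, h 3) (by simp [ht]) hb2
  have hdet : ∀ a b, det (a - b) u ≠ 0 → det u a ≠ det u b ∧ det u b ≠ det u a := by
    intro a b hab
    have : det (a - b) u = det u b - det u a := by simp [det]; ring
    rw [this, sub_ne_zero] at hab
    exact ⟨hab.symm, hab⟩
  refine ⟨h₃, hs3, v0, v2, v4, ?_, ?_⟩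
  · intro i
    fin_cases i
    · simpa [v0, v1] using (hdet _ _ hc1).2
    · simpa [v2, v1] using (hdet _ _ hd1).1
    · simpa [v2, v3] using (hdet _ _ hc2).2
    · simpa [v4, v3] using (hdet _ _ hd2).1
    · simpa [v4, v5] using (hdet _ _ hc3).2
    · simpa [v0, v5] using (hdet _ _ hd3).1
  · rintro ⟨j, p⟩ hx hj hw
    simp only at hj hw ⊢
    have hxt : (j, p) ∈ t := Or.inl hx
    rcases hw with hw | rfl | rfl
    · exact hr3 _ hxt (hr2 _ hxt (hr1 _ hxt hw))
    · rcases hj with rfl | rfl | rfl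
      · rw [i7]; exact q1
      · rw [i10]; exact q3
      · rw [i12]; exact ha3
    · rcases hj with rfl | rfl | rfl
      · rw [i8]; exact hb3
      · rw [i9]; exact q2
      · rw [i11]; exact q4

/-- The direction of `c u`, for `c` of the sign of `σ`, occurs among the sides and inner segments
at the vertex `h j`. -/
def HasDirection (h : Fin 6 → ℝ × ℝ) (u : ℝ × ℝ) (j : Fin 6) (σ : ℝ) : Prop :=
  ∃ p, RunsWeaklyInside h j p ∧ ∃ c : ℝ, 0 < c ∧ p - h j = (σ * c) • u

/-- The relation of `upSum_farSides` for a segment of direction `c u` instead of a vertical one,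
after a similarity that makes `u` vertical. -/
lemma upSum_farSides_turn {g : Fin 6 → ℝ × ℝ} {u : ℝ × ℝ} (hu : u ≠ 0)
    (hx : ∀ i, det u (g i) ≠ det u (g (i + 1))) {j : Fin 6} {p : ℝ × ℝ} (hr : RunsInside g j p)
    {c : ℝ} (hp : p - g j = c • u) :
    let f := fun i => turn u hu (g i)
    (0 < c → upSum (f j) (farSides f j) = 1) ∧
    (c < 0 → upSum (f j) (farSides f j) =
      if (f (j + 1)).1 < (f j).1 ↔ (f (j + 5)).1 < (f j).1 then 1 else 0) := by
  intro f
  have hp' : p = g j + c • u := by rw [← hp]; abel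
  have hN := sq_add_sq_pos hu
  have hp1 : (turn u hu p).1 = (f j).1 := by
    simp only [f, turn_fst, hp', det_add_right, det_smul_right, det_self]; ring
  have hp2 : (turn u hu p).2 = (f j).2 + c * (u.1 ^ 2 + u.2 ^ 2) := by
    simp only [f, turn_snd, hp', Prod.fst_add, Prod.snd_add, Prod.smul_fst, Prod.smul_snd,
      smul_eq_mul]
    ring
  have j5 : ∀ j : Fin 6, j + 5 + 1 = j := by decide
  have key := upSum_farSides (g := f) (j := j) hp1 (fun h => hx j h.symm)
    (fun h => hx (j + 5) (by rw [j5]; exact h)) ?_ ?_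
  · refine ⟨fun hc => key.1 ?_, fun hc => key.2 ?_⟩
    · rw [hp2]; nlinarith
    · rw [hp2]; nlinarith
  · have hd : ∀ i, i ≠ j → i + 1 ≠ j → Disjoint (segment ℝ (f i) (f (i + 1)))
        (segment ℝ (f j) (turn u hu p)) := fun i h1 h2 =>
      disjoint_segment_map _ (hr.2.1 i h1 h2).symm
    have k : ∀ j : Fin 6, (j + 1 ≠ j ∧ j + 1 + 1 ≠ j) ∧ (j + 2 ≠ j ∧ j + 2 + 1 ≠ j) ∧
      (j + 3 ≠ j ∧ j + 3 + 1 ≠ j) ∧ (j + 4 ≠ j ∧ j + 4 + 1 ≠ j) := by decide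
    obtain ⟨k1, k2, k3, k4⟩ := k j
    have s : ∀ j : Fin 6, j + 1 + 1 = j + 2 ∧ j + 2 + 1 = j + 3 ∧ j + 3 + 1 = j + 4 ∧
      j + 4 + 1 = j + 5 := by decide
    obtain ⟨s1, s2, s3, s4⟩ := s j
    intro e he e' he'
    rw [List.mem_singleton] at he'
    subst he'
    simp only [farSides, List.mem_cons, List.not_mem_nil, or_false] at he
    rcases he with rfl | rfl | rfl | rfl
    · have := hd _ k1.1 k1.2; rwa [s1] at this
    · have := hd _ k2.1 k2.2; rwa [s2] at this
    · have := hd _ k3.1 k3.2; rwa [s3] at this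
    · have := hd _ k4.1 k4.2; rwa [s4] at this
  · have := (hex_isCycle g).upSum_mapL hr.avoids (turn u hu)
    rw [hr.2.2] at this
    exact this

/-- If the directions `u` and `-u` both occur at the vertices `0` and `2`, then neither of them
occurs at the vertex `4`. -/
lemma SimpleHex.not_five {h : Fin 6 → ℝ × ℝ} (hs : SimpleHex h) {u : ℝ × ℝ} (hu : u ≠ 0)
    (h0 : HasDirection h u 0 1) (h0' : HasDirection h u 0 (-1)) (h2 : HasDirection h u 2 1)
    (h2' : HasDirection h u 2 (-1)) (h4 : HasDirection h u 4 1 ∨ HasDirection h u 4 (-1)) :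
    False := by
  obtain ⟨p₁, r1, c₁, hc1, e1⟩ := h0
  obtain ⟨p₂, r2, c₂, hc2, e2⟩ := h0'
  obtain ⟨p₃, r3, c₃, hc3, e3⟩ := h2
  obtain ⟨p₄, r4, c₄, hc4, e4⟩ := h2'
  obtain ⟨p₅, c₅, r5, hc5, e5⟩ : ∃ (p : ℝ × ℝ) (c : ℝ), RunsWeaklyInside h 4 p ∧ c ≠ 0 ∧
      p - h 4 = c • u := by
    rcases h4 with ⟨p, r, c, hc, e⟩ | ⟨p, r, c, hc, e⟩
    · exact ⟨p, 1 * c, r, by simpa using hc.ne', e⟩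
    · exact ⟨p, -1 * c, r, by simpa using hc.ne', e⟩
  obtain ⟨g, hgs, v0, v2, v4, hx, hrun⟩ := hs.exists_opening hu
    (s := {(0, p₁), (0, p₂), (2, p₃), (2, p₄), (4, p₅)}) (by simp)
  have k1 := upSum_farSides_turn hu hx (hrun (0, p₁) (by simp) (by simp) r1) (c := 1 * c₁)
    (by rw [v0, e1])
  have k2 := upSum_farSides_turn hu hx (hrun (0, p₂) (by simp) (by simp) r2) (c := -1 * c₂)
    (by rw [v0, e2])
  have k3 := upSum_farSides_turn hu hx (hrun (2, p₃) (by simp) (by simp) r3) (c := 1 * c₃)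
    (by rw [v2, e3])
  have k4 := upSum_farSides_turn hu hx (hrun (2, p₄) (by simp) (by simp) r4) (c := -1 * c₄)
    (by rw [v2, e4])
  have k5 := upSum_farSides_turn hu hx (hrun (4, p₅) (by simp) (by simp) r5) (c := c₅)
    (by rw [v4, e5])
  set f := fun i => turn u hu (g i) with hf
  have u0 := k1.1 (by linarith)
  have u0' := k2.2 (by linarith)
  have u2 := k3.1 (by linarith)
  have u2' := k4.2 (by linarith)
  simp only [farSides, Fin.isValue, zero_add, Fin.reduceAdd] at u0 u0' u2 u2' k5
  rw [u0] at u0'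
  rw [u2] at u2'
  have hdis : ∀ i j, j ≠ i → j ≠ i + 1 → i ≠ j + 1 →
      Disjoint (segment ℝ (f i) (f (i + 1))) (segment ℝ (f j) (f (j + 1))) := fun i j a b c =>
    disjoint_segment_map _ (hgs.2 i j a b c)
  refine hexagon_contradiction (a := f 0) (m := f 1) (b := f 2) (n := f 3) (c := f 4) (l := f 5)
    ?_ (hdis 2 5 (by decide) (by decide) (by decide)) (hx 0) (hx 1) (hx 2) (hx 3) (hx 4) (hx 5)
    ?_ ?_ u0 u2 ?_
  · intro e he e' he'
    simp only [List.mem_cons, List.not_mem_nil, or_false] at he he'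
    rcases he with rfl | rfl <;> rcases he' with rfl | rfl
    · exact hdis 0 3 (by decide) (by decide) (by decide)
    · exact hdis 0 4 (by decide) (by decide) (by decide)
    · exact hdis 1 3 (by decide) (by decide) (by decide)
    · exact hdis 1 4 (by decide) (by decide) (by decide)
  · by_contra hn; rw [if_neg hn] at u0'; exact one_ne_zero u0'
  · by_contra hn; rw [if_neg hn] at u2'; exact one_ne_zero u2'
  · rcases lt_or_gt_of_ne hc5 with hc | hc
    · have := k5.2 hc
      by_cases hn : (f 5).1 < (f 4).1 ↔ (f 3).1 < (f 4).1
      · right; rw [this, if_pos hn]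
      · left; exact hn
    · exact Or.inr (k5.1 hc)

lemma hex_rotate (h : Fin 6 → ℝ × ℝ) (q : ℝ × ℝ) :
    upSum q (hex fun i => h (i + 2)) = upSum q (hex h) := by
  simp [hex]; ring

lemma SimpleHex.rotate {h : Fin 6 → ℝ × ℝ} (hs : SimpleHex h) :
    SimpleHex fun i => h (i + 2) := by
  have k1 : ∀ i : Fin 6, i + 1 + 2 = i + 2 + 1 := by decide
  have k2 : ∀ i : Fin 6, i - 1 + 2 = i + 2 - 1 := by decide
  refine ⟨fun i => ?_, fun i j h1 h2 h3 => ?_⟩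
  · simp only [k1, k2]; exact hs.1 (i + 2)
  · simp only [k1]
    refine hs.2 (i + 2) (j + 2) (fun h => h1 (add_right_cancel h)) ?_ ?_
    · rw [← k1]; exact fun h => h2 (add_right_cancel h)
    · rw [← k1]; exact fun h => h3 (add_right_cancel h)

lemma HasDirection.rotate {h : Fin 6 → ℝ × ℝ} {u : ℝ × ℝ} {j : Fin 6} {σ : ℝ}
    (hd : HasDirection h u (j + 2) σ) : HasDirection (fun i => h (i + 2)) u j σ := by
  have k1 : ∀ i : Fin 6, i + 1 + 2 = i + 2 + 1 := by decide
  have k2 : ∀ i : Fin 6, i - 1 + 2 = i + 2 - 1 := by decide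
  obtain ⟨p, hr, c, hc, e⟩ := hd
  refine ⟨p, ?_, c, hc, e⟩
  rcases hr with hr | hr | hr
  · left
    refine ⟨⟨?_, ?_⟩, ?_, ?_⟩
    · simp only [k1]; exact hr.1.1
    · simp only [k2]; exact hr.1.2
    · intro i h1 h2
      simp only [k1]
      refine hr.2.1 (i + 2) (fun h => h1 (add_right_cancel h)) ?_
      rw [← k1]; exact fun h => h2 (add_right_cancel h)
    · rw [hex_rotate]; exact hr.2.2
  · right; left; simp only [k1]; exact hr
  · right; right; simp only [k2]; exact hr

/-- The even vertices of a hexagon. -/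
def evenVertex : Fin 3 → Fin 6 := ![0, 2, 4]

/-- The sign of a direction. -/
def signOf : Bool → ℝ := fun b => if b then 1 else -1

/-- At the three even vertices of a simple hexagon, the two directions of a line occur at most four
times among the sides and the inner segments. -/
theorem SimpleHex.card_directions_le {h : Fin 6 → ℝ × ℝ} (hs : SimpleHex h) {u : ℝ × ℝ}
    (hu : u ≠ 0) (F : Finset (Fin 3 × Bool))
    (hF : ∀ x ∈ F, HasDirection h u (evenVertex x.1) (signOf x.2)) : F.card ≤ 4 := by
  by_contra hcard
  -- Five of the six possibilities include both signs at two of the vertices.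
  have comb : ∀ F : Finset (Fin 3 × Bool), ¬ F.card ≤ 4 → ∃ i : Fin 3,
      (i, true) ∈ F ∧ (i, false) ∈ F ∧ (i + 1, true) ∈ F ∧ (i + 1, false) ∈ F ∧
      ((i + 2, true) ∈ F ∨ (i + 2, false) ∈ F) := by decide
  obtain ⟨i, a1, a2, a3, a4, a5⟩ := comb F hcard
  have b1 := hF _ a1
  have b2 := hF _ a2
  have b3 := hF _ a3
  have b4 := hF _ a4
  have b5 := a5.imp (hF _) (hF _)
  simp only [signOf, if_true, Bool.false_eq_true, if_false] at b1 b2 b3 b4 b5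
  fin_cases i
  · exact hs.not_five hu b1 b2 b3 b4 b5
  · exact hs.rotate.not_five hu b1.rotate b2.rotate b3.rotate b4.rotate
      (b5.imp HasDirection.rotate HasDirection.rotate)
  · exact hs.rotate.rotate.not_five hu b1.rotate.rotate b2.rotate.rotate b3.rotate.rotate
      b4.rotate.rotate (b5.imp (fun h => h.rotate.rotate) (fun h => h.rotate.rotate))

end Chain

/-! ### Drawings with one bend per edge -/

/-- A drawing in which every edge `uv` consists of two segments that meet at the point
`bend s(u, v)`. The last field says that different edges meet in common end vertices only. -/
structure BendDrawing {V : Type*} (G : SimpleGraph V) where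
  pos : V → ℝ × ℝ
  bend : Sym2 V → ℝ × ℝ
  pos_injective : Function.Injective pos
  pos_ne_bend : ∀ u v, G.Adj u v → pos u ≠ bend s(u, v)
  not_sameRay : ∀ u v, G.Adj u v → ¬ SameRay ℝ (pos u - bend s(u, v)) (pos v - bend s(u, v))
  exists_of_mem : ∀ u v u' v' x, G.Adj u v → G.Adj u' v' → s(u, v) ≠ s(u', v') →
    x ∈ segment ℝ (pos u) (bend s(u, v)) → x ∈ segment ℝ (pos u') (bend s(u', v')) →
    ∃ w, w ∈ s(u, v) ∧ w ∈ s(u', v') ∧ x = pos w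

lemma slopeOf_comm (p q : ℝ × ℝ) : slopeOf p q = slopeOf q p := by
  rw [slopeOf, slopeOf, ← neg_sub p q, ← Set.neg_singleton, Submodule.span_neg]

lemma slopeOf_eq_of_smul {p q r : ℝ × ℝ} {c : ℝ} (hc : c ≠ 0) (h : r - p = c • (q - p)) :
    slopeOf p r = slopeOf p q := by
  rw [slopeOf, slopeOf, h]
  exact Submodule.span_singleton_smul_eq (IsUnit.mk0 c hc) _

/-- A polygonal path with at most one bend between different points contains a path with exactly
one, possibly straight, bend and no further slopes. -/
lemma exists_bend_of_isPolygonalPath {S : Finset (Submodule ℝ (ℝ × ℝ))} {p q : ℝ × ℝ}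
    {A : Set (ℝ × ℝ)} (hpq : p ≠ q) (h : IsPolygonalPath 1 S p q A) :
    ∃ m, p ≠ m ∧ q ≠ m ∧ ¬ SameRay ℝ (p - m) (q - m) ∧ slopeOf p m ∈ S ∧ slopeOf q m ∈ S ∧
      segment ℝ p m ⊆ A ∧ segment ℝ q m ⊆ A := by
  have straight : slopeOf p q ∈ S → segment ℝ p q ⊆ A →
      ∃ m, p ≠ m ∧ q ≠ m ∧ ¬ SameRay ℝ (p - m) (q - m) ∧ slopeOf p m ∈ S ∧ slopeOf q m ∈ S ∧
        segment ℝ p m ⊆ A ∧ segment ℝ q m ⊆ A := by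
    intro hS hA
    have hmem : midpoint ℝ p q ∈ segment ℝ p q := midpoint_mem_segment p q
    have e1 : p - midpoint ℝ p q = (-(1 / 2 : ℝ)) • (q - p) := by
      rw [midpoint_eq_smul_add, invOf_eq_inv]; module
    have e2 : q - midpoint ℝ p q = -(p - midpoint ℝ p q) := by
      rw [midpoint_eq_smul_add, invOf_eq_inv]; module
    have hne : q - p ≠ 0 := sub_ne_zero.2 hpq.symm
    have hpm : p - midpoint ℝ p q ≠ 0 := by
      rw [e1]; exact smul_ne_zero (by norm_num) hne
    have s1 : slopeOf p (midpoint ℝ p q) = slopeOf p q :=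
      slopeOf_eq_of_smul (c := 1 / 2) (by norm_num) (by rw [← neg_sub, e1]; module)
    have s2 : slopeOf q (midpoint ℝ p q) = slopeOf q p :=
      slopeOf_eq_of_smul (c := 1 / 2) (by norm_num) (by rw [← neg_sub, e2, e1]; module)
    refine ⟨midpoint ℝ p q, sub_ne_zero.1 hpm, ?_, ?_, ?_, ?_, ?_, ?_⟩
    · rw [← sub_ne_zero, e2]; exact neg_ne_zero.2 hpm
    · rw [e2]; exact fun h => hpm (eq_zero_of_sameRay_self_neg h)
    · rwa [s1]
    · rwa [s2, slopeOf_comm]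
    · exact ((convex_segment p q).segment_subset (left_mem_segment ℝ _ _) hmem).trans hA
    · exact ((convex_segment p q).segment_subset (right_mem_segment ℝ _ _) hmem).trans hA
  obtain ⟨n, hn, x, hx0, hx1, hx, hA⟩ := h
  have hsub : ∀ i ≤ n, segment ℝ (x i) (x (i + 1)) ⊆ A := by
    intro i hi y hy
    rw [hA]
    exact Set.mem_biUnion (show i ∈ {i | i ≤ n} from hi) hy
  interval_cases n
  · have := hx 0 le_rfl
    have h2 := hsub 0 le_rfl
    rw [hx0, hx1] at this h2
    exact straight this.2 h2
  · have h0 := hx 0 (by norm_num)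
    have h1 := hx 1 le_rfl
    have g0 := hsub 0 (by norm_num)
    have g1 := hsub 1 le_rfl
    rw [hx0] at h0 g0
    rw [hx1] at h1 g1
    simp only [zero_add] at h0 g0
    by_cases hs : SameRay ℝ (p - x 1) (q - x 1)
    · obtain ⟨r, hr, he⟩ := hs.exists_pos_left (sub_ne_zero.2 h0.1) (sub_ne_zero.2 h1.1.symm)
      have hr1 : r ≠ 1 := by
        rintro rfl
        rw [one_smul, sub_left_inj] at he
        exact hpq he
      apply straight
      · rw [slopeOf_eq_of_smul (q := x 1) (c := 1 - r) (sub_ne_zero.2 hr1.symm)]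
        · exact h0.2
        · have : q - p = (q - x 1) - (p - x 1) := by abel
          rw [this, ← he]; module
      · rcases le_or_gt r 1 with h | h
        · refine ((convex_segment p (x 1)).segment_subset (left_mem_segment ℝ _ _) ?_).trans g0
          refine ⟨r, 1 - r, hr.le, by linarith, by ring, ?_⟩
          rw [← sub_eq_zero, ← sub_add_cancel q (x 1), ← he]; module
        · refine ((convex_segment (x 1) q).segment_subset ?_ (right_mem_segment ℝ _ _)).trans g1
          refine ⟨1 - r⁻¹, r⁻¹, by simpa using inv_le_one_of_one_le₀ h.le, (inv_pos.2 hr).le,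
            by ring, ?_⟩
          have e : r⁻¹ • (q - x 1) = p - x 1 := by rw [← he, inv_smul_smul₀ hr.ne']
          have e' : (1 - r⁻¹) • x 1 + r⁻¹ • q = x 1 + r⁻¹ • (q - x 1) := by module
          rw [e', e]; abel
    · exact ⟨x 1, h0.1, h1.1.symm, hs, h0.2, by rw [slopeOf_comm]; exact h1.2, g0,
        by rwa [segment_symm]⟩

/-- Different edges of a plane drawing meet in common end vertices only. -/
lemma PlaneDrawing.exists_of_mem_arc {V : Type*} {G : SimpleGraph V} (D : PlaneDrawing G)
    {u v u' v' : V} (h : G.Adj u v) (h' : G.Adj u' v') (hne : s(u, v) ≠ s(u', v')) {x : ℝ × ℝ}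
    (hx : x ∈ D.arc s(u, v)) (hx' : x ∈ D.arc s(u', v')) :
    ∃ w, w ∈ s(u, v) ∧ w ∈ s(u', v') ∧ x = D.pos w := by
  by_cases h1 : ∃ w, w ∈ s(u, v) ∧ x = D.pos w
  · obtain ⟨w, hw, rfl⟩ := h1
    exact ⟨w, hw, by rw [Sym2.mem_iff]; exact D.avoids _ _ _ h' hx', rfl⟩
  by_cases h2 : ∃ w, w ∈ s(u', v') ∧ x = D.pos w
  · obtain ⟨w, hw, rfl⟩ := h2
    exact ⟨w, by rw [Sym2.mem_iff]; exact D.avoids _ _ _ h hx, hw, rfl⟩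
  exfalso
  refine Set.disjoint_left.1 (D.noncrossing _ _ _ _ h h' hne) ⟨hx, ?_⟩ ⟨hx', ?_⟩
  · rintro (rfl | rfl)
    · exact h1 ⟨u, by simp, rfl⟩
    · exact h1 ⟨v, by simp, rfl⟩
  · rintro (rfl | rfl)
    · exact h2 ⟨u', by simp, rfl⟩
    · exact h2 ⟨v', by simp, rfl⟩

/-- A drawing with at most one bend per edge can be replaced by one with exactly one, possibly
straight, bend per edge, without moving the vertices and without new slopes. -/
theorem PlaneDrawing.HasBendsSlopes.exists_bendDrawing {V : Type*} {G : SimpleGraph V}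
    {D : PlaneDrawing G} {S : Finset (Submodule ℝ (ℝ × ℝ))} (hD : D.HasBendsSlopes 1 S) :
    ∃ B : BendDrawing G, B.pos = D.pos ∧ ∀ u v, G.Adj u v →
      slopeOf (B.pos u) (B.bend s(u, v)) ∈ S ∧
      segment ℝ (B.pos u) (B.bend s(u, v)) ⊆ D.arc s(u, v) := by
  have key : ∀ e : Sym2 V, ∃ m, ∀ u v, e = s(u, v) → G.Adj u v →
      D.pos u ≠ m ∧ ¬ SameRay ℝ (D.pos u - m) (D.pos v - m) ∧ slopeOf (D.pos u) m ∈ S ∧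
      segment ℝ (D.pos u) m ⊆ D.arc e := by
    intro e
    induction e with
    | _ a b =>
      by_cases hab : G.Adj a b
      · obtain ⟨m, h1, h2, h3, h4, h5, h6, h7⟩ :=
          exists_bend_of_isPolygonalPath (D.pos_injective.ne hab.ne) (hD a b hab)
        refine ⟨m, fun u v he _ => ?_⟩
        rcases Sym2.eq_iff.1 he with ⟨rfl, rfl⟩ | ⟨rfl, rfl⟩
        · exact ⟨h1, h3, h4, h6⟩
        · exact ⟨h2, fun h => h3 h.symm, h5, h7⟩
      · refine ⟨0, fun u v he h => absurd ?_ hab⟩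
        rcases Sym2.eq_iff.1 he with ⟨rfl, rfl⟩ | ⟨rfl, rfl⟩
        · exact h
        · exact h.symm
  choose b hb using key
  refine ⟨⟨D.pos, b, D.pos_injective, fun u v h => (hb _ u v rfl h).1,
    fun u v h => (hb _ u v rfl h).2.1, ?_⟩, rfl, fun u v h => (hb _ u v rfl h).2.2⟩
  intro u v u' v' x h h' hne hx hx'
  exact D.exists_of_mem_arc h h' hne ((hb _ u v rfl h).2.2.2 hx) ((hb _ u' v' rfl h').2.2.2 hx')

namespace BendDrawing

variable {V : Type*} {G : SimpleGraph V} (B : BendDrawing G)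

/-- The half of the edge `uv` at the vertex `u`. -/
def half (u v : V) : Set (ℝ × ℝ) := segment ℝ (B.pos u) (B.bend s(u, v))

lemma pos_notMem_half {u v : V} (h : G.Adj u v) : B.pos v ∉ B.half u v := by
  intro hm
  have h1 := B.not_sameRay u v h
  rw [half, segment_symm] at hm
  exact h1 (Chain.sameRay_of_mem_segment hm).symm

/-- Halves of different edges meet only if they start at the same vertex, and there only. -/
lemma eq_of_mem_half {u v u' v' : V} {x : ℝ × ℝ} (h : G.Adj u v) (h' : G.Adj u' v')
    (hne : s(u, v) ≠ s(u', v')) (hx : x ∈ B.half u v) (hx' : x ∈ B.half u' v') :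
    u = u' ∧ x = B.pos u := by
  obtain ⟨w, hw, hw', rfl⟩ := B.exists_of_mem u v u' v' x h h' hne hx hx'
  have h1 : w = u := by
    rcases Sym2.mem_iff.1 hw with rfl | rfl
    · rfl
    · exact absurd hx (B.pos_notMem_half h)
  have h2 : w = u' := by
    rcases Sym2.mem_iff.1 hw' with rfl | rfl
    · rfl
    · exact absurd hx' (B.pos_notMem_half h')
  exact ⟨h1 ▸ h2, by rw [h1]⟩

lemma disjoint_half {u v u' v' : V} (h : G.Adj u v) (h' : G.Adj u' v')
    (hne : s(u, v) ≠ s(u', v')) (hu : u ≠ u') : Disjoint (B.half u v) (B.half u' v') :=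
  Set.disjoint_left.2 fun _ hx hx' => hu (B.eq_of_mem_half h h' hne hx hx').1

/-- Different edges leave a vertex in different directions. -/
lemma not_sameRay_of_ne {u v w : V} (hv : G.Adj u v) (hw : G.Adj u w) (hne : v ≠ w) :
    ¬ SameRay ℝ (B.bend s(u, v) - B.pos u) (B.bend s(u, w) - B.pos u) := by
  intro hs
  have hne' : s(u, v) ≠ s(u, w) := fun h => hne (Sym2.congr_right.1 h)
  obtain ⟨r, hr, he⟩ := hs.exists_pos_left (sub_ne_zero.2 (B.pos_ne_bend u v hv).symm)
    (sub_ne_zero.2 (B.pos_ne_bend u w hw).symm)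
  rcases le_or_gt r 1 with h | h
  · refine B.pos_ne_bend u w hw (B.eq_of_mem_half hv hw hne' (x := B.bend s(u, w)) ?_
      (right_mem_segment ℝ _ _)).2.symm
    refine ⟨1 - r, r, by linarith, hr.le, by ring, ?_⟩
    have e' : (1 - r) • B.pos u + r • B.bend s(u, v) =
      B.pos u + r • (B.bend s(u, v) - B.pos u) := by module
    rw [e', he]; abel
  · refine B.pos_ne_bend u v hv (B.eq_of_mem_half hv hw hne' (x := B.bend s(u, v))
      (right_mem_segment ℝ _ _) ?_).2.symm
    refine ⟨1 - r⁻¹, r⁻¹, by simpa using inv_le_one_of_one_le₀ h.le, (inv_pos.2 hr).le,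
      by ring, ?_⟩
    have e : r⁻¹ • (B.bend s(u, w) - B.pos u) = B.bend s(u, v) - B.pos u := by
      rw [← he, inv_smul_smul₀ hr.ne']
    have e' : (1 - r⁻¹) • B.pos u + r⁻¹ • B.bend s(u, w) =
      B.pos u + r⁻¹ • (B.bend s(u, w) - B.pos u) := by module
    rw [e', e]; abel

/-- The polygonal chain along which a walk is drawn. -/
def chain {u v : V} : G.Walk u v → Chain
  | .nil => []
  | .cons (u := x) (v := y) _ p =>
    (B.pos x, B.bend s(x, y)) :: (B.bend s(x, y), B.pos y) :: chain p

lemma chain_joins {u v : V} (p : G.Walk u v) : (B.chain p).Joins (B.pos u) (B.pos v) := by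
  induction p with
  | nil => exact Chain.joins_nil _
  | @cons a b c h p ih =>
    exact ((Chain.joins_single (B.pos a) (B.bend s(a, b))).append
      (Chain.joins_single _ (B.pos b))).append ih

lemma exists_half_of_mem_chain {u v : V} (p : G.Walk u v) {e} (he : e ∈ B.chain p) :
    ∃ x y, G.Adj x y ∧ x ∈ p.support ∧ y ∈ p.support ∧ segment ℝ e.1 e.2 = B.half x y := by
  induction p with
  | nil => simp [chain] at he
  | @cons a b c h p ih =>
    rw [chain, List.mem_cons, List.mem_cons] at he
    rcases he with rfl | rfl | he
    · exact ⟨a, b, h, by simp, by simp, rfl⟩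
    · refine ⟨b, a, h.symm, by simp, by simp, ?_⟩
      rw [half, segment_symm, Sym2.eq_swap]
    · obtain ⟨x, y, hxy, hx, hy, hseg⟩ := ih he
      exact ⟨x, y, hxy, by simp [hx], by simp [hy], hseg⟩

lemma chain_disj {u v u' v' : V} (p : G.Walk u v) (p' : G.Walk u' v')
    (h : ∀ x ∈ p.support, x ∉ p'.support) : (B.chain p).Disj (B.chain p') := by
  intro e he e' he'
  obtain ⟨x, y, hxy, hx, hy, hseg⟩ := B.exists_half_of_mem_chain p he
  obtain ⟨x', y', hxy', hx', hy', hseg'⟩ := B.exists_half_of_mem_chain p' he'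
  rw [hseg, hseg']
  refine B.disjoint_half hxy hxy' ?_ (fun hxx => h x hx (hxx ▸ hx'))
  intro hs
  have : x ∈ s(x', y') := hs ▸ Sym2.mem_mk_left x y
  rcases Sym2.mem_iff.1 this with rfl | rfl
  · exact h _ hx hx'
  · exact h _ hx hy'

end BendDrawing

/-! ### The hexagon around a triangle of the graph -/

/-- The vertex `i` of the triangle in the copy `s`. -/
abbrev corner {d : ℕ} (s : Bool) (i : Fin 3) : PrismCycleVertex d := (s, Sum.inl i)

/-- The vertex `x` of the cycle in the copy `s`. -/
abbrev rim {d : ℕ} (s : Bool) (x : Fin (3 * (d - 3))) : PrismCycleVertex d := (s, Sum.inr x)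

section Adjacency

variable {d : ℕ}

lemma adj_corner (s : Bool) {i j : Fin 3} (h : i ≠ j) :
    (prismCycleGraph d).Adj (corner s i) (corner s j) := Or.inl ⟨rfl, h⟩

lemma adj_corner_not (s : Bool) (i : Fin 3) :
    (prismCycleGraph d).Adj (corner s i) (corner (!s) i) := Or.inr ⟨by simp, rfl⟩

lemma adj_corner_rim (s : Bool) {i : Fin 3} {x : Fin (3 * (d - 3))} (h : x.val / (d - 3) = i) :
    (prismCycleGraph d).Adj (corner s i) (rim s x) := ⟨rfl, h⟩

/-- The embedding of the cycle in the copy `s`. -/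
def rimHom (s : Bool) : SimpleGraph.cycleGraph (3 * (d - 3)) →g prismCycleGraph d where
  toFun := rim s
  map_rel' h := ⟨rfl, h⟩

/-- A walk from a cycle vertex to a corner that stays in the cycle up to its last step. -/
lemma exists_walk_rim_corner (s : Bool) (x : Fin (3 * (d - 3))) (i : Fin 3) :
    ∃ p : (prismCycleGraph d).Walk (rim s x) (corner s i),
      ∀ v ∈ p.support, v = corner s i ∨ ∃ y, v = rim s y := by
  have hk : 0 < d - 3 := by have := x.pos; omega
  have hlt : i.val * (d - 3) < 3 * (d - 3) := Nat.mul_lt_mul_of_pos_right i.2 hk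
  set y : Fin (3 * (d - 3)) := ⟨i.val * (d - 3), hlt⟩ with hy
  have hadj : (prismCycleGraph d).Adj (rim s y) (corner s i) :=
    (adj_corner_rim s (Nat.mul_div_cancel _ hk)).symm
  obtain ⟨n, hn⟩ : ∃ n, 3 * (d - 3) = n + 1 := ⟨3 * (d - 3) - 1, by omega⟩
  have hconn : (SimpleGraph.cycleGraph (3 * (d - 3))).Connected := by
    rw [hn]; exact SimpleGraph.cycleGraph_connected
  obtain ⟨p⟩ := hconn.preconnected x y
  let q : (prismCycleGraph d).Walk (rim s x) (rim s y) := p.map (rimHom s)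
  have hq : ∀ v ∈ q.support, ∃ y, v = rim s y := by
    intro v hv
    have hv' : v ∈ (p.map (rimHom s)).support := hv
    rw [SimpleGraph.Walk.support_map, List.mem_map] at hv'
    obtain ⟨y, -, rfl⟩ := hv'
    exact ⟨y, rfl⟩
  refine ⟨q.concat hadj, fun v hv => ?_⟩
  rw [SimpleGraph.Walk.support_concat, List.mem_append, List.mem_singleton] at hv
  rcases hv with hv | rfl
  · exact Or.inr (hq v hv)
  · exact Or.inl rfl

/-- A walk to a corner that runs in the triangle of the other copy up to its last step. -/
lemma exists_walk_corner_corner (s : Bool) (i : Fin 3) :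
    ∃ p : (prismCycleGraph d).Walk (corner (!s) 0) (corner s i),
      ∀ v ∈ p.support, v = corner s i ∨ ∃ j, v = corner (!s) j := by
  have hadj : (prismCycleGraph d).Adj (corner (!s) i) (corner s i) := (adj_corner_not s i).symm
  by_cases hi : 0 = i
  · subst hi
    refine ⟨hadj.toWalk, fun v hv => ?_⟩
    simp only [SimpleGraph.Walk.support_cons, SimpleGraph.Walk.support_nil, List.mem_cons,
      List.not_mem_nil, or_false] at hv
    rcases hv with rfl | rfl
    · exact Or.inr ⟨_, rfl⟩
    · exact Or.inl rfl
  · refine ⟨.cons (adj_corner (!s) hi) hadj.toWalk, fun v hv => ?_⟩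
    simp only [SimpleGraph.Walk.support_cons, SimpleGraph.Walk.support_nil, List.mem_cons,
      List.not_mem_nil, or_false] at hv
    rcases hv with rfl | rfl | rfl
    · exact Or.inr ⟨_, rfl⟩
    · exact Or.inr ⟨_, rfl⟩
    · exact Or.inl rfl

end Adjacency

namespace BendDrawing

variable {d : ℕ} (B : BendDrawing (prismCycleGraph d))

/-- The hexagon along which the triangle in the copy `s` is drawn. Its even vertices are the corners
of the triangle and its odd vertices are the bends. -/
def hexagon (s : Bool) : Fin 6 → ℝ × ℝ :=
  ![B.pos (corner s 0), B.bend s(corner s 0, corner s 1), B.pos (corner s 1),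
    B.bend s(corner s 1, corner s 2), B.pos (corner s 2), B.bend s(corner s 2, corner s 0)]

/-- The side `k` of the hexagon of a triangle is the half at the corner `halfStart k` of the edge to
the corner `halfEnd k`. -/
def halfStart : Fin 6 → Fin 3 := ![0, 1, 1, 2, 2, 0]

/-- The other end vertex of the edge along which the side `k` of the hexagon of a triangle runs. -/
def halfEnd : Fin 6 → Fin 3 := ![1, 0, 2, 1, 0, 2]

lemma segment_hexagon (s : Bool) (k : Fin 6) :
    segment ℝ (B.hexagon s k) (B.hexagon s (k + 1)) =
      B.half (corner s (halfStart k)) (corner s (halfEnd k)) := by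
  have e01 : s((corner s 1 : PrismCycleVertex d), corner s 0) = s(corner s 0, corner s 1) :=
    Sym2.eq_swap
  have e12 : s((corner s 2 : PrismCycleVertex d), corner s 1) = s(corner s 1, corner s 2) :=
    Sym2.eq_swap
  have e20 : s((corner s 0 : PrismCycleVertex d), corner s 2) = s(corner s 2, corner s 0) :=
    Sym2.eq_swap
  fin_cases k
  · rfl
  · change segment ℝ (B.bend _) (B.pos _) = segment ℝ _ _
    rw [segment_symm, ← e01]; rfl
  · rfl
  · change segment ℝ (B.bend _) (B.pos _) = segment ℝ _ _
    rw [segment_symm, ← e12]; rfl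
  · rfl
  · change segment ℝ (B.bend _) (B.pos _) = segment ℝ _ _
    rw [segment_symm, ← e20]; rfl

lemma half_ne (k : Fin 6) : halfStart k ≠ halfEnd k := by revert k; decide

lemma adj_half (s : Bool) (k : Fin 6) :
    (prismCycleGraph d).Adj (corner s (halfStart k)) (corner s (halfEnd k)) :=
  adj_corner s (half_ne k)

/-- The halves of the edges from the hexagon to other vertices do not meet the hexagon, unless they
start at a corner. -/
lemma disjoint_hexagon_half (s : Bool) (k : Fin 6) {u v : PrismCycleVertex d}
    (h : (prismCycleGraph d).Adj u v) (huv : (∀ i, u ≠ corner s i) ∨ (∀ i, v ≠ corner s i))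
    (hu : u ≠ corner s (halfStart k)) :
    Disjoint (segment ℝ (B.hexagon s k) (B.hexagon s (k + 1))) (B.half u v) := by
  rw [segment_hexagon]
  refine B.disjoint_half (adj_half s k) h ?_ hu.symm
  intro he
  rcases huv with huv | huv
  · have : u ∈ s(corner s (halfStart k), corner s (halfEnd k)) := he ▸ Sym2.mem_mk_left u v
    rcases Sym2.mem_iff.1 this with h | h
    · exact huv _ h
    · exact huv _ h
  · have : v ∈ s(corner s (halfStart k), corner s (halfEnd k)) := he ▸ Sym2.mem_mk_right u v
    rcases Sym2.mem_iff.1 this with h | h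
    · exact huv _ h
    · exact huv _ h

/-- A half that starts outside the triangle does not cross the hexagon of the triangle. -/
lemma upSum_hexagon_eq (s : Bool) {u v : PrismCycleVertex d} (h : (prismCycleGraph d).Adj u v)
    (hu : ∀ i, u ≠ corner s i) :
    Chain.upSum (B.pos u) (Chain.hex (B.hexagon s)) =
      Chain.upSum (B.bend s(u, v)) (Chain.hex (B.hexagon s)) := by
  refine (Chain.hex_isCycle _).upSum_eq fun e he => ?_
  obtain ⟨k, rfl⟩ := Chain.mem_hex.1 he
  exact B.disjoint_hexagon_half s k h (Or.inl hu) (hu _)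

/-- The cycle of a copy and the other copy lie on different sides of the hexagon of the copy. -/
lemma upSum_rim_add_upSum_corner (s : Bool) (x : Fin (3 * (d - 3))) :
    Chain.upSum (B.pos (rim s x)) (Chain.hex (B.hexagon s)) +
      Chain.upSum (B.pos (corner (!s) 0)) (Chain.hex (B.hexagon s)) = 1 := by
  have hpos := B.pos_injective
  choose py hpy using exists_walk_rim_corner (d := d) s x
  choose pz hpz using exists_walk_corner_corner (d := d) s
  have hss : s ≠ !s := by cases s <;> decide
  have n1 : ∀ {i j : Fin 3}, (corner s i : PrismCycleVertex d) = corner s j → i = j :=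
    fun h => Sum.inl_injective (congrArg Prod.snd h)
  have n2 : ∀ {i j : Fin 3}, (corner s i : PrismCycleVertex d) ≠ corner (!s) j :=
    fun h => hss (congrArg Prod.fst h)
  have n3 : ∀ {i : Fin 3} {y : Fin (3 * (d - 3))} {t : Bool},
      rim s y ≠ (corner t i : PrismCycleVertex d) := fun h => Sum.inr_ne_inl (congrArg Prod.snd h)
  have yz : ∀ i j, i ≠ j → (B.chain (py i)).Disj (B.chain (pz j)) := by
    intro i j hij
    refine B.chain_disj _ _ fun v hv hv' => ?_
    rcases hpy i v hv with rfl | ⟨y, rfl⟩ <;> rcases hpz j _ hv' with h | ⟨j', h⟩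
    · exact hij (n1 h)
    · exact n2 h
    · exact n3 h
    · exact n3 h
  have ey : ∀ i j k (hij : i ≠ j), i ≠ k → j ≠ k →
      (B.chain (adj_corner (d := d) s hij).toWalk).Disj (B.chain (py k)) := by
    intro i j k hij hik hjk
    refine B.chain_disj _ _ fun v hv hv' => ?_
    simp only [SimpleGraph.Walk.support_cons, SimpleGraph.Walk.support_nil, List.mem_cons,
      List.not_mem_nil, or_false] at hv
    rcases hpy k v hv' with h | ⟨y, h⟩ <;> rcases hv with rfl | rfl
    · exact hik (n1 h)
    · exact hjk (n1 h)
    · exact n3 h.symm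
    · exact n3 h.symm
  have ez : ∀ i j k (hij : i ≠ j), i ≠ k → j ≠ k →
      (B.chain (adj_corner (d := d) s hij).toWalk).Disj (B.chain (pz k)) := by
    intro i j k hij hik hjk
    refine B.chain_disj _ _ fun v hv hv' => ?_
    simp only [SimpleGraph.Walk.support_cons, SimpleGraph.Walk.support_nil, List.mem_cons,
      List.not_mem_nil, or_false] at hv
    rcases hpz k v hv' with h | ⟨y, h⟩ <;> rcases hv with rfl | rfl
    · exact hik (n1 h)
    · exact hjk (n1 h)
    · exact n2 h
    · exact n2 h
  have key := Chain.tripod_parity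
    (B.chain_joins (adj_corner (d := d) s (i := 0) (j := 1) (by decide)).toWalk)
    (B.chain_joins (adj_corner (d := d) s (i := 1) (j := 2) (by decide)).toWalk)
    (B.chain_joins (adj_corner (d := d) s (i := 2) (j := 0) (by decide)).toWalk)
    (B.chain_joins (py 0)) (B.chain_joins (py 1)) (B.chain_joins (py 2))
    (B.chain_joins (pz 0)) (B.chain_joins (pz 1)) (B.chain_joins (pz 2))
    (ey 0 1 2 (by decide) (by decide) (by decide)) (ey 1 2 0 (by decide) (by decide) (by decide))
    (ey 2 0 1 (by decide) (by decide) (by decide))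
    (ez 0 1 2 (by decide) (by decide) (by decide)) (ez 1 2 0 (by decide) (by decide) (by decide))
    (ez 2 0 1 (by decide) (by decide) (by decide))
    (yz _ _ (by decide)) (yz _ _ (by decide)) (yz _ _ (by decide)) (yz _ _ (by decide))
    (yz _ _ (by decide)) (yz _ _ (by decide))
    (hpos.ne fun h => absurd (n1 h) (by decide)) (hpos.ne fun h => absurd (n1 h) (by decide))
    (hpos.ne fun h => absurd (n1 h) (by decide)) ⟨hpos.ne n3, hpos.ne n3, hpos.ne n3⟩
  exact key

end BendDrawing

/-! ### One of the cycles lies inside its triangle -/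

namespace BendDrawing

variable {d : ℕ} (B : BendDrawing (prismCycleGraph d))

lemma corner_not_ne (s : Bool) (i j : Fin 3) :
    (corner (!s) i : PrismCycleVertex d) ≠ corner s j := fun h => by
  have := congrArg Prod.fst h
  cases s <;> simp at this

/-- The hexagon of the other copy lies on one side of the hexagon of a copy. -/
lemma upSum_hexagon_not (s : Bool) (k : Fin 6) :
    Chain.upSum (B.hexagon (!s) k) (Chain.hex (B.hexagon s)) =
      Chain.upSum (B.pos (corner (!s) 0)) (Chain.hex (B.hexagon s)) := by
  have hb : ∀ i j : Fin 3, i ≠ j → Chain.upSum (B.pos (corner (!s) i)) (Chain.hex (B.hexagon s)) =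
      Chain.upSum (B.bend s(corner (!s) i, corner (!s) j)) (Chain.hex (B.hexagon s)) :=
    fun i j hij => B.upSum_hexagon_eq s (adj_corner (!s) hij) (corner_not_ne s i)
  have hc : ∀ i j : Fin 3, i ≠ j → Chain.upSum (B.pos (corner (!s) i)) (Chain.hex (B.hexagon s)) =
      Chain.upSum (B.pos (corner (!s) j)) (Chain.hex (B.hexagon s)) := by
    intro i j hij
    rw [hb i j hij, hb j i hij.symm, Sym2.eq_swap]
  fin_cases k
  · rfl
  · exact (hb 0 1 (by decide)).symm
  · exact hc 1 0 (by decide)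
  · exact (hb 1 2 (by decide)).symm.trans (hc 1 0 (by decide))
  · exact hc 2 0 (by decide)
  · exact (hb 2 0 (by decide)).symm.trans (hc 2 0 (by decide))

lemma hexagon_ne_hexagon_not (s : Bool) (k k' : Fin 6) :
    B.hexagon s k ≠ B.hexagon (!s) k' := by
  intro h
  have h1 : B.hexagon s k ∈ B.half (corner s (halfStart k)) (corner s (halfEnd k)) := by
    rw [← segment_hexagon]; exact left_mem_segment ℝ _ _
  have h2 : B.hexagon s k ∈ B.half (corner (!s) (halfStart k')) (corner (!s) (halfEnd k')) := by
    rw [← segment_hexagon, h]; exact left_mem_segment ℝ _ _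
  refine Set.disjoint_left.1 (B.disjoint_half (adj_half s k) (adj_half (!s) k') (fun he => ?_)
    (corner_not_ne s _ _).symm) h1 h2
  have h3 : (corner (!s) (halfStart k') : PrismCycleVertex d) ∈
      s(corner s (halfStart k), corner s (halfEnd k)) :=
    by rw [he]; exact Sym2.mem_mk_left _ _
  rcases Sym2.mem_iff.1 h3 with h | h
  · exact corner_not_ne s _ _ h
  · exact corner_not_ne s _ _ h

/-- The two hexagons cannot be nested in each other both ways, since then they would have the same
convex hull, every extreme point of which is a vertex of both. -/
theorem exists_forall_upSum_hexagon_eq_one :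
    ∃ s, ∀ x, Chain.upSum (B.pos (rim s x)) (Chain.hex (B.hexagon s)) = 1 := by
  by_contra! hcon
  have hsub : ∀ s, convexHull ℝ (Set.range (B.hexagon (!s))) ⊆
      convexHull ℝ (Set.range (B.hexagon s)) := by
    intro s
    refine convexHull_min ?_ (convex_convexHull ℝ _)
    rintro _ ⟨k, rfl⟩
    by_contra hk
    have h0 := (Chain.hex_isCycle (B.hexagon s)).upSum_eq_zero_of_notMem_convexHull
      (Set.finite_range _) (fun e he => ?_) hk
    · obtain ⟨x, hx⟩ := hcon s
      rw [B.upSum_hexagon_not] at h0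
      have := B.upSum_rim_add_upSum_corner s x
      rw [h0, add_zero] at this
      exact hx this
    · obtain ⟨i, rfl⟩ := Chain.mem_hex.1 he
      exact ⟨⟨i, rfl⟩, ⟨i + 1, rfl⟩⟩
  have heq : convexHull ℝ (Set.range (B.hexagon false)) =
      convexHull ℝ (Set.range (B.hexagon true)) := (hsub true).antisymm (hsub false)
  obtain ⟨p, hp⟩ := ((Set.finite_range (B.hexagon false)).isCompact_convexHull ℝ
    ).extremePoints_nonempty ((Set.range_nonempty _).convexHull)
  obtain ⟨k, hk⟩ := extremePoints_convexHull_subset hp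
  rw [heq] at hp
  obtain ⟨k', hk'⟩ := extremePoints_convexHull_subset hp
  exact B.hexagon_ne_hexagon_not false k k' (hk.trans hk'.symm)

end BendDrawing

/-! ### Counting slopes with one bend per edge -/

lemma exists_smul_of_slopeOf_eq {p q p' q' : ℝ × ℝ} (hne : p ≠ q)
    (h : slopeOf p q = slopeOf p' q') : ∃ c : ℝ, c ≠ 0 ∧ q - p = c • (q' - p') := by
  have hm : q - p ∈ slopeOf p' q' := h ▸ Submodule.mem_span_singleton_self _
  obtain ⟨c, hc⟩ := Submodule.mem_span_singleton.1 hm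
  refine ⟨c, ?_, hc.symm⟩
  rintro rfl
  rw [zero_smul] at hc
  exact hne (sub_eq_zero.1 hc.symm).symm

lemma fin_three_ne_add_one : ∀ i : Fin 3, i ≠ i + 1 := by decide

lemma fin_three_ne_add_two : ∀ i : Fin 3, i ≠ i + 2 := by decide

lemma fin_three_add_one_ne_add_two : ∀ i : Fin 3, i + 1 ≠ i + 2 := by decide

section Neighbours

variable {d : ℕ}

/-- The neighbours of the corner `x.1` in its copy `s`: two corners and `d - 3` cycle vertices. -/
def nbr (s : Bool) : Fin 3 × (Bool ⊕ Fin (d - 3)) → PrismCycleVertex d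
  | (i, Sum.inl true) => corner s (i + 1)
  | (i, Sum.inl false) => corner s (i + 2)
  | (i, Sum.inr j) => rim s (finProdFinEquiv (i, j))

lemma adj_corner_block (s : Bool) (i : Fin 3) (j : Fin (d - 3)) :
    (prismCycleGraph d).Adj (corner s i) (rim s (finProdFinEquiv (i, j))) := by
  refine adj_corner_rim s ?_
  rw [finProdFinEquiv_apply_val, Nat.add_mul_div_left _ _ j.pos, Nat.div_eq_of_lt j.2, zero_add]

lemma adj_nbr (s : Bool) (x : Fin 3 × (Bool ⊕ Fin (d - 3))) :
    (prismCycleGraph d).Adj (corner s x.1) (nbr s x) := by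
  obtain ⟨i, b | j⟩ := x
  · cases b
    · exact adj_corner s (fin_three_ne_add_two i)
    · exact adj_corner s (fin_three_ne_add_one i)
  · exact adj_corner_block s i j

lemma nbr_injective (s : Bool) : Function.Injective fun x : Fin 3 × (Bool ⊕ Fin (d - 3)) =>
    (x.1, nbr s x) := by
  rintro ⟨i, b | j⟩ ⟨i', b' | j'⟩ h
  · obtain ⟨rfl, h⟩ := Prod.mk.inj h
    cases b <;> cases b' <;> simp [nbr, (fin_three_add_one_ne_add_two _).symm] at h ⊢
  · cases b <;> simp [nbr] at h
  · cases b' <;> simp [nbr] at h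
  · simp only [nbr, Prod.mk.injEq, Sum.inr.injEq, true_and, EmbeddingLike.apply_eq_iff_eq] at h
    simp [h]

end Neighbours

namespace BendDrawing

open Chain

variable {d : ℕ} (B : BendDrawing (prismCycleGraph d))

lemma hexagon_evenVertex (s : Bool) (i : Fin 3) :
    B.hexagon s (evenVertex i) = B.pos (corner s i) := by fin_cases i <;> rfl

lemma hexagon_evenVertex_add (s : Bool) (i : Fin 3) :
    B.hexagon s (evenVertex i + 1) = B.bend s(corner s i, corner s (i + 1)) := by
  fin_cases i <;> rfl

lemma hexagon_evenVertex_sub (s : Bool) (i : Fin 3) :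
    B.hexagon s (evenVertex i - 1) = B.bend s(corner s i, corner s (i + 2)) := by
  rw [Sym2.eq_swap]; fin_cases i <;> rfl

lemma hexagon_evenVertex_add_two (s : Bool) (i : Fin 3) :
    B.hexagon s (evenVertex i + 1 + 1) = B.pos (corner s (i + 1)) := by fin_cases i <;> rfl

lemma simpleHex_hexagon (s : Bool) : SimpleHex (B.hexagon s) := by
  constructor
  · intro k
    obtain ⟨i, rfl | rfl⟩ : ∃ i, k = evenVertex i ∨ k = evenVertex i + 1 := by
      revert k; decide
    · rw [hexagon_evenVertex_add, hexagon_evenVertex_sub, hexagon_evenVertex]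
      refine B.not_sameRay_of_ne (adj_corner s (fin_three_ne_add_one i))
        (adj_corner s (fin_three_ne_add_two i)) ?_
      simp
    · rw [add_sub_cancel_right, hexagon_evenVertex_add_two, hexagon_evenVertex_add,
        hexagon_evenVertex]
      exact fun h => B.not_sameRay _ _ (adj_corner s (fin_three_ne_add_one i)) h.symm
  · intro k l h1 h2 h3
    rw [segment_hexagon, segment_hexagon]
    have key : ∀ k l : Fin 6, l ≠ k → l ≠ k + 1 → k ≠ l + 1 → halfStart k ≠ halfStart l ∧
        ¬ (halfStart k = halfEnd l ∧ halfEnd k = halfStart l) := by decide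
    obtain ⟨h4, h5⟩ := key k l h1 h2 h3
    refine B.disjoint_half (adj_half s k) (adj_half s l) ?_ ?_
    · intro he
      rcases Sym2.eq_iff.1 he with h | h
      · simp [h4] at h
      · simp only [Prod.mk.injEq, Sum.inl.injEq, true_and] at h
        exact h5 h
    · simpa using h4

lemma runsWeaklyInside_bend_nbr {s : Bool}
    (hin : ∀ x, upSum (B.pos (rim s x)) (hex (B.hexagon s)) = 1)
    (x : Fin 3 × (Bool ⊕ Fin (d - 3))) :
    RunsWeaklyInside (B.hexagon s) (evenVertex x.1) (B.bend s(corner s x.1, nbr s x)) := by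
  obtain ⟨i, b | j⟩ := x
  · cases b
    · exact Or.inr (Or.inr (B.hexagon_evenVertex_sub s i).symm)
    · exact Or.inr (Or.inl (B.hexagon_evenVertex_add s i).symm)
  · have hadj := adj_corner_block s i j
    have hne : ∀ i' : Fin 3, rim s (finProdFinEquiv (i, j)) ≠ corner s i' := fun i' => by simp
    refine Or.inl ⟨⟨?_, ?_⟩, ?_, ?_⟩
    · rw [hexagon_evenVertex_add, hexagon_evenVertex]
      exact B.not_sameRay_of_ne hadj (adj_corner s (fin_three_ne_add_one i)) (hne _)
    · rw [hexagon_evenVertex_sub, hexagon_evenVertex]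
      exact B.not_sameRay_of_ne hadj (adj_corner s (fin_three_ne_add_two i)) (hne _)
    · intro k h1 h2
      have key : ∀ (i : Fin 3) (k : Fin 6), k ≠ evenVertex i → k + 1 ≠ evenVertex i →
        i ≠ halfStart k := by decide
      rw [hexagon_evenVertex]
      refine (B.disjoint_hexagon_half s k hadj (Or.inr hne) ?_).symm
      simpa using key i k h1 h2
    · rw [Sym2.eq_swap, ← hin (finProdFinEquiv (i, j))]
      exact (B.upSum_hexagon_eq s hadj.symm hne).symm

/-- Each slope is used at most four times by the `3 (d - 1)` segments at the three corners that run
along or inside the hexagon. -/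
theorem card_le_of_slopeOf_mem {s : Bool}
    (hin : ∀ x, upSum (B.pos (rim s x)) (hex (B.hexagon s)) = 1)
    {S : Finset (Submodule ℝ (ℝ × ℝ))}
    (hS : ∀ u v, (prismCycleGraph d).Adj u v → slopeOf (B.pos u) (B.bend s(u, v)) ∈ S) :
    3 * (2 + (d - 3)) ≤ 4 * S.card := by
  classical
  let slope : Fin 3 × (Bool ⊕ Fin (d - 3)) → Submodule ℝ (ℝ × ℝ) := fun x =>
    slopeOf (B.pos (corner s x.1)) (B.bend s(corner s x.1, nbr s x))
  have hcard : (Finset.univ : Finset (Fin 3 × (Bool ⊕ Fin (d - 3)))).card = 3 * (2 + (d - 3)) := by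
    simp
  rw [← hcard]
  refine Finset.card_le_mul_card_image_of_maps_to (f := slope)
    (fun x _ => hS _ _ (adj_nbr s x)) 4 fun L _ => ?_
  rcases Finset.eq_empty_or_nonempty (Finset.univ.filter fun x => slope x = L) with h0 | ⟨x₀, hx₀⟩
  · simp [h0]
  have hx₀ : slope x₀ = L := (Finset.mem_filter.1 hx₀).2
  set u := B.bend s(corner s x₀.1, nbr s x₀) - B.pos (corner s x₀.1) with hu
  have hu0 : u ≠ 0 := sub_ne_zero.2 (B.pos_ne_bend _ _ (adj_nbr s x₀)).symm
  have hex : ∀ x, ∃ c : ℝ, slope x = L → c ≠ 0 ∧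
      B.bend s(corner s x.1, nbr s x) - B.pos (corner s x.1) = c • u := by
    intro x
    by_cases hx : slope x = L
    · obtain ⟨c, hc⟩ := exists_smul_of_slopeOf_eq (B.pos_ne_bend _ _ (adj_nbr s x))
        (hx.trans hx₀.symm)
      exact ⟨c, fun _ => hc⟩
    · exact ⟨0, fun h => absurd h hx⟩
  choose c hc using hex
  let f : Fin 3 × (Bool ⊕ Fin (d - 3)) → Fin 3 × Bool := fun x => (x.1, decide (0 < c x))
  have hinj : Set.InjOn f (Finset.univ.filter fun x => slope x = L) := by
    intro x hx y hy hxy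
    have hx : slope x = L := (Finset.mem_filter.1 hx).2
    have hy : slope y = L := (Finset.mem_filter.1 hy).2
    obtain ⟨h1, h2⟩ := Prod.mk.inj hxy
    rw [decide_eq_decide] at h2
    obtain ⟨cx0, ex⟩ := hc x hx
    obtain ⟨cy0, ey⟩ := hc y hy
    refine nbr_injective s (Prod.ext h1 ?_)
    by_contra hne
    have hadj := adj_nbr s x
    rw [h1] at ex hadj
    refine B.not_sameRay_of_ne hadj (adj_nbr s y) hne ?_
    rw [ex, ey]
    rcases lt_or_gt_of_ne cx0 with h | h
    · have hy' : c y < 0 := lt_of_le_of_ne (not_lt.1 fun h' => absurd (h2.2 h') h.not_gt) cy0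
      have := (SameRay.sameRay_nonneg_smul_left (R := ℝ) (-u) (neg_nonneg.2 h.le)).trans
        (SameRay.sameRay_nonneg_smul_right (R := ℝ) (-u) (neg_nonneg.2 hy'.le))
        (fun h => absurd (neg_eq_zero.1 h) hu0)
      simpa using this
    · exact (SameRay.sameRay_nonneg_smul_left (R := ℝ) u h.le).trans
        (SameRay.sameRay_nonneg_smul_right (R := ℝ) u (h2.1 h).le) (fun h => absurd h hu0)
  rw [← Finset.card_image_of_injOn hinj]
  refine (B.simpleHex_hexagon s).card_directions_le hu0 _ fun y hy => ?_
  obtain ⟨x, hx, rfl⟩ := Finset.mem_image.1 hy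
  have hx : slope x = L := (Finset.mem_filter.1 hx).2
  obtain ⟨cx0, ex⟩ := hc x hx
  refine ⟨_, B.runsWeaklyInside_bend_nbr hin x, |c x|, abs_pos.2 cx0, ?_⟩
  rw [hexagon_evenVertex, ex]
  congr 1
  by_cases h : 0 < c x
  · simp [f, h, signOf, abs_of_pos h]
  · simp [f, h, signOf, abs_of_nonpos (not_lt.1 h)]

end BendDrawing

/-! ### Counting slopes in straight-line drawings -/

open Chain

lemma det_eq_zero_of_slopeOf_eq {p q p' q' : ℝ × ℝ} (h : slopeOf p q = slopeOf p' q') :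
    det (q - p) (q' - p') = 0 := by
  have hm : q - p ∈ slopeOf p' q' := h ▸ Submodule.mem_span_singleton_self _
  obtain ⟨c, hc⟩ := Submodule.mem_span_singleton.1 hm
  rw [← hc, det_smul_left, det_self, mul_zero]

namespace PlaneDrawing

variable {V : Type*} {G : SimpleGraph V} {D : PlaneDrawing G}
  {S : Finset (Submodule ℝ (ℝ × ℝ))}

lemma HasBendsSlopes.mono {k l : ℕ} (hD : D.HasBendsSlopes k S) (h : k ≤ l) :
    D.HasBendsSlopes l S := by
  intro u v huv
  obtain ⟨m, hm, hx⟩ := hD u v huv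
  exact ⟨m, hm.trans h, hx⟩

lemma HasBendsSlopes.straight (hD : D.HasBendsSlopes 0 S) {u v : V} (h : G.Adj u v) :
    slopeOf (D.pos u) (D.pos v) ∈ S ∧ D.arc s(u, v) = segment ℝ (D.pos u) (D.pos v) := by
  obtain ⟨m, hm, x, h0, h1, hx, hA⟩ := hD u v h
  obtain rfl : m = 0 := by omega
  have := (hx 0 le_rfl).2
  rw [h0, h1] at this
  refine ⟨this, ?_⟩
  rw [hA, ← h0, ← h1]
  ext y
  simp

lemma HasBendsSlopes.eq_or_eq_of_mem_segment (hD : D.HasBendsSlopes 0 S) {u v w : V}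
    (h : G.Adj u v) (hw : D.pos w ∈ segment ℝ (D.pos u) (D.pos v)) : w = u ∨ w = v :=
  D.avoids u v w h (by rwa [(hD.straight h).2])

/-- In a straight-line drawing, different edges leave a vertex in different directions. -/
lemma HasBendsSlopes.ne_smul (hD : D.HasBendsSlopes 0 S) {u v w : V} (hv : G.Adj u v)
    (hw : G.Adj u w) (hne : v ≠ w) {c : ℝ} (hc : 0 < c) :
    D.pos w - D.pos u ≠ c • (D.pos v - D.pos u) := by
  intro h
  rcases le_or_gt c 1 with h1 | h1
  · rcases hD.eq_or_eq_of_mem_segment hv (w := w) ⟨1 - c, c, by linarith, hc.le, by ring, by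
      rw [← sub_eq_zero, ← neg_eq_zero, ← sub_eq_zero.2 h]; module⟩ with h2 | h2
    · exact hw.ne h2.symm
    · exact hne h2.symm
  · have h' : D.pos v - D.pos u = c⁻¹ • (D.pos w - D.pos u) := by
      rw [h, inv_smul_smul₀ hc.ne']
    rcases hD.eq_or_eq_of_mem_segment hw (w := v) ⟨1 - c⁻¹, c⁻¹,
      by simpa using inv_le_one_of_one_le₀ h1.le, (inv_pos.2 hc).le, by ring, by
      rw [← sub_eq_zero, ← neg_eq_zero, ← sub_eq_zero.2 h']; module⟩ with h2 | h2
    · exact hv.ne h2.symm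
    · exact hne h2

/-- The three vertices of a triangle of a graph are not collinear in a straight-line drawing. -/
lemma HasBendsSlopes.det_ne_zero (hD : D.HasBendsSlopes 0 S) {u v w : V} (huv : G.Adj u v)
    (hvw : G.Adj v w) (hwu : G.Adj w u) :
    det (D.pos v - D.pos u) (D.pos w - D.pos u) ≠ 0 := by
  intro h
  have hne : D.pos v - D.pos u ≠ 0 := sub_ne_zero.2 (D.pos_injective.ne huv.ne.symm)
  obtain ⟨c, hc⟩ := exists_smul_of_det_eq_zero hne h
  have hcol : Collinear ℝ {D.pos u, D.pos v, D.pos w} := by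
    rw [collinear_iff_of_mem (p₀ := D.pos u) (by simp)]
    refine ⟨D.pos v - D.pos u, fun p hp => ?_⟩
    rcases hp with rfl | rfl | rfl
    · exact ⟨0, by simp⟩
    · exact ⟨1, by simp⟩
    · exact ⟨c, by rw [← hc]; simp⟩
  rcases hcol.wbtw_or_wbtw_or_wbtw with h | h | h
  · rcases hD.eq_or_eq_of_mem_segment hwu.symm h.mem_segment with h | h
    · exact huv.ne h.symm
    · exact hvw.ne h
  · rcases hD.eq_or_eq_of_mem_segment huv.symm h.mem_segment with h | h
    · exact hvw.ne h.symm
    · exact hwu.ne h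
  · rcases hD.eq_or_eq_of_mem_segment hvw.symm h.mem_segment with h | h
    · exact hwu.ne h.symm
    · exact huv.ne h

end PlaneDrawing

/-- In a straight-line drawing, the cycle of one of the copies lies in the interior of its
triangle. -/
lemma exists_barycentric {d : ℕ} {D : PlaneDrawing (prismCycleGraph d)}
    {S : Finset (Submodule ℝ (ℝ × ℝ))} (hD : D.HasBendsSlopes 0 S) :
    ∃ s, ∀ x, ∃ w : Fin 3 → ℝ, (∀ i, 0 < w i) ∧ w 0 + w 1 + w 2 = 1 ∧
      w 0 • D.pos (corner s 0) + w 1 • D.pos (corner s 1) + w 2 • D.pos (corner s 2) =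
        D.pos (rim s x) := by
  obtain ⟨B, hB, hBS⟩ := (hD.mono zero_le_one).exists_bendDrawing
  obtain ⟨s, hs⟩ := B.exists_forall_upSum_hexagon_eq_one
  refine ⟨s, fun x => ?_⟩
  have hside : ∀ i j, i ≠ j → D.pos (rim s x) ∉
      segment ℝ (D.pos (corner s i)) (D.pos (corner s j)) := by
    intro i j hij hm
    rcases hD.eq_or_eq_of_mem_segment (adj_corner s hij) hm with h | h <;> simp at h
  have hc : ∀ i, D.pos (corner s i) ∈ convexHull ℝ
      {D.pos (corner s 0), D.pos (corner s 1), D.pos (corner s 2)} := by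
    intro i
    apply subset_convexHull
    fin_cases i <;> simp
  have hb : ∀ i j, i ≠ j → B.bend s(corner s i, corner s j) ∈ convexHull ℝ
      {D.pos (corner s 0), D.pos (corner s 1), D.pos (corner s 2)} := by
    intro i j hij
    have h1 := (hBS _ _ (adj_corner s hij)).2 (right_mem_segment ℝ _ _)
    rw [(hD.straight (adj_corner s hij)).2] at h1
    exact (convex_convexHull ℝ _).segment_subset (hc i) (hc j) h1
  have hmem : D.pos (rim s x) ∈ convexHull ℝ
      {D.pos (corner s 0), D.pos (corner s 1), D.pos (corner s 2)} := by
    have hsub : convexHull ℝ (Set.range (B.hexagon s)) ⊆ convexHull ℝ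
        {D.pos (corner s 0), D.pos (corner s 1), D.pos (corner s 2)} := by
      refine convexHull_min ?_ (convex_convexHull ℝ _)
      rintro _ ⟨k, rfl⟩
      rw [← hB] at hc
      fin_cases k
      · exact hB ▸ hc 0
      · exact hb 0 1 (by decide)
      · exact hB ▸ hc 1
      · exact hb 1 2 (by decide)
      · exact hB ▸ hc 2
      · exact hb 2 0 (by decide)
    refine hsub ?_
    by_contra hn
    have h0 := (Chain.hex_isCycle (B.hexagon s)).upSum_eq_zero_of_notMem_convexHull
      (Set.finite_range _) (fun e he => ?_) hn
    · rw [← hB, hs x] at h0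
      exact one_ne_zero h0
    · obtain ⟨i, rfl⟩ := Chain.mem_hex.1 he
      exact ⟨⟨i, rfl⟩, ⟨i + 1, rfl⟩⟩
  obtain ⟨α, β, γ, hα, hβ, hγ, h1, h2⟩ := exists_pos_of_mem_convexHull hmem
    (hside 0 1 (by decide)) (hside 1 2 (by decide)) (hside 2 0 (by decide))
  refine ⟨![α, β, γ], fun i => ?_, h1, h2⟩
  fin_cases i
  · exact hα
  · exact hβ
  · exact hγ

lemma fin_three_add : ∀ i : Fin 3, i + 1 + 1 = i + 2 ∧ i + 1 + 2 = i ∧ i + 2 + 1 = i ∧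
    i + 2 + 2 = i + 1 := by decide

lemma fin_three_trichotomy : ∀ i j : Fin 3, j = i ∨ j = i + 1 ∨ j = i + 2 := by decide

/-- The sides of a triangle and the edges from its vertices to the vertices inside it have pairwise
different slopes. -/
theorem card_le_of_straight {d : ℕ} {D : PlaneDrawing (prismCycleGraph d)}
    {S : Finset (Submodule ℝ (ℝ × ℝ))} (hD : D.HasBendsSlopes 0 S) :
    3 + 3 * (d - 3) ≤ S.card := by
  classical
  obtain ⟨s, hs⟩ := exists_barycentric hD
  choose w hw0 hw1 hw using hs
  let e : Fin 3 → ℝ × ℝ := fun i => D.pos (corner s (i + 1)) - D.pos (corner s i)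
  let r : Fin 3 × Fin (d - 3) → Fin (3 * (d - 3)) := fun x => finProdFinEquiv x
  obtain ⟨Δ, hΔ0, hΔ⟩ : ∃ Δ : ℝ, Δ ≠ 0 ∧ ∀ i, det (e i) (e (i + 1)) = Δ := by
    refine ⟨_, hD.det_ne_zero (adj_corner s (i := 0) (j := 1) (by decide))
      (adj_corner s (j := 2) (by decide)) (adj_corner s (by decide)), fun i => ?_⟩
    fin_cases i <;> simp [e, det] <;> ring
  have hΔ2 : ∀ i, det (e i) (e (i + 2)) = -Δ := by
    intro i
    rw [det_swap, ← hΔ (i + 2), (fin_three_add i).2.2.1]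
  -- The direction of an edge into the triangle lies between the directions of the two sides.
  let v : Fin 3 × Fin (d - 3) → ℝ × ℝ := fun x => D.pos (rim s (r x)) - D.pos (corner s x.1)
  have hv : ∀ i j, v (i, j) =
      w (r (i, j)) (i + 1) • e i - w (r (i, j)) (i + 2) • e (i + 2) := by
    intro i j
    simp only [v]
    rw [← hw]
    have h1 := hw1 (r (i, j))
    generalize w (r (i, j)) = W at h1
    have e3 : W 0 = 1 - W 1 - W 2 := by linarith
    fin_cases i <;> simp [e, e3] <;> module
  have hlin : ∀ (a b : ℝ) (u x y : ℝ × ℝ), det u (a • x - b • y) = a * det u x - b * det u y := by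
    intros; simp [det]; ring
  have hlin' : ∀ (a b : ℝ) (u x y : ℝ × ℝ), det (a • x - b • y) u = a * det x u - b * det y u := by
    intros; simp [det]; ring
  have hev : ∀ i j k, det (e k) (v (i, j)) ≠ 0 := by
    intro i j k
    have p1 := hw0 (r (i, j)) (i + 1)
    have p2 := hw0 (r (i, j)) (i + 2)
    rw [hv, hlin]
    rcases fin_three_trichotomy i k with rfl | rfl | rfl
    · rw [det_self, hΔ2, mul_zero, zero_sub, mul_neg, neg_neg]
      exact mul_ne_zero p2.ne' hΔ0
    · have h1 := hΔ2 (i + 1)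
      have h2 := hΔ (i + 1)
      rw [(fin_three_add i).2.1] at h1
      rw [(fin_three_add i).1] at h2
      rw [h1, h2, show w (r (i, j)) (i + 1) * -Δ - w (r (i, j)) (i + 2) * Δ =
        -((w (r (i, j)) (i + 1) + w (r (i, j)) (i + 2)) * Δ) by ring]
      exact neg_ne_zero.2 (mul_ne_zero (add_pos p1 p2).ne' hΔ0)
    · have h1 := hΔ (i + 2)
      rw [(fin_three_add i).2.2.1] at h1
      rw [h1, det_self, mul_zero, sub_zero]
      exact mul_ne_zero p1.ne' hΔ0
  have hvv : ∀ i j j', det (v (i, j)) (v (i + 1, j')) ≠ 0 := by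
    intro i j j'
    have p1 := hw0 (r (i, j)) (i + 1)
    have p2 := hw0 (r (i, j)) (i + 2)
    have q1 := hw0 (r (i + 1, j')) (i + 2)
    have q2 := hw0 (r (i + 1, j')) i
    have h1 := hΔ2 (i + 2)
    have h2 := hΔ (i + 2)
    rw [(fin_three_add i).2.2.2] at h1
    rw [(fin_three_add i).2.2.1] at h2
    rw [hv i, hv (i + 1), (fin_three_add i).1, (fin_three_add i).2.1, hlin, hlin', hlin', hΔ, h1,
      h2, det_self]
    have : 0 < w (r (i + 1, j')) (i + 2) * (w (r (i, j)) (i + 1) + w (r (i, j)) (i + 2)) +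
      w (r (i + 1, j')) i * w (r (i, j)) (i + 2) := by positivity
    convert mul_ne_zero this.ne' hΔ0 using 1
    ring
  have hvs : ∀ i j j', j ≠ j' → det (v (i, j)) (v (i, j')) ≠ 0 := by
    intro i j j' hj h0
    have hne : v (i, j) ≠ 0 := by
      intro h
      have := hev i j i
      rw [h] at this
      simp [det] at this
    obtain ⟨c, hc⟩ := exists_smul_of_det_eq_zero hne h0
    -- Both directions lie in the angle of the triangle at the corner, hence `c` is positive.
    have hpos : 0 < c := by
      have h1 : det (e i) (v (i, j')) = c * det (e i) (v (i, j)) := by rw [hc, det_smul_right]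
      rw [hv, hv, hlin, hlin, det_self, hΔ2] at h1
      have p := hw0 (r (i, j)) (i + 2)
      have q := hw0 (r (i, j')) (i + 2)
      have h2 : w (r (i, j')) (i + 2) = c * w (r (i, j)) (i + 2) :=
        mul_right_cancel₀ hΔ0 (by linear_combination h1)
      by_contra hcon
      nlinarith
    refine hD.ne_smul (adj_corner_block s i j) (adj_corner_block s i j') ?_ hpos hc
    simpa using hj
  let f : Fin 3 ⊕ (Fin 3 × Fin (d - 3)) → Submodule ℝ (ℝ × ℝ) := Sum.elim
    (fun i => slopeOf (D.pos (corner s i)) (D.pos (corner s (i + 1))))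
    (fun x => slopeOf (D.pos (corner s x.1)) (D.pos (rim s (r x))))
  have hf : ∀ x ∈ (Finset.univ : Finset (Fin 3 ⊕ (Fin 3 × Fin (d - 3)))), f x ∈ S := by
    rintro (i | x) -
    · exact (hD.straight (adj_corner s (fin_three_ne_add_one i))).1
    · exact (hD.straight (adj_corner_block s x.1 x.2)).1
  have hinj : Function.Injective f := by
    rintro (i | ⟨i, j⟩) (i' | ⟨i', j'⟩) h
    · have h := det_eq_zero_of_slopeOf_eq h
      rcases fin_three_trichotomy i i' with rfl | rfl | rfl
      · rfl
      · exact absurd ((hΔ i).symm.trans h) hΔ0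
      · exact absurd ((hΔ2 i).symm.trans h) (neg_ne_zero.2 hΔ0)
    · exact absurd (det_eq_zero_of_slopeOf_eq h) (hev _ _ _)
    · exact absurd (det_eq_zero_of_slopeOf_eq h.symm) (hev _ _ _)
    · have h' := det_eq_zero_of_slopeOf_eq h.symm
      have h := det_eq_zero_of_slopeOf_eq h
      rcases fin_three_trichotomy i i' with rfl | rfl | rfl
      · by_contra hne
        exact hvs _ j j' (fun hj => hne (by rw [hj])) h
      · exact absurd h (hvv _ _ _)
      · have := hvv (i + 2) j' j
        rw [(fin_three_add i).2.2.1] at this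
        exact absurd h' this
  have := Finset.card_le_card_of_injOn f hf hinj.injOn
  simpa using this

/-! ### Straight-line drawings from separating lines -/

section StraightLine

variable {V : Type*}

lemma isArcBetween_segment {p q : ℝ × ℝ} (h : p ≠ q) : IsArcBetween p q (segment ℝ p q) := by
  refine ⟨⟨⟨fun t => AffineMap.lineMap p q (t : ℝ), by fun_prop⟩, by simp, by simp⟩, ?_, ?_⟩
  · exact (AffineMap.lineMap_injective ℝ h).comp Subtype.val_injective
  · rw [segment_eq_image_lineMap]
    ext x
    simp

/-- The segment between the positions of the two end vertices of an edge. -/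
def edgeSegment (pos : V → ℝ × ℝ) : Sym2 V → Set (ℝ × ℝ) :=
  Sym2.lift ⟨fun u v => segment ℝ (pos u) (pos v), fun _ _ => segment_symm _ _ _⟩

/-- The segments of two edges meet in common end vertices only. -/
def NonCrossing (pos : V → ℝ × ℝ) (e e' : Sym2 V) : Prop :=
  ∀ x ∈ edgeSegment pos e, x ∈ edgeSegment pos e' → ∃ w, w ∈ e ∧ w ∈ e' ∧ x = pos w

lemma NonCrossing.symm {pos : V → ℝ × ℝ} {e e' : Sym2 V} (h : NonCrossing pos e e') :
    NonCrossing pos e' e := fun x hx hx' =>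
  let ⟨w, h1, h2, h3⟩ := h x hx' hx
  ⟨w, h2, h1, h3⟩

/-- Two different edges do not cross if the line `A x + B y + C = 0` separates them and contains
no vertex of the second one that is not a vertex of the first one. -/
lemma nonCrossing_of_separated {pos : V → ℝ × ℝ} {e e' : Sym2 V} (hne : e ≠ e')
    (hd : ¬ e'.IsDiag) (A B C : ℝ) (he : ∀ w ∈ e, A * (pos w).1 + B * (pos w).2 + C ≤ 0)
    (he' : ∀ w ∈ e', 0 ≤ A * (pos w).1 + B * (pos w).2 + C)
    (hz : ∀ w ∈ e', A * (pos w).1 + B * (pos w).2 + C = 0 → w ∈ e) : NonCrossing pos e e' := by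
  induction e with | _ u v
  induction e' with | _ u' v'
  rintro _ ⟨a, b, ha, hb, hab, rfl⟩ ⟨a', b', ha', hb', hab', hx⟩
  have hu := he u (Sym2.mem_mk_left u v)
  have hv := he v (Sym2.mem_mk_right u v)
  have hu' := he' u' (Sym2.mem_mk_left u' v')
  have hv' := he' v' (Sym2.mem_mk_right u' v')
  have zu' := hz u' (Sym2.mem_mk_left u' v')
  have zv' := hz v' (Sym2.mem_mk_right u' v')
  have h1 : a' * (A * (pos u').1 + B * (pos u').2 + C) +
      b' * (A * (pos v').1 + B * (pos v').2 + C) =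
      a * (A * (pos u).1 + B * (pos u).2 + C) + b * (A * (pos v).1 + B * (pos v).2 + C) := by
    have e1 := congrArg Prod.fst hx
    have e2 := congrArg Prod.snd hx
    simp only [Prod.fst_add, Prod.snd_add, Prod.smul_fst, Prod.smul_snd, smul_eq_mul] at e1 e2
    linear_combination A * e1 + B * e2 + C * hab' - C * hab
  rw [← hx]
  generalize A * (pos u).1 + B * (pos u).2 + C = gu at *
  generalize A * (pos v).1 + B * (pos v).2 + C = gv at *
  generalize A * (pos u').1 + B * (pos u').2 + C = gu' at *
  generalize A * (pos v').1 + B * (pos v').2 + C = gv' at *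
  have k1 := mul_nonneg ha' hu'
  have k2 := mul_nonneg hb' hv'
  have k3 := mul_nonpos_of_nonneg_of_nonpos ha hu
  have k4 := mul_nonpos_of_nonneg_of_nonpos hb hv
  have h2 : a' * gu' = 0 := by linarith
  have h3 : b' * gv' = 0 := by linarith
  rcases mul_eq_zero.1 h2 with h | h
  · obtain rfl : b' = 1 := by linarith
    exact ⟨v', zv' (by linarith), by simp, by rw [h]; simp⟩
  rcases mul_eq_zero.1 h3 with h' | h'
  · obtain rfl : a' = 1 := by linarith
    exact ⟨u', zu' (by linarith), by simp, by rw [h']; simp⟩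
  · exact absurd ((Sym2.mem_and_mem_iff (by simpa using hd)).1 ⟨zu' h, zv' h'⟩) hne

/-- A placement of the vertices without crossing edges gives a straight-line drawing. -/
lemma exists_straight_drawing [Finite V] {G : SimpleGraph V} {pos : V → ℝ × ℝ}
    (hpos : Function.Injective pos) (hG : ∀ u, ∃ v, G.Adj u v)
    (h : ∀ e ∈ G.edgeSet, ∀ e' ∈ G.edgeSet, e ≠ e' → NonCrossing pos e e') :
    ∃ (D : PlaneDrawing G) (S : Finset (Submodule ℝ (ℝ × ℝ))), D.HasBendsSlopes 0 S := by
  classical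
  have := Fintype.ofFinite V
  refine ⟨⟨pos, edgeSegment pos, hpos, fun u v huv => isArcBetween_segment (hpos.ne huv.ne),
    ?_, ?_⟩, Finset.univ.image fun x : V × V => slopeOf (pos x.1) (pos x.2), ?_⟩
  · intro u v w huv hw
    by_contra hcon
    obtain ⟨w', hw'⟩ := hG w
    have hmem : w ∉ s(u, v) := by simpa using hcon
    obtain ⟨x, hx, -, hwx⟩ := h _ ((SimpleGraph.mem_edgeSet G).2 huv) s(w, w')
      ((SimpleGraph.mem_edgeSet G).2 hw') (fun he => hmem (he ▸ Sym2.mem_mk_left w w')) _ hw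
      (left_mem_segment ℝ _ _)
    exact hmem (hpos hwx ▸ hx)
  · intro u v u' v' huv huv' hne
    rw [Set.disjoint_left]
    rintro x ⟨hx, hx0⟩ ⟨hx', -⟩
    obtain ⟨w, hw, -, rfl⟩ := h _ ((SimpleGraph.mem_edgeSet G).2 huv) _
      ((SimpleGraph.mem_edgeSet G).2 huv') hne _ hx hx'
    apply hx0
    rcases Sym2.mem_iff.1 hw with rfl | rfl <;> simp
  · intro u v huv
    refine ⟨0, le_rfl, fun n => if n = 0 then pos u else pos v, by simp, by simp, ?_, ?_⟩
    · intro i hi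
      obtain rfl : i = 0 := by omega
      exact ⟨by simpa using hpos.ne huv.ne, by simp⟩
    · simp [edgeSegment]

end StraightLine

/-! ### Points on the inscribed conic -/

section Coordinates

/-- Homogeneous barycentric coordinates, with respect to the triangle of a copy, of the vertices of
the copy. The cycle is placed on the conic inscribed in the triangle, parametrized by the quadratic
polynomials `(4 k - m) ^ 2`, `(2 k) ^ 2`, `(m - 2 k) ^ 2`, at the odd values of `m` up to `6 k`. The
conic touches the sides of the triangle at `m = 0, 2 k, 4 k`. -/
def coord (k : ℕ) : Fin 3 ⊕ Fin (3 * k) → Fin 3 → ℝ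
  | Sum.inl i => Pi.single i 1
  | Sum.inr n => ![(4 * k - (2 * n + 1)) ^ 2, (2 * k) ^ 2, (2 * n + 1 - 2 * k) ^ 2]

/-- The bilinear form of the conic, as a linear form in its second argument: at the parameter `m` it
has the value `4 k ^ 2 (m - p) (m - q)`, so it vanishes on the line through the points with
parameters `p` and `q`. -/
def conicForm (k p q : ℝ) : Fin 3 → ℝ :=
  ![k * (p + q - 4 * k), p * q - 3 * k * (p + q) + 8 * k ^ 2, k * (8 * k - p - q)]

variable {k : ℕ}

lemma conicForm_dotProduct_coord (p q : ℝ) (n : Fin (3 * k)) :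
    conicForm k p q ⬝ᵥ coord k (Sum.inr n) =
      4 * k ^ 2 * ((2 * n + 1 - p) * (2 * n + 1 - q)) := by
  simp only [conicForm, coord, dotProduct, Fin.sum_univ_three, Matrix.cons_val_zero,
    Matrix.cons_val_one, Matrix.cons_val]
  ring

lemma pos_of_fin_three_mul (n : Fin (3 * k)) : (0 : ℝ) < k := by
  have := n.pos
  exact_mod_cast (by omega : 0 < k)

lemma coord_pos (n : Fin (3 * k)) (i : Fin 3) : 0 < coord k (Sum.inr n) i := by
  have hk := pos_of_fin_three_mul n
  have h1 : (4 * k - (2 * n + 1) : ℝ) ≠ 0 := by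
    have : (4 * k - (2 * n + 1) : ℤ) ≠ 0 := by omega
    exact_mod_cast this
  have h2 : (2 * n + 1 - 2 * k : ℝ) ≠ 0 := by
    have : (2 * n + 1 - 2 * k : ℤ) ≠ 0 := by omega
    exact_mod_cast this
  fin_cases i <;> simp [coord] <;> positivity

lemma coord_nonneg (w : Fin 3 ⊕ Fin (3 * k)) (i : Fin 3) : 0 ≤ coord k w i := by
  rcases w with j | n
  · rw [coord, Pi.single_apply]
    split <;> norm_num
  · exact (coord_pos n i).le

lemma coord_sum_pos (w : Fin 3 ⊕ Fin (3 * k)) : 0 < coord k w 0 + coord k w 1 + coord k w 2 := by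
  rcases w with j | n
  · fin_cases j <;> simp [coord]
  · have := coord_pos n
    linarith [this 0, this 1, this 2]

lemma block_bounds {n : Fin (3 * k)} {i : Fin 3} (h : n.val / k = i.val) :
    (2 * i * k : ℝ) < 2 * n + 1 ∧ (2 * n + 1 : ℝ) < 2 * (i + 1) * k := by
  have hk : 0 < k := by have := n.pos; omega
  have h1 : i.val * k ≤ n.val := h ▸ Nat.div_mul_le_self _ _
  have h2 : n.val + 1 ≤ (i.val + 1) * k := by
    have := Nat.lt_mul_div_succ n.val hk
    rw [h] at this
    linarith [mul_comm k (i.val + 1)]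
  have h1' : (i.val * k : ℝ) ≤ n.val := by exact_mod_cast h1
  have h2' : (n.val + 1 : ℝ) ≤ (i.val + 1) * k := by exact_mod_cast h2
  constructor <;> linarith

/-- The tangent at a point of block `i` separates the vertex `i` of the triangle from the conic. -/
lemma conicForm_dotProduct_apex {n : Fin (3 * k)} {i : Fin 3} (h : n.val / k = i.val) :
    conicForm k (2 * n + 1) (2 * n + 1) ⬝ᵥ coord k (Sum.inl i) < 0 := by
  have hk := pos_of_fin_three_mul n
  obtain ⟨h1, h2⟩ := block_bounds h
  generalize (2 * n + 1 : ℝ) = m at *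
  fin_cases i <;> simp [conicForm, coord, dotProduct, Fin.sum_univ_three] at h1 h2 ⊢
  · nlinarith
  · nlinarith
  · nlinarith

/-- In block `i` the coordinate `i` is the largest one. -/
lemma coord_lt_coord {n : Fin (3 * k)} {i j : Fin 3} (h : n.val / k = i.val) (hij : j ≠ i) :
    coord k (Sum.inr n) j < coord k (Sum.inr n) i := by
  have hk := pos_of_fin_three_mul n
  obtain ⟨h1, h2⟩ := block_bounds h
  simp only [coord]
  generalize (2 * n + 1 : ℝ) = m at *
  fin_cases i <;> fin_cases j <;> simp at h1 h2 hij ⊢ <;> nlinarith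

/-- A line through the vertex `i` of the triangle that contains one point of block `i` contains no
other one. -/
lemma exists_fan_form {n n' : Fin (3 * k)} {i : Fin 3} (h : n.val / k = i.val)
    (h' : n'.val / k = i.val) (hne : n ≠ n') : ∃ a : Fin 3 → ℝ, a ⬝ᵥ coord k (Sum.inl i) = 0 ∧
      a ⬝ᵥ coord k (Sum.inr n) = 0 ∧ 0 < a ⬝ᵥ coord k (Sum.inr n') := by
  suffices hs : ∃ a : Fin 3 → ℝ, a ⬝ᵥ coord k (Sum.inl i) = 0 ∧
      a ⬝ᵥ coord k (Sum.inr n) = 0 ∧ a ⬝ᵥ coord k (Sum.inr n') ≠ 0 by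
    obtain ⟨a, h1, h2, h3⟩ := hs
    rcases lt_or_gt_of_ne h3 with h | h
    · exact ⟨-a, by simp [h1], by simp [h2], by simpa using h⟩
    · exact ⟨a, h1, h2, h⟩
  have hk := pos_of_fin_three_mul n
  obtain ⟨h1, h2⟩ := block_bounds h
  obtain ⟨h3, h4⟩ := block_bounds h'
  have hm : (2 * n + 1 - (2 * n' + 1) : ℝ) ≠ 0 := by
    have : (n : ℝ) ≠ n' := fun h => hne (Fin.ext (by exact_mod_cast h))
    intro h
    exact this (by linarith)
  have hc : ∀ n : Fin (3 * k), coord k (Sum.inr n) =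
    (![(4 * k - (2 * n + 1)) ^ 2, (2 * k) ^ 2, (2 * n + 1 - 2 * k) ^ 2] : Fin 3 → ℝ) :=
    fun n => rfl
  rw [hc, hc]
  generalize (2 * n + 1 : ℝ) = m at *
  generalize (2 * n' + 1 : ℝ) = m' at *
  fin_cases i
  · refine ⟨![0, -(m - 2 * k) ^ 2, (2 * k) ^ 2], ?_, ?_, ?_⟩
    · simp [coord, dotProduct, Fin.sum_univ_three]
    · simp [dotProduct, Fin.sum_univ_three]; ring
    · have : m + m' - 4 * k < 0 := by simp at h2 h4; linarith
      have hk2 : -(2 * k : ℝ) ^ 2 ≠ 0 := neg_ne_zero.2 (by positivity)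
      have := mul_ne_zero (mul_ne_zero hk2 hm) this.ne
      convert this using 1
      simp [dotProduct, Fin.sum_univ_three]; ring
  · refine ⟨![-(m - 2 * k) ^ 2, 0, (4 * k - m) ^ 2], ?_, ?_, ?_⟩
    · simp [coord, dotProduct, Fin.sum_univ_three]
    · simp [dotProduct, Fin.sum_univ_three]; ring
    · simp at h1 h2 h3 h4
      have : (m - 4 * k) * (m' - 2 * k) + (m - 2 * k) * (m' - 4 * k) < 0 := by nlinarith
      have := mul_ne_zero (mul_ne_zero (by positivity : (2 * k : ℝ) ≠ 0) hm) this.ne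
      convert this using 1
      simp [dotProduct, Fin.sum_univ_three]; ring
  · refine ⟨![(2 * k) ^ 2, -(4 * k - m) ^ 2, 0], ?_, ?_, ?_⟩
    · simp [coord, dotProduct, Fin.sum_univ_three]
    · simp [dotProduct, Fin.sum_univ_three]; ring
    · have : 0 < m + m' - 8 * k := by simp at h1 h3; linarith
      have hk2 : -(2 * k : ℝ) ^ 2 ≠ 0 := neg_ne_zero.2 (by positivity)
      have := mul_ne_zero (mul_ne_zero hk2 hm) this.ne'
      convert this using 1
      simp [dotProduct, Fin.sum_univ_three]; ring

lemma cycleGraph_adj_cases {n : ℕ} {x y : Fin n} (h : (SimpleGraph.cycleGraph n).Adj x y) :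
    y.val = x.val + 1 ∨ x.val = y.val + 1 ∨ (x.val + 1 = n ∧ y.val = 0) ∨
      (y.val + 1 = n ∧ x.val = 0) := by
  have key : ∀ x y : Fin n, (x - y).val = 1 → x.val = y.val + 1 ∨ (y.val + 1 = n ∧ x.val = 0) := by
    intro x y h
    rw [Fin.sub_def] at h
    have hx := x.2
    have hy := y.2
    rcases lt_or_ge (n - y.val + x.val) n with h1 | h1
    · simp only [Nat.mod_eq_of_lt h1] at h
      omega
    · simp only [Nat.mod_eq_sub_mod h1] at h
      rw [Nat.mod_eq_of_lt (by omega)] at h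
      omega
  rw [SimpleGraph.cycleGraph_adj'] at h
  rcases h with h | h
  · have := key x y h; tauto
  · have := key y x h; tauto

/-- The line along an edge of the cycle supports the convex polygon formed by the cycle. -/
lemma exists_rim_form {x y : Fin (3 * k)} (h : (SimpleGraph.cycleGraph (3 * k)).Adj x y) :
    ∃ a : Fin 3 → ℝ, ∀ z, 0 ≤ a ⬝ᵥ coord k (Sum.inr z) ∧
      (a ⬝ᵥ coord k (Sum.inr z) = 0 ↔ z = x ∨ z = y) := by
  have hk := pos_of_fin_three_mul x
  have hzero : ∀ z : Fin (3 * k), (z.val : ℝ) - x.val = 0 ∨ (z.val : ℝ) - y.val = 0 ↔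
      z = x ∨ z = y := by
    intro z
    simp only [sub_eq_zero, Nat.cast_inj, Fin.ext_iff]
  have hval : ∀ z : Fin (3 * k), conicForm k (2 * x + 1) (2 * y + 1) ⬝ᵥ coord k (Sum.inr z) =
      16 * k ^ 2 * (((z.val : ℝ) - x.val) * ((z.val : ℝ) - y.val)) := by
    intro z; rw [conicForm_dotProduct_coord]; ring
  -- No parameter lies between those of consecutive points, and all lie between the first and the
  -- last one.
  have key : (∀ z : Fin (3 * k), 0 ≤ ((z.val : ℤ) - x.val) * ((z.val : ℤ) - y.val)) ∨
      (∀ z : Fin (3 * k), ((z.val : ℤ) - x.val) * ((z.val : ℤ) - y.val) ≤ 0) := by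
    have hcons : ∀ a b : ℤ, 0 ≤ (a - b) * (a - (b + 1)) := by
      intro a b
      rcases le_or_gt a b with h | h
      · exact mul_nonneg_of_nonpos_of_nonpos (by omega) (by omega)
      · exact mul_nonneg (by omega) (by omega)
    rcases cycleGraph_adj_cases h with h | h | ⟨h, h'⟩ | ⟨h, h'⟩
    · exact Or.inl fun z => by rw [h]; exact_mod_cast hcons z x
    · exact Or.inl fun z => by rw [h, mul_comm]; exact_mod_cast hcons z y
    · exact Or.inr fun z => mul_nonpos_of_nonpos_of_nonneg (by omega) (by omega)
    · exact Or.inr fun z => mul_nonpos_of_nonneg_of_nonpos (by omega) (by omega)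
  rcases key with key | key
  · refine ⟨conicForm k (2 * x + 1) (2 * y + 1), fun z => ?_⟩
    have hz : 0 ≤ ((z.val : ℝ) - x.val) * ((z.val : ℝ) - y.val) := by exact_mod_cast key z
    rw [hval, mul_eq_zero, or_iff_right (by positivity), mul_eq_zero, hzero]
    exact ⟨by positivity, Iff.rfl⟩
  · refine ⟨-conicForm k (2 * x + 1) (2 * y + 1), fun z => ?_⟩
    have hz : ((z.val : ℝ) - x.val) * ((z.val : ℝ) - y.val) ≤ 0 := by exact_mod_cast key z
    rw [neg_dotProduct, hval, neg_eq_zero, mul_eq_zero, or_iff_right (by positivity), mul_eq_zero,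
      hzero]
    exact ⟨neg_nonneg.2 (mul_nonpos_of_nonneg_of_nonpos (by positivity) hz), Iff.rfl⟩

end Coordinates

/-! ### A straight-line drawing of the graph -/

section Drawing

variable {k : ℕ}

/-- The positions of the vertices: the triangle of the copy `true` has the vertices `(2, 1)`,
`(2, -1)`, `(1, 0)`, and the copy `false` is its mirror image. -/
noncomputable def drawPos (k : ℕ) (v : Bool × (Fin 3 ⊕ Fin (3 * k))) : ℝ × ℝ :=
  (signOf v.1 * (2 - coord k v.2 2 / (coord k v.2 0 + coord k v.2 1 + coord k v.2 2)),
    (coord k v.2 0 - coord k v.2 1) / (coord k v.2 0 + coord k v.2 1 + coord k v.2 2))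

lemma signOf_mul_self (s : Bool) : signOf s * signOf s = 1 := by cases s <;> simp [signOf]

lemma one_le_signOf_mul (s : Bool) (w : Fin 3 ⊕ Fin (3 * k)) :
    1 ≤ signOf s * (drawPos k (s, w)).1 := by
  have h := coord_sum_pos w
  have h2 : coord k w 2 / (coord k w 0 + coord k w 1 + coord k w 2) ≤ 1 := by
    rw [div_le_one h]
    linarith [coord_nonneg w 0, coord_nonneg w 1]
  rw [drawPos, ← mul_assoc, signOf_mul_self]
  linarith

/-- A linear form in the barycentric coordinates is an affine function in the plane. -/
lemma affine_drawPos (s : Bool) (a : Fin 3 → ℝ) (w : Fin 3 ⊕ Fin (3 * k)) :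
    signOf s * ((a 0 + a 1) / 2 - a 2) * (drawPos k (s, w)).1 +
      (a 0 - a 1) / 2 * (drawPos k (s, w)).2 + (2 * a 2 - (a 0 + a 1) / 2) =
      a ⬝ᵥ coord k w / (coord k w 0 + coord k w 1 + coord k w 2) := by
  have h := (coord_sum_pos w).ne'
  have hs := signOf_mul_self s
  simp only [drawPos, dotProduct, Fin.sum_univ_three]
  generalize coord k w 0 = x at *
  generalize coord k w 1 = y at *
  generalize coord k w 2 = z at *
  field_simp
  linear_combination (a 0 + a 1 - 2 * a 2) * (2 * x + 2 * y + z) * hs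

lemma div_coord_sum_eq_zero {w : Fin 3 ⊕ Fin (3 * k)} {t : ℝ} :
    t / (coord k w 0 + coord k w 1 + coord k w 2) = 0 ↔ t = 0 := by
  rw [div_eq_zero_iff, or_iff_left (coord_sum_pos w).ne']

/-- The vertices of a copy are separated by linear forms in the barycentric coordinates. -/
lemma exists_separating_form {w w' : Fin 3 ⊕ Fin (3 * k)} (h : w ≠ w') :
    ∃ a : Fin 3 → ℝ, (a ⬝ᵥ coord k w = 0 ∧ a ⬝ᵥ coord k w' ≠ 0) ∨
      (a ⬝ᵥ coord k w' = 0 ∧ a ⬝ᵥ coord k w ≠ 0) := by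
  have key : ∀ (i : Fin 3) (w : Fin 3 ⊕ Fin (3 * k)), Sum.inl i ≠ w → ∃ a : Fin 3 → ℝ,
      a ⬝ᵥ coord k (Sum.inl i) = 0 ∧ a ⬝ᵥ coord k w ≠ 0 := by
    rintro i (j | n) hij
    · refine ⟨Pi.single j 1, ?_, ?_⟩
      · have : j ≠ i := fun h => hij (by rw [h])
        rw [single_one_dotProduct, coord, Pi.single_eq_of_ne this]
      · rw [single_one_dotProduct, coord, Pi.single_eq_same]
        exact one_ne_zero
    · refine ⟨Pi.single (i + 1) 1, ?_, ?_⟩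
      · rw [single_one_dotProduct, coord, Pi.single_eq_of_ne (fin_three_ne_add_one i).symm]
      · rw [single_one_dotProduct]
        exact (coord_pos n _).ne'
  rcases w with i | n
  · obtain ⟨a, ha⟩ := key i w' h
    exact ⟨a, Or.inl ha⟩
  rcases w' with i | n'
  · obtain ⟨a, ha⟩ := key i _ h.symm
    exact ⟨a, Or.inr ha⟩
  · have hk := pos_of_fin_three_mul n
    have hne : (n' : ℝ) - n ≠ 0 := by
      intro h'
      exact h (by rw [Fin.ext (Nat.cast_injective (sub_eq_zero.1 h').symm)])
    refine ⟨conicForm k (2 * n + 1) (2 * n + 1), Or.inl ⟨?_, ?_⟩⟩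
    · rw [conicForm_dotProduct_coord]; ring
    · rw [conicForm_dotProduct_coord, show (2 * n' + 1 - (2 * n + 1) : ℝ) = 2 * (n' - n) by ring]
      positivity

lemma drawPos_injective : Function.Injective (drawPos k) := by
  rintro ⟨s, w⟩ ⟨s', w'⟩ h
  obtain rfl : s = s' := by
    have h1 := one_le_signOf_mul s w
    have h2 := one_le_signOf_mul s' w'
    rw [h] at h1
    cases s <;> cases s' <;> simp [signOf] at h1 h2 ⊢ <;> linarith
  refine Prod.ext rfl ?_
  by_contra hne
  obtain ⟨a, ha⟩ := exists_separating_form hne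
  have h1 := affine_drawPos s a w
  rw [h, affine_drawPos s a w'] at h1
  rcases ha with ⟨h2, h3⟩ | ⟨h2, h3⟩
  · rw [h2, zero_div, div_coord_sum_eq_zero] at h1
    exact h3 h1
  · rw [h2, zero_div, eq_comm, div_coord_sum_eq_zero] at h1
    exact h3 h1

/-- A linear form in the barycentric coordinates separates the first edge from the second one. -/
def FormSeparates (k : ℕ) (e e' : Sym2 (Fin 3 ⊕ Fin (3 * k))) : Prop :=
  ∃ a : Fin 3 → ℝ, (∀ w ∈ e, a ⬝ᵥ coord k w ≤ 0) ∧
    ∀ w ∈ e', 0 ≤ a ⬝ᵥ coord k w ∧ (a ⬝ᵥ coord k w = 0 → w ∈ e)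

lemma FormSeparates.nonCrossing {e e' : Sym2 (Fin 3 ⊕ Fin (3 * k))} (h : FormSeparates k e e')
    (hne : e ≠ e') (hd : ¬ e'.IsDiag) (s : Bool) :
    NonCrossing (drawPos k) (e.map (Prod.mk s)) (e'.map (Prod.mk s)) := by
  obtain ⟨a, he, he'⟩ := h
  have hinj : Function.Injective (Prod.mk s : Fin 3 ⊕ Fin (3 * k) → _) := Prod.mk_right_injective s
  refine nonCrossing_of_separated ((Sym2.map.injective hinj).ne hne)
    (by rwa [Sym2.isDiag_map hinj])
    (signOf s * ((a 0 + a 1) / 2 - a 2)) ((a 0 - a 1) / 2) (2 * a 2 - (a 0 + a 1) / 2) ?_ ?_ ?_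
  · intro v hv
    obtain ⟨w, hw, rfl⟩ := Sym2.mem_map.1 hv
    rw [affine_drawPos]
    exact div_nonpos_of_nonpos_of_nonneg (he w hw) (coord_sum_pos w).le
  · intro v hv
    obtain ⟨w, hw, rfl⟩ := Sym2.mem_map.1 hv
    rw [affine_drawPos]
    exact div_nonneg (he' w hw).1 (coord_sum_pos w).le
  · intro v hv h0
    obtain ⟨w, hw, rfl⟩ := Sym2.mem_map.1 hv
    rw [affine_drawPos, div_coord_sum_eq_zero] at h0
    exact Sym2.mem_map.2 ⟨w, (he' w hw).2 h0, rfl⟩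

/-- The edges within a copy: a side of the triangle, an edge of a fan or an edge of the cycle. -/
def IsCopyEdge (k : ℕ) (e : Sym2 (Fin 3 ⊕ Fin (3 * k))) : Prop :=
  (∃ i, e = s(Sum.inl (i + 1), Sum.inl (i + 2))) ∨
  (∃ (i : Fin 3) (n : Fin (3 * k)), n.val / k = i.val ∧ e = s(Sum.inl i, Sum.inr n)) ∨
  ∃ x y, (SimpleGraph.cycleGraph (3 * k)).Adj x y ∧ e = s(Sum.inr x, Sum.inr y)

lemma IsCopyEdge.not_isDiag {e : Sym2 (Fin 3 ⊕ Fin (3 * k))} (h : IsCopyEdge k e) :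
    ¬ e.IsDiag := by
  rcases h with ⟨i, rfl⟩ | ⟨i, n, -, rfl⟩ | ⟨x, y, h, rfl⟩
  · simp
  · simp
  · simpa using h.ne

lemma side_separates (i : Fin 3) (e : Sym2 (Fin 3 ⊕ Fin (3 * k))) :
    FormSeparates k s(Sum.inl (i + 1), Sum.inl (i + 2)) e := by
  refine ⟨Pi.single i 1, fun w hw => ?_, fun w hw => ?_⟩
  · rw [single_one_dotProduct]
    rcases Sym2.mem_iff.1 hw with rfl | rfl
    · rw [coord, Pi.single_eq_of_ne (fin_three_ne_add_one i)]
    · rw [coord, Pi.single_eq_of_ne (fin_three_ne_add_two i)]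
  · rw [single_one_dotProduct]
    refine ⟨coord_nonneg w i, fun h => ?_⟩
    rcases w with j | n
    · rcases fin_three_trichotomy i j with rfl | rfl | rfl
      · simp [coord] at h
      · simp
      · simp
    · exact absurd h (coord_pos n i).ne'

lemma rim_separates_rim {x y x' y' : Fin (3 * k)} (h : (SimpleGraph.cycleGraph (3 * k)).Adj x y) :
    FormSeparates k s(Sum.inr x, Sum.inr y) s(Sum.inr x', Sum.inr y') := by
  obtain ⟨a, ha⟩ := exists_rim_form h
  refine ⟨a, fun w hw => ?_, fun w hw => ?_⟩
  · rcases Sym2.mem_iff.1 hw with rfl | rfl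
    · exact ((ha x).2.2 (Or.inl rfl)).le
    · exact ((ha y).2.2 (Or.inr rfl)).le
  · obtain ⟨z, rfl⟩ : ∃ z, w = Sum.inr z := by
      rcases Sym2.mem_iff.1 hw with rfl | rfl
      · exact ⟨x', rfl⟩
      · exact ⟨y', rfl⟩
    refine ⟨(ha z).1, fun h0 => ?_⟩
    rcases (ha z).2.1 h0 with rfl | rfl <;> simp

lemma fan_separates_rim {i : Fin 3} {n : Fin (3 * k)} (h : n.val / k = i.val)
    (x y : Fin (3 * k)) : FormSeparates k s(Sum.inl i, Sum.inr n) s(Sum.inr x, Sum.inr y) := by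
  have hk := pos_of_fin_three_mul n
  refine ⟨conicForm k (2 * n + 1) (2 * n + 1), fun w hw => ?_, fun w hw => ?_⟩
  · rcases Sym2.mem_iff.1 hw with rfl | rfl
    · exact (conicForm_dotProduct_apex h).le
    · rw [conicForm_dotProduct_coord]; simp
  · obtain ⟨z, rfl⟩ : ∃ z, w = Sum.inr z := by
      rcases Sym2.mem_iff.1 hw with rfl | rfl
      · exact ⟨x, rfl⟩
      · exact ⟨y, rfl⟩
    rw [conicForm_dotProduct_coord]
    refine ⟨mul_nonneg (by positivity) (mul_self_nonneg _), fun h0 => ?_⟩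
    rw [mul_eq_zero, or_iff_right (by positivity), mul_self_eq_zero] at h0
    have : z = n := Fin.ext (Nat.cast_injective (R := ℝ) (by linarith))
    simp [this]

lemma fan_separates_fan {i j : Fin 3} {n m : Fin (3 * k)} (h : n.val / k = i.val)
    (h' : m.val / k = j.val) (hne : (s(Sum.inl i, Sum.inr n) : Sym2 (Fin 3 ⊕ Fin (3 * k))) ≠
      s(Sum.inl j, Sum.inr m)) :
    FormSeparates k s(Sum.inl i, Sum.inr n) s(Sum.inl j, Sum.inr m) := by
  by_cases hij : i = j
  · subst hij
    obtain ⟨a, h1, h2, h3⟩ := exists_fan_form h h' (fun h => hne (by rw [h]))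
    refine ⟨a, fun w hw => ?_, fun w hw => ?_⟩
    · rcases Sym2.mem_iff.1 hw with rfl | rfl
      · exact h1.le
      · exact h2.le
    · rcases Sym2.mem_iff.1 hw with rfl | rfl
      · exact ⟨h1.ge, fun _ => by simp⟩
      · exact ⟨h3.le, fun h0 => absurd h0 h3.ne'⟩
  · have hv : ∀ w, (Pi.single j 1 - Pi.single i 1 : Fin 3 → ℝ) ⬝ᵥ coord k w =
        coord k w j - coord k w i := fun w => by
      rw [sub_dotProduct, single_one_dotProduct, single_one_dotProduct]
    refine ⟨Pi.single j 1 - Pi.single i 1, fun w hw => ?_, fun w hw => ?_⟩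
    · rw [hv]
      rcases Sym2.mem_iff.1 hw with rfl | rfl
      · simp [coord, Ne.symm hij]
      · exact (sub_neg.2 (coord_lt_coord h (Ne.symm hij))).le
    · rw [hv]
      have : 0 < coord k w j - coord k w i := by
        rcases Sym2.mem_iff.1 hw with rfl | rfl
        · simp [coord, hij]
        · exact sub_pos.2 (coord_lt_coord h' hij)
      exact ⟨this.le, fun h0 => absurd h0 this.ne'⟩

lemma IsCopyEdge.nonCrossing {e e' : Sym2 (Fin 3 ⊕ Fin (3 * k))} (he : IsCopyEdge k e)
    (he' : IsCopyEdge k e') (hne : e ≠ e') (s : Bool) :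
    NonCrossing (drawPos k) (e.map (Prod.mk s)) (e'.map (Prod.mk s)) := by
  have hd := he.not_isDiag
  have hd' := he'.not_isDiag
  suffices h : FormSeparates k e e' ∨ FormSeparates k e' e from
    h.elim (fun h => h.nonCrossing hne hd' s) (fun h => (h.nonCrossing hne.symm hd s).symm)
  rcases he with ⟨i, rfl⟩ | ⟨i, n, h, rfl⟩ | ⟨x, y, h, rfl⟩
  · exact Or.inl (side_separates i _)
  · rcases he' with ⟨j, rfl⟩ | ⟨j, m, h', rfl⟩ | ⟨x', y', h', rfl⟩
    · exact Or.inr (side_separates j _)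
    · exact Or.inl (fan_separates_fan h h' hne)
    · exact Or.inl (fan_separates_rim h _ _)
  · rcases he' with ⟨j, rfl⟩ | ⟨j, m, h', rfl⟩ | ⟨x', y', h', rfl⟩
    · exact Or.inr (side_separates j _)
    · exact Or.inr (fan_separates_rim h' _ _)
    · exact Or.inl (rim_separates_rim h)

/-- The two copies are separated by the axis of symmetry. -/
lemma nonCrossing_copies {e e' : Sym2 (Fin 3 ⊕ Fin (3 * k))} (hd : ¬ e'.IsDiag) {s s' : Bool}
    (hs : s ≠ s') :
    NonCrossing (drawPos k) (e.map (Prod.mk s)) (e'.map (Prod.mk s')) := by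
  have hpos : ∀ w, 0 < signOf s' * (drawPos k (s', w)).1 := fun w =>
    zero_lt_one.trans_le (one_le_signOf_mul s' w)
  refine nonCrossing_of_separated ?_ (by rwa [Sym2.isDiag_map (Prod.mk_right_injective s')])
    (signOf s') 0 0 ?_ ?_ ?_
  · induction e with | _ u v
    intro he
    have : (s, u) ∈ e'.map (Prod.mk s') := he ▸ Sym2.mem_mk_left (s, u) (s, v)
    obtain ⟨w, -, hw⟩ := Sym2.mem_map.1 this
    exact hs (congrArg Prod.fst hw).symm
  · intro v hv
    obtain ⟨w, hw, rfl⟩ := Sym2.mem_map.1 hv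
    have h1 := one_le_signOf_mul s w
    have h2 : signOf s = - signOf s' := by cases s <;> cases s' <;> simp [signOf] at hs ⊢
    rw [h2] at h1
    linarith
  · intro v hv
    obtain ⟨w, hw, rfl⟩ := Sym2.mem_map.1 hv
    linarith [hpos w]
  · intro v hv
    obtain ⟨w, hw, rfl⟩ := Sym2.mem_map.1 hv
    intro h
    linarith [hpos w]

/-- The edge joining the copies of the vertex `i` of the triangle. -/
def matchingEdge (k : ℕ) (i : Fin 3) : Sym2 (Bool × (Fin 3 ⊕ Fin (3 * k))) :=
  s((true, Sum.inl i), (false, Sum.inl i))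

lemma mem_matchingEdge {i : Fin 3} {v : Bool × (Fin 3 ⊕ Fin (3 * k))} :
    v ∈ matchingEdge k i ↔ v.2 = Sum.inl i := by
  obtain ⟨s, w⟩ := v
  cases s <;> simp [matchingEdge]

lemma nonCrossing_matchingEdges {i j : Fin 3} (h : i ≠ j) :
    NonCrossing (drawPos k) (matchingEdge k i) (matchingEdge k j) := by
  let y : Fin 3 → ℝ := ![1, -1, 0]
  have hy : ∀ l s, (drawPos k (s, Sum.inl l)).2 = y l := by
    intro l s
    fin_cases l <;> simp [drawPos, coord, y]
  have hij : y j - y i ≠ 0 := by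
    fin_cases i <;> fin_cases j <;> (simp [y] at h ⊢; try norm_num)
  have hj : ∀ v ∈ matchingEdge k j, 0 * (drawPos k v).1 + (y j - y i) * (drawPos k v).2 +
      -((y j - y i) * y i) = (y j - y i) ^ 2 := by
    rintro ⟨s, w⟩ hv
    obtain rfl : w = Sum.inl j := mem_matchingEdge.1 hv
    rw [hy]; ring
  refine nonCrossing_of_separated ?_ (by simp [matchingEdge]) 0 (y j - y i)
    (-((y j - y i) * y i)) ?_ ?_ ?_
  · intro he
    have : ((true, Sum.inl i) : Bool × (Fin 3 ⊕ Fin (3 * k))) ∈ matchingEdge k j :=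
      he ▸ mem_matchingEdge.2 rfl
    exact h (Sum.inl_injective (mem_matchingEdge.1 this))
  · rintro ⟨s, w⟩ hv
    obtain rfl : w = Sum.inl i := mem_matchingEdge.1 hv
    rw [hy]; linarith
  · intro v hv
    rw [hj v hv]; positivity
  · intro v hv h0
    rw [hj v hv] at h0
    exact absurd h0 (by positivity)

lemma nonCrossing_matchingEdge_copyEdge (i : Fin 3) {e : Sym2 (Fin 3 ⊕ Fin (3 * k))}
    (hd : ¬ e.IsDiag) (s : Bool) :
    NonCrossing (drawPos k) (matchingEdge k i) (e.map (Prod.mk s)) := by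
  -- These linear forms are nonnegative on the triangle and vanish only at the vertex `i`.
  let a : Fin 3 → ℝ := ![![0, 2, 1], ![2, 0, 1], ![1, 1, 0]] i
  have ha : a i = 0 ∧ ∀ j, j ≠ i → 0 < a j := by
    constructor
    · fin_cases i <;> rfl
    · intro j hj
      fin_cases i <;> fin_cases j <;> simp [a] at hj ⊢
  have hdot : ∀ w : Fin 3 ⊕ Fin (3 * k), 0 ≤ a ⬝ᵥ coord k w ∧
      (a ⬝ᵥ coord k w = 0 → w = Sum.inl i) := by
    have ha0 : ∀ j, 0 ≤ a j := fun j => by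
      by_cases hj : j = i
      · rw [hj, ha.1]
      · exact (ha.2 j hj).le
    intro w
    refine ⟨Finset.sum_nonneg fun j _ => mul_nonneg (ha0 j) (coord_nonneg w j), fun h => ?_⟩
    rcases w with j | n
    · rw [coord, dotProduct_single_one] at h
      by_contra hne
      exact (ha.2 j fun h => hne (by rw [h])).ne' h
    · have : 0 < a ⬝ᵥ coord k (Sum.inr n) :=
        Finset.sum_pos' (fun j _ => mul_nonneg (ha0 j) (coord_pos n j).le)
          ⟨i + 1, Finset.mem_univ _,
            mul_pos (ha.2 _ (fin_three_ne_add_one i).symm) (coord_pos n _)⟩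
      exact absurd h this.ne'
  refine nonCrossing_of_separated ?_ (by rwa [Sym2.isDiag_map (Prod.mk_right_injective s)])
    (signOf s * ((a 0 + a 1) / 2 - a 2)) ((a 0 - a 1) / 2) (2 * a 2 - (a 0 + a 1) / 2) ?_ ?_ ?_
  · intro he
    have : ((!s, Sum.inl i) : Bool × (Fin 3 ⊕ Fin (3 * k))) ∈ e.map (Prod.mk s) :=
      he ▸ mem_matchingEdge.2 rfl
    obtain ⟨w, -, hw⟩ := Sym2.mem_map.1 this
    have := congrArg Prod.fst hw
    cases s <;> simp at this
  · rintro ⟨t, w⟩ hv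
    obtain rfl : w = Sum.inl i := mem_matchingEdge.1 hv
    fin_cases i <;> cases s <;> cases t <;> simp [a, drawPos, coord, signOf] <;> norm_num
  · intro v hv
    obtain ⟨w, hw, rfl⟩ := Sym2.mem_map.1 hv
    rw [affine_drawPos]
    exact div_nonneg (hdot w).1 (coord_sum_pos w).le
  · intro v hv h0
    obtain ⟨w, hw, rfl⟩ := Sym2.mem_map.1 hv
    rw [affine_drawPos, div_coord_sum_eq_zero] at h0
    exact mem_matchingEdge.2 ((hdot w).2 h0)

/-- The edges of `G_d` are the edges within the copies and the edges joining the triangles. -/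
lemma edge_cases {d : ℕ} {e : Sym2 (PrismCycleVertex d)} (he : e ∈ (prismCycleGraph d).edgeSet) :
    (∃ i, e = matchingEdge (d - 3) i) ∨
      ∃ (s : Bool) (e₀ : Sym2 (Fin 3 ⊕ Fin (3 * (d - 3)))), IsCopyEdge (d - 3) e₀ ∧
        e = e₀.map (Prod.mk s) := by
  induction e with | _ u v
  obtain ⟨s, i | x⟩ := u <;> obtain ⟨t, j | y⟩ := v
  · rcases he with ⟨rfl, hij⟩ | ⟨hst, rfl⟩
    · right
      rcases fin_three_trichotomy i j with rfl | rfl | rfl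
      · exact absurd rfl hij
      · refine ⟨s, _, Or.inl ⟨i + 2, ?_⟩, (Sym2.map_mk _ (Sum.inl i) (Sum.inl (i + 1))).symm⟩
        rw [(fin_three_add i).2.2.1, (fin_three_add i).2.2.2]
      · refine ⟨s, _, Or.inl ⟨i + 1, ?_⟩, (Sym2.map_mk _ (Sum.inl i) (Sum.inl (i + 2))).symm⟩
        rw [(fin_three_add i).1, (fin_three_add i).2.1, Sym2.eq_swap]
    · left
      refine ⟨i, ?_⟩
      cases s <;> cases t <;> simp [matchingEdge] at hst ⊢
  · obtain ⟨rfl, h⟩ := he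
    exact Or.inr ⟨s, _, Or.inr (Or.inl ⟨i, y, h, rfl⟩), rfl⟩
  · obtain ⟨rfl, h⟩ := he
    exact Or.inr ⟨s, _, Or.inr (Or.inl ⟨j, x, h, rfl⟩), Sym2.eq_swap⟩
  · obtain ⟨rfl, h⟩ := he
    exact Or.inr ⟨s, _, Or.inr (Or.inr ⟨x, y, h, rfl⟩), rfl⟩

theorem exists_straight_drawing_prismCycleGraph (d : ℕ) :
    ∃ (D : PlaneDrawing (prismCycleGraph d)) (S : Finset (Submodule ℝ (ℝ × ℝ))),
      D.HasBendsSlopes 0 S := by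
  refine exists_straight_drawing (pos := drawPos (d - 3)) drawPos_injective ?_ ?_
  · rintro ⟨s, i | x⟩
    · exact ⟨_, adj_corner_not s i⟩
    · have hlt : x.val / (d - 3) < 3 :=
        (Nat.div_lt_iff_lt_mul (by have := x.pos; omega)).2 x.2
      exact ⟨_, (adj_corner_rim s (i := ⟨_, hlt⟩) rfl).symm⟩
  · intro e he e' he' hne
    rcases edge_cases he with ⟨i, rfl⟩ | ⟨s, e, h, rfl⟩ <;>
      rcases edge_cases he' with ⟨i', rfl⟩ | ⟨s', e', h', rfl⟩
    · exact nonCrossing_matchingEdges fun h => hne (by rw [h])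
    · exact nonCrossing_matchingEdge_copyEdge i h'.not_isDiag s'
    · exact (nonCrossing_matchingEdge_copyEdge i' h.not_isDiag s).symm
    · by_cases hs : s = s'
      · subst hs
        exact h.nonCrossing h' (fun h => hne (by rw [h])) s
      · exact nonCrossing_copies h'.not_isDiag hs

end Drawing

/-! ### Degrees -/

section Degree

variable {d : ℕ}

lemma eq_nbr_of_adj_corner {s : Bool} {i : Fin 3} {v : PrismCycleVertex d}
    (h : (prismCycleGraph d).Adj (corner s i) v) :
    v = corner (!s) i ∨ ∃ y, v = nbr s (i, y) := by
  obtain ⟨t, j | x⟩ := v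
  · rcases h with ⟨rfl, hij⟩ | ⟨hst, rfl⟩
    · right
      rcases fin_three_trichotomy i j with rfl | rfl | rfl
      · exact absurd rfl hij
      · exact ⟨Sum.inl true, rfl⟩
      · exact ⟨Sum.inl false, rfl⟩
    · left
      cases s <;> cases t <;> simp at hst ⊢
  · obtain ⟨rfl, h⟩ := h
    refine Or.inr ⟨Sum.inr (finProdFinEquiv.symm x).2, ?_⟩
    have hi : (finProdFinEquiv.symm x).1 = i := Fin.ext h
    rw [nbr, ← hi, Prod.mk.eta, Equiv.apply_symm_apply]

lemma degree_corner (hd : 3 ≤ d) (s : Bool) (i : Fin 3) :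
    (prismCycleGraph d).degree (corner s i) = d := by
  have hset : (prismCycleGraph d).neighborFinset (corner s i) =
      insert (corner (!s) i) (Finset.univ.image fun y => nbr s (i, y)) := by
    ext v
    simp only [SimpleGraph.mem_neighborFinset, Finset.mem_insert, Finset.mem_image,
      Finset.mem_univ, true_and]
    refine ⟨fun h => (eq_nbr_of_adj_corner h).imp_right fun ⟨y, hy⟩ => ⟨y, hy.symm⟩, ?_⟩
    rintro (rfl | ⟨y, rfl⟩)
    · exact adj_corner_not s i
    · exact adj_nbr s (i, y)
  have hinj : Function.Injective fun y : Bool ⊕ Fin (d - 3) => nbr (d := d) s (i, y) := by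
    intro y y' h
    have h' := @nbr_injective d s (i, y) (i, y') (Prod.ext rfl h)
    exact congrArg Prod.snd h'
  have hcopy : ∀ y : Bool ⊕ Fin (d - 3), (nbr s (i, y)).1 = s := by
    rintro ((_ | _) | _) <;> rfl
  rw [← SimpleGraph.card_neighborFinset_eq_degree, hset, Finset.card_insert_of_notMem,
    Finset.card_image_of_injective _ hinj]
  · simp; omega
  · intro h
    obtain ⟨y, -, hy⟩ := Finset.mem_image.1 h
    have := hcopy y
    rw [hy] at this
    cases s <;> simp at this

lemma cycleGraph_degree_le_two {n : ℕ} (hn : 2 ≤ n) (x : Fin n) :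
    (SimpleGraph.cycleGraph n).degree x ≤ 2 := by
  obtain ⟨m, rfl⟩ := Nat.exists_eq_add_of_le' hn
  rw [SimpleGraph.cycleGraph_degree_two_le]
  exact Finset.card_le_two

lemma degree_rim_le (s : Bool) (x : Fin (3 * (d - 3))) :
    (prismCycleGraph d).degree (rim s x) ≤ d := by
  have hd : 4 ≤ d := by have := x.pos; omega
  have hlt : x.val / (d - 3) < 3 := (Nat.div_lt_iff_lt_mul (by omega)).2 x.2
  have hsub : (prismCycleGraph d).neighborFinset (rim s x) ⊆ insert (corner s ⟨_, hlt⟩)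
      (((SimpleGraph.cycleGraph (3 * (d - 3))).neighborFinset x).image (rim s)) := by
    rintro ⟨t, j | y⟩ h
    · obtain ⟨rfl, h'⟩ := (SimpleGraph.mem_neighborFinset _ _ _).1 h
      have : j = ⟨_, hlt⟩ := Fin.ext h'.symm
      simp [this]
    · obtain ⟨rfl, h'⟩ := (SimpleGraph.mem_neighborFinset _ _ _).1 h
      simpa using h'
  have hcyc : (SimpleGraph.cycleGraph (3 * (d - 3))).degree x ≤ 2 :=
    cycleGraph_degree_le_two (by omega) x
  calc (prismCycleGraph d).degree (rim s x)
      ≤ (((SimpleGraph.cycleGraph (3 * (d - 3))).neighborFinset x).image (rim s)).card + 1 :=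
        (Finset.card_le_card hsub).trans (Finset.card_insert_le _ _)
    _ ≤ 2 + 1 := by
        gcongr
        exact Finset.card_image_le.trans hcyc
    _ ≤ d := by omega

lemma maxDegree_prismCycleGraph (hd : 3 ≤ d) : (prismCycleGraph d).maxDegree = d := by
  apply le_antisymm
  · refine SimpleGraph.maxDegree_le_of_forall_degree_le _ _ fun v => ?_
    obtain ⟨s, i | x⟩ := v
    · exact (degree_corner hd s i).le
    · exact degree_rim_le s x
  · exact (degree_corner hd true 0).symm.le.trans (SimpleGraph.degree_le_maxDegree _ _)

end Degree

/-! ### Planarity, maximum degree and the two lower bounds -/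

theorem mainTheorem4 (d : ℕ) (hd : 3 ≤ d) :
    IsPlanarGraph (prismCycleGraph d) ∧
    (prismCycleGraph d).maxDegree = d ∧
    (3 * d - 6 : ℝ) ≤ planarSlopeNumber (prismCycleGraph d) ∧
    ∀ (D : PlaneDrawing (prismCycleGraph d)) (S : Finset (Submodule ℝ (ℝ × ℝ))),
      D.HasBendsSlopes 1 S → (3 / 4 * (d - 1) : ℝ) ≤ S.card := by
  obtain ⟨D₀, S₀, hD₀⟩ := exists_straight_drawing_prismCycleGraph d
  refine ⟨⟨D₀⟩, maxDegree_prismCycleGraph hd, ?_, fun D S hD => ?_⟩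
  · -- The infimum is attained because a straight-line drawing exists.
    obtain ⟨D, S, hS, hD⟩ := Nat.sInf_mem (s := {s : ℕ | ∃ (D : PlaneDrawing (prismCycleGraph d))
      (S : Finset (Submodule ℝ (ℝ × ℝ))), S.card ≤ s ∧ D.HasBendsSlopes 0 S})
      ⟨_, D₀, S₀, le_rfl, hD₀⟩
    have h : 3 + 3 * (d - 3) ≤ planarSlopeNumber (prismCycleGraph d) :=
      (card_le_of_straight hD).trans hS
    have h' : 3 * d ≤ planarSlopeNumber (prismCycleGraph d) + 6 := by omega
    have h'' : (3 * d : ℝ) ≤ planarSlopeNumber (prismCycleGraph d) + 6 := by exact_mod_cast h'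
    linarith
  · obtain ⟨B, -, hBS⟩ := hD.exists_bendDrawing
    obtain ⟨s, hs⟩ := B.exists_forall_upSum_hexagon_eq_one
    have h := B.card_le_of_slopeOf_mem hs fun u v huv => (hBS u v huv).1
    have h' : 3 * d ≤ 4 * S.card + 3 := by omega
    have h'' : (3 * d : ℝ) ≤ 4 * S.card + 3 := by exact_mod_cast h'
    linarith
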